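/- **Notation.** Let $q$ be a prime power, $A=\mathbb F_q[t]$, $K=\mathbb F_q(t)$, $K_\infty=\mathbb F_q((1/t))$, and let $\mathbb C_\infty$ be the completion of an algebraic closure of $K_\infty$. Fix $\tilde t\in\mathbb C_\infty$ with $t=-\tilde t^{\,q-1}$. Let $T$ be a variable independent of $t$. For $f=\sum_i f_iT^i\in\mathbb C_\infty[[T]]$ and $n\in\mathbb Z$ put $f^{(n)}=\sum_i f_i^{q^n}T^i$ (entrywise for matrices). Put $$\Omega(T)=\tilde t^{-q}\prod_{i\ge 1}\bigl(1-T/t^{q^i}\bigr),\qquad \tilde\pi=1/\Omega(t).$$ Put $D_n=\prod_{i=0}^{n-1}(t^{q^n}-t^{q^i})$, and for $n=\sum_i n_iq^i$ with $0\le n_i<q$ put $\Gamma_{n+1}=\prod_i D_i^{n_i}$. Let $H_s(T)$ $(s\ge 0)$ be defined by $$\sum_{s\ge 0}\frac{H_s(T)}{\Gamma_{s+1}|_{t=T}}x^s=\Bigl(1-\sum_{i\ge 0}\prod_{j=1}^{i}\frac{T^{q^i}-t^{q^j}}{T^{q^i}-T^{q^{j-1}}}\,x^{q^i}\Bigr)^{-1}.$$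 For $d\ge 0$ and $s\geq 1$ let $S_d(s)=\sum a^{-s}$, the sum over monic $a\in A$ of degree $d$, and for positive integers $s_1,\dots,s_r$ let $\zeta(s_1,\dots,s_r)=\sum_{d_1>\cdots>d_r\ge 0}S_{d_1}(s_1)\cdots S_{d_r}(s_r)$ (with value $1$ for the empty tuple). **Dual $t$-motives.** Let $F$ be a perfect field with a ring homomorphism $A\to F$; the image of $t$ is again written $t$. A *dual $t$-motive of rank $n$* over $F$ is a free $F[T]$-module $M$ of rank $n$ with an additive map $\sigma:M\to M$ such that $\sigma(fm)=f^{(-1)}\sigma(m)$ for $f\in F[T]$, $m\in M$, and $(T-t)^NM\subseteq\sigma M$ for some $N$. (Finite generation over the twisted polynomial ring $F[\sigma]$ is not required.) The tensor power $C^{\otimes n}$ $(n\ge 0)$ of the Carlitz motive is $F[T]$ with $\sigma f=(T-t)^nf^{(-1)}$. A square matrix $\Phi$ over $F[T]$ defines the module of row vectors over $F[T]$ with $\sigma f=f^{(-1)}\Phi$. Let $\mathbb T\subset\mathbb C_\infty[[T]]$ be the Tate algebra of series whose coefficients tend to $0$. For $F=\mathbb C_\infty$, a *rigid analytic trivialization*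 of $\Phi$ is a $\Psi\in \mathrm{GL}_n(\mathbb T)$ with $\Psi^{(-1)}=\Phi\Psi$, and a *period matrix* of $\Phi$ is the value at $T=t$ of a square matrix whose rows form an $\mathbb F_q[T]$-basis of $\{v\in\mathbb T^n: v^{(-1)}\Phi=v\}$ (row vectors) and whose entries converge at $T=t$. **Theorem.** One has $H_s(T)\in A[T]$ for all $s\ge 0$. Let $s=(s_1,\dots,s_r)$ be a tuple of positive integers. For $X$ in a commutative ring write $[[X]]$ for the diagonal matrix with entries $X^{s_1+\cdots+s_r},X^{s_2+\cdots+s_r},\dots,X^{s_r},1$. Put $D=[[T-t]]$ and $\Lambda=[[\Omega]]$. Let $Q$ be the $(r+1)\times(r+1)$ lower bidiagonal matrix with $Q_{ii}=1$ and $Q_{i+1,i}=H_{s_i-1}(T)$, and $L$ the lower triangular matrix with $L_{ii}=1$ and $$L_{ik}=\sum_{d_k>\cdots>d_{i-1}\ge 0}\ \prod_{m=k}^{i-1}\bigl(\Omega^{s_m}Q_{m+1,m}\bigr)^{(d_m)}\qquad(i>k).$$ Put $\Phi=Q^{(-1)}D$ and $\Psi=\Lambda L$. The product $\Omega$ and the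 series $L_{ik}$ converge coefficientwise, $\Omega$ is entire, $\Omega(t)\ne 0$, and the series $\zeta(s_k,\dots,s_{i-1})$ converge. Moreover: 1. $\Phi$ has entries in $A[T]$. For every perfect field $F$ with a ring homomorphism $A\to F$, it defines a dual $t$-motive $M$ of rank $r+1$ over $F$. This $M$ is an iterated extension of tensor powers of the Carlitz motive: it has a filtration $0=W_0\subset W_1\subset\cdots\subset W_{r+1}=M$ by $F[T]$-submodules stable under $\sigma$, with $W_i/W_{i-1}\cong C^{\otimes(s_i+\cdots+s_r)}$ for $1\le i\le r$ and $W_{r+1}/W_r\cong C^{\otimes 0}$; and $W_r$ is free of finite rank over $F[\sigma]$. 2. $\Psi$ is a rigid analytic trivialization of $\Phi$, and its entries are entire. 3. $\Psi^{-1}$ evaluated at $T=t$ is a period matrix of $\Phi$. It is invertible, and its inverse is $\Psi$ evaluated at $T=t$. The $(i,k)$ entry of this inverse is $$\frac{\Gamma_{s_k}\cdots\Gamma_{s_{i-1}}\,\zeta(s_k,\dots,s_{i-1})}{\tilde\pi^{\,s_k+\cdots+s_r}}\quad\text{for } i\ge k,$$ and $0$ for $i<k$. In particular its lower left entry is $\Gamma_{s_1}\cdots\Gamma_{s_r}\,\zeta(s_1,\dots,s_r)/\tilde\pi^{\,s_1+\cdots+s_r}$.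 -/

import Mathlib

open Polynomial
open scoped PowerSeries.WithPiTopology Topology

noncomputable section

namespace CarlitzMZV

/-! ### The fields `K_∞ = 𝔽_q((1/t))` and `ℂ_∞` -/

section Fields

variable (Fq : Type*) [Field Fq]

instance ratFuncDecidableEq : DecidableEq (RatFunc Fq) := Classical.decEq _

/-- `K_∞`, the completion of `K = 𝔽_q(t)` at the place `∞`. -/
abbrev KInfty := RatFunc.CompletionAtInfty Fq

lemma kInfty_v_X :
    (Valued.v : Valuation (KInfty Fq) (WithZero (Multiplicative ℤ)))
      (algebraMap (RatFunc Fq) (KInfty Fq) RatFunc.X) = WithZero.exp 1 := by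
  rw [RatFunc.valuedCompletionAtInfty.def]
  let _ := RatFunc.inftyValued Fq
  have h : algebraMap (RatFunc Fq) (KInfty Fq) RatFunc.X =
      ((RatFunc.X : RatFunc Fq) : UniformSpace.Completion (RatFunc Fq)) := rfl
  rw [h]
  refine (Valued.extensionValuation_apply_coe _).trans ?_
  exact RatFunc.inftyValuation.X Fq

variable [Fintype Fq]

lemma one_lt_card_nnreal : (1 : NNReal) < (Fintype.card Fq : NNReal) := by
  exact_mod_cast Fintype.one_lt_card

/-- The valuation of `K_∞` as an absolute value, normalized by `|t| = q`. -/
instance kInftyRankOne :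
    (Valued.v : Valuation (KInfty Fq) (WithZero (Multiplicative ℤ))).RankOne where
  hom' := (WithZeroMulInt.toNNReal (one_lt_card_nnreal Fq).ne_zero).comp
    MonoidWithZeroHom.ValueGroup₀.embedding
  strictMono' := (WithZeroMulInt.toNNReal_strictMono (one_lt_card_nnreal Fq)).comp
    MonoidWithZeroHom.ValueGroup₀.embedding_strictMono
  exists_val_nontrivial :=
    ⟨algebraMap (RatFunc Fq) (KInfty Fq) RatFunc.X, by rw [kInfty_v_X]; simp, by
      rw [kInfty_v_X]; simp⟩

instance kInftyNormedField : NontriviallyNormedField (KInfty Fq) :=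
  Valued.toNontriviallyNormedField (KInfty Fq) (WithZero (Multiplicative ℤ))

instance : IsUltrametricDist (KInfty Fq) :=
  inferInstanceAs (@IsUltrametricDist (KInfty Fq)
    (Valued.toNormedField (KInfty Fq) (WithZero (Multiplicative ℤ))).toMetricSpace.toDist)

instance : CompleteSpace (KInfty Fq) :=
  letI := RatFunc.inftyValued Fq
  inferInstanceAs (CompleteSpace (UniformSpace.Completion (RatFunc Fq)))

/-- An algebraic closure of `K_∞`, with the unique extension of the absolute value. -/
abbrev KInftyBar := AlgebraicClosure (KInfty Fq)

instance kInftyBarNormedField : NormedField (KInftyBar Fq) :=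
  spectralNorm.normedField (KInfty Fq) (KInftyBar Fq)

/-- `ℂ_∞`, the completion of the algebraic closure of `K_∞`. -/
def CInfty : Type _ := UniformSpace.Completion (KInftyBar Fq)

instance : NormedField (CInfty Fq) :=
  inferInstanceAs (NormedField (UniformSpace.Completion (KInftyBar Fq)))

instance : CompleteSpace (CInfty Fq) :=
  inferInstanceAs (CompleteSpace (UniformSpace.Completion (KInftyBar Fq)))


/-- The embedding of the algebraic closure of `K_∞` in `ℂ_∞`. -/
def barToCInfty : KInftyBar Fq →+* CInfty Fq :=
  algebraMap (KInftyBar Fq) (UniformSpace.Completion (KInftyBar Fq))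

/-- The embedding of `K = 𝔽_q(t)` in `ℂ_∞`. -/
def ratFuncToCInfty : RatFunc Fq →+* CInfty Fq :=
  ((barToCInfty Fq).comp (algebraMap (KInfty Fq) (KInftyBar Fq))).comp
    (algebraMap (RatFunc Fq) (KInfty Fq))

instance : Algebra Fq (CInfty Fq) :=
  ((ratFuncToCInfty Fq).comp (algebraMap Fq (RatFunc Fq))).toAlgebra

/-- The variable `t`, as an element of `ℂ_∞`. -/
def tInfty : CInfty Fq := ratFuncToCInfty Fq RatFunc.X

/-- `ℂ_∞` is perfect, so that Frobenius can be inverted on it. -/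
instance : PerfectField (CInfty Fq) := by
  obtain ⟨p, hp⟩ := CharP.exists Fq
  have : Fact p.Prime := ⟨CharP.char_is_prime Fq p⟩
  have : CharP (CInfty Fq) p := charP_of_injective_algebraMap' Fq p
  have : ExpChar (CInfty Fq) p := .prime Fact.out
  suffices h : Function.Surjective (frobenius (CInfty Fq) p) by
    have : PerfectRing (CInfty Fq) p := PerfectRing.ofSurjective _ p h
    exact PerfectRing.toPerfectField _ p
  have hp0 : p ≠ 0 := (Fact.out : p.Prime).ne_zero
  have key : ∀ a b : CInfty Fq, dist (a ^ p) (b ^ p) = dist a b ^ p := by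
    intro a b
    rw [dist_eq_norm, dist_eq_norm, ← sub_pow_expChar, norm_pow]
  have hd : DenseRange (barToCInfty Fq) :=
    UniformSpace.Completion.denseRange_coe
  intro x
  have hx : x ∈ closure (Set.range (frobenius (CInfty Fq) p)) := by
    refine closure_mono ?_ (hd x)
    rintro _ ⟨y, rfl⟩
    obtain ⟨z, hz⟩ := IsAlgClosed.exists_pow_nat_eq y (Nat.pos_of_ne_zero hp0)
    exact ⟨barToCInfty Fq z, by rw [frobenius_def, ← map_pow, hz]⟩
  obtain ⟨u, hu, hux⟩ := mem_closure_iff_seq_limit.1 hx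
  choose v hv using hu
  have hv' : ∀ n, v n ^ p = u n := fun n => by rw [← hv n, frobenius_def]
  have hc : CauchySeq v := by
    rw [Metric.cauchySeq_iff]
    intro ε hε
    obtain ⟨N, hN⟩ := Metric.cauchySeq_iff.1 hux.cauchySeq (ε ^ p) (by positivity)
    refine ⟨N, fun m hm n hn => ?_⟩
    have := hN m hm n hn
    rw [← hv', ← hv', key] at this
    exact lt_of_pow_lt_pow_left₀ p hε.le this
  obtain ⟨y, hy⟩ := cauchySeq_tendsto_of_complete hc
  refine ⟨y, ?_⟩
  rw [frobenius_def]
  refine tendsto_nhds_unique (hy.pow p) ?_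
  simpa only [hv'] using hux

/-- A `(q-1)`-st root of `-t` exists in `ℂ_∞`. -/
lemma exists_tTilde : ∃ τ : CInfty Fq, tInfty Fq = -τ ^ (Fintype.card Fq - 1) := by
  have h1 : 0 < Fintype.card Fq - 1 := Nat.sub_pos_of_lt Fintype.one_lt_card
  obtain ⟨z, hz⟩ := IsAlgClosed.exists_pow_nat_eq
    (-(algebraMap (KInfty Fq) (KInftyBar Fq)
      (algebraMap (RatFunc Fq) (KInfty Fq) RatFunc.X))) h1
  refine ⟨barToCInfty Fq z, ?_⟩
  rw [← map_pow, hz, map_neg, neg_neg]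
  rfl

end Fields

/-! ### Twisting -/

section Twisting

variable (Fq : Type*) [Field Fq] [Fintype Fq] {F : Type*} [Field F] [PerfectField F] [Algebra Fq F]

variable (F) in
/-- The automorphism `x ↦ x ^ q` of a perfect field `F` containing `𝔽_q`. -/
def qFrob : F ≃ₐ[Fq] F := FiniteField.frobeniusAlgEquiv Fq F (ringExpChar F)

/-- The twist `f ↦ f^{(n)}` of polynomials in `T`: the coefficients are raised to the power
`q ^ n`. -/
def polyTwist (n : ℤ) : F[X] →+* F[X] :=
  Polynomial.mapRingHom ((qFrob Fq F ^ n : F ≃ₐ[Fq] F) : F →+* F)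

/-- The twist `f ↦ f^{(n)}` of power series in `T`: the coefficients are raised to the power
`q ^ n`. -/
def twist (n : ℤ) : PowerSeries F →+* PowerSeries F :=
  PowerSeries.map ((qFrob Fq F ^ n : F ≃ₐ[Fq] F) : F →+* F)

end Twisting

/-! ### Dual `t`-motives

`F` is a perfect field containing `𝔽_q`, with an element `θ`, the image of `t` under a ring
homomorphism `A = 𝔽_q[t] → F`. The variable of `F[X]` is `T`. A left `F[T, σ]`-module is an
`F[T]`-module with an additive `σ` satisfying `σ (f • m) = f^{(-1)} • σ m`. -/

section Motives

variable (Fq : Type*) [Field Fq] [Fintype Fq] {F : Type*} [Field F] [PerfectField F] [Algebra Fq F]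
variable {M : Type*} [AddCommGroup M] [Module F[X] M]

/-- `(M, σ)` is a dual `t`-motive of rank `n`: a left `F[T, σ]`-module which is free of rank `n`
over `F[T]` and such that `(T - t) ^ N M ⊆ σ M` for some `N`. (Finite generation over `F[σ]`
is not included, so that the trivial object `C^{⊗ 0}` is admitted.) -/
structure IsDualTMotive (θ : F) (σ : M →+ M) (n : ℕ) : Prop where
  free : Module.Free F[X] M
  finite : Module.Finite F[X] M
  finrank_eq : Module.finrank F[X] M = n
  semilinear : ∀ (f : F[X]) (m : M), σ (f • m) = polyTwist Fq (-1) f • σ m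
  cokernel : ∃ N : ℕ, ∀ m : M, ∃ m' : M, σ m' = (X - C θ) ^ N • m

/-- The left `F[T, σ]`-module with underlying module `F[T]^ι` (row vectors, standard basis `e`)
given by the matrix `Φ`: `σ e = Φ e`, that is, `σ f = f^{(-1)} Φ`. -/
def motiveSigma {ι : Type*} [Fintype ι] (Φ : Matrix ι ι F[X]) : (ι → F[X]) →+ (ι → F[X]) where
  toFun f := Matrix.vecMul (fun j => polyTwist Fq (-1) (f j)) Φ
  map_zero' := by
    have : (fun j : ι => polyTwist Fq (-1) ((0 : ι → F[X]) j)) = 0 := by ext j : 1; simp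
    rw [this, Matrix.zero_vecMul]
  map_add' f g := by
    have : (fun j : ι => polyTwist Fq (-1) ((f + g) j)) =
        (fun j => polyTwist Fq (-1) (f j)) + (fun j => polyTwist Fq (-1) (g j)) := by
      ext j : 1; simp
    rw [this, Matrix.add_vecMul]

/-- The tensor power `C^{⊗ n}` of the Carlitz motive: `F[T]` with `σ f = (T - t) ^ n f^{(-1)}`. -/
def carlitzSigma (θ : F) (n : ℕ) : F[X] →+ F[X] :=
  (AddMonoidHom.mulLeft ((X - C θ) ^ n)).comp (polyTwist Fq (-1) : F[X] →+* F[X]).toAddMonoidHom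

/-- `0 = W 0 ⊆ W 1 ⊆ … ⊆ W n = M` is a filtration of `(M, σ)` by left `F[T, σ]`-submodules with
`W (i + 1) / W i` isomorphic to the tensor power `C^{⊗ d i}` of the Carlitz motive. -/
structure IsCarlitzFiltration (θ : F) (σ : M →+ M) {n : ℕ} (d : Fin n → ℕ)
    (W : Fin (n + 1) → Submodule F[X] M) : Prop where
  bot : W 0 = ⊥
  top : W (Fin.last n) = ⊤
  le : ∀ i : Fin n, W i.castSucc ≤ W i.succ
  stable : ∀ i, ∀ m ∈ W i, σ m ∈ W i
  quotient : ∀ i : Fin n, ∃ π : W i.succ →ₗ[F[X]] F[X],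
    Function.Surjective π ∧
    (∀ m : W i.succ, π m = 0 ↔ (m : M) ∈ W i.castSucc) ∧
    ∀ m m' : W i.succ, (m' : M) = σ m → π m' = carlitzSigma Fq θ (d i) (π m)

/-- The `σ`-stable subspace `W` is free of finite rank over the twisted polynomial ring
`F[σ] = ⨁ F σ ^ n`: there are `b₁, …, b_k` such that the `σ ^ n b_i` form an `F`-basis of `W`. -/
def IsSigmaFree [Module F M] (σ : M →+ M) (W : Submodule F M) : Prop :=
  ∃ (k : ℕ) (b : Fin k → M),
    LinearIndependent F (fun p : Fin k × ℕ => σ^[p.2] (b p.1)) ∧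
    Submodule.span F (Set.range fun p : Fin k × ℕ => σ^[p.2] (b p.1)) = W

end Motives

/-! ### Rigid analytic trivializations and period matrices -/

section Periods

variable (Fq : Type*) [Field Fq] [Fintype Fq]
variable {L : Type*} [NormedField L] [PerfectField L] [Algebra Fq L]

/-- The value at `T = a` of a power series in `T`. -/
def evalAt (a : L) (f : PowerSeries L) : L := ∑' n, PowerSeries.coeff n f * a ^ n

variable {ι : Type*} [Fintype ι] [DecidableEq ι]

/-- `Ψ` is a rigid analytic trivialization of `Φ`: it is an invertible matrix over the Tate algebra
of power series converging on the closed unit disk, and `Ψ^{(-1)} = Φ Ψ`. -/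
structure IsRigidAnalyticTrivialization (Φ Ψ : Matrix ι ι (PowerSeries L)) : Prop where
  restricted : ∀ i j, PowerSeries.IsRestricted 1 (Ψ i j)
  isUnit_det : IsUnit Ψ.det
  restricted_inv : ∀ i j, PowerSeries.IsRestricted 1 (Ψ⁻¹ i j)
  uniformizability : Ψ.map (twist Fq (-1)) = Φ * Ψ

/-- `v`, a row vector over the Tate algebra, represents a `σ`-invariant element of the base change
to the Tate algebra of the module defined by `Φ`: `v^{(-1)} Φ = v`. -/
def IsSigmaInvariant (Φ : Matrix ι ι (PowerSeries L)) (v : ι → PowerSeries L) : Prop :=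
  (∀ j, PowerSeries.IsRestricted 1 (v j)) ∧
    Matrix.vecMul (fun j => twist Fq (-1) (v j)) Φ = v

/-- The embedding `𝔽_q[T] → L⟦T⟧`. -/
def constPoly : Fq[X] →+* PowerSeries L :=
  (Polynomial.coeToPowerSeries.ringHom).comp (Polynomial.mapRingHom (algebraMap Fq L))

/-- `P` is a period matrix of the dual `t`-motive defined by `Φ`: its rows are the values at
`T = θ` of an `𝔽_q[T]`-basis of the module of `σ`-invariants. -/
def IsPeriodMatrix (θ : L) (Φ : Matrix ι ι (PowerSeries L)) (P : Matrix ι ι L) : Prop :=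
  ∃ B : Matrix ι ι (PowerSeries L),
    (∀ i, IsSigmaInvariant Fq Φ (B i)) ∧
    (∀ v, IsSigmaInvariant Fq Φ v →
      ∃! c : ι → Fq[X], v = ∑ i, (constPoly Fq (c i) : PowerSeries L) • B i) ∧
    (∀ i j, PowerSeries.IsRestricted ‖θ‖ (B i j)) ∧
    P = B.map (evalAt θ)

end Periods

/-! ### Carlitz gamma values, the polynomials `H_s`, and multizeta values -/

section Carlitz

variable (Fq : Type*) [Field Fq] [Fintype Fq]

/-- `D_n = ∏_{i < n} (t ^ (q ^ n) - t ^ (q ^ i))`, as an element of `A = 𝔽_q[t]`. -/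
def carlitzD (n : ℕ) : Fq[X] :=
  ∏ i ∈ Finset.range n, (X ^ Fintype.card Fq ^ n - X ^ Fintype.card Fq ^ i)

/-- The Carlitz factorial `Π_n = ∏_i D_i ^ (n_i)`, with `n_i` the `i`-th digit of `n` in base `q`
(which is zero for `i > n`). -/
def carlitzFactorial (n : ℕ) : Fq[X] :=
  ∏ i ∈ Finset.range (n + 1), carlitzD Fq i ^ (n / Fintype.card Fq ^ i % Fintype.card Fq)

/-- The Carlitz gamma value `Γ_s = Π_{s - 1}`, for `s ≥ 1`. -/
def carlitzGamma (s : ℕ) : Fq[X] := carlitzFactorial Fq (s - 1)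

/-- The image in `Frac (A[T])` of an element of `A[T]`. -/
abbrev toFrac : Fq[X][X] →+* FractionRing Fq[X][X] := algebraMap _ _

/-- `1 - ∑_i (∏_{j=1}^i (T ^ (q ^ i) - t ^ (q ^ j)) / (T ^ (q ^ i) - T ^ (q ^ (j - 1)))) x ^ (q ^ i)`,
as a power series in `x` over `Frac (A[T])`; here `T` is `X` and `t` is `C X`. -/
def andersonThakurSeries : PowerSeries (FractionRing Fq[X][X]) :=
  1 - PowerSeries.mk fun n => ∑ i ∈ Finset.range (n + 1),
    if n = Fintype.card Fq ^ i then
      ∏ j ∈ Finset.Icc 1 i,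
        toFrac Fq (X ^ Fintype.card Fq ^ i - C X ^ Fintype.card Fq ^ j) /
          toFrac Fq (X ^ Fintype.card Fq ^ i - X ^ Fintype.card Fq ^ (j - 1))
    else 0

/-- The polynomials `H_s(T) ∈ A[T]` satisfy the generating series identity which defines them:
`∑_s (H_s(T) / Γ_{s + 1}|_{t = T}) x ^ s` is the inverse of the series above. -/
def IsAndersonThakur (H : ℕ → Fq[X][X]) : Prop :=
  (PowerSeries.mk fun s =>
    toFrac Fq (H s) / toFrac Fq ((carlitzGamma Fq (s + 1)).map C)) = (andersonThakurSeries Fq)⁻¹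

end Carlitz

section Multizeta

variable (Fq : Type*) [Field Fq] {L : Type*} [NormedField L] [Algebra Fq L]

/-- The power sum `S_d(s)`, the sum of `1 / a ^ s` over the monic `a ∈ 𝔽_q[t]` of degree `d`,
with `t` specialized to `θ`. -/
def powerSum (θ : L) (d s : ℕ) : L :=
  ∑ᶠ a ∈ {a : Fq[X] | a.Monic ∧ a.natDegree = d}, 1 / aeval θ a ^ s

/-- The product `∏_i S_{d_i}(s_i)`. -/
def multiPowerSum (θ : L)
    {ι : Type*} [Fintype ι] (s d : ι → ℕ) : L :=
  ∏ i, powerSum Fq θ (d i) (s i)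

/-- The multizeta value `ζ(s)`, the sum of the `∏_i S_{d_i}(s_i)` over strictly decreasing `d`. -/
def multizeta (θ : L)
    {ι : Type*} [Fintype ι] [LinearOrder ι] (s : ι → ℕ) : L :=
  ∑' d : {d : ι → ℕ // StrictAnti d}, multiPowerSum Fq θ s d.1

end Multizeta

section Omega

variable (Fq : Type*) [Fintype Fq] {L : Type*} [NormedField L]

/-- The factors `1 - T / t ^ (q ^ i)`, `i ≥ 1`, of `Ω`. -/
def omegaFactor (θ : L) (i : ℕ) : PowerSeries L :=
  1 - PowerSeries.C (1 / θ ^ Fintype.card Fq ^ (i + 1)) * PowerSeries.X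

/-- `Ω(T) = τ ^ (-q) ∏_{i ≥ 1} (1 - T / t ^ (q ^ i))`, with coefficientwise convergence. -/
def carlitzOmega (θ τ : L) : PowerSeries L :=
  PowerSeries.C (1 / τ ^ Fintype.card Fq) * ∏' i, omegaFactor Fq θ i

/-- `π̃ = 1 / Ω(t)`. -/
def carlitzPi (θ τ : L) : L := 1 / evalAt θ (carlitzOmega Fq θ τ)

end Omega

/-! ### The matrices

Rows and columns are numbered from `0` to `r`, and `s = (s_0, …, s_{r-1})`. -/

section Matrices

variable {r : ℕ}

/-- The indices `m` of the sub-tuple `(s_k, …, s_{i-1})`. -/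
abbrev Block (k i : Fin (r + 1)) := {m : Fin r // k ≤ m.castSucc ∧ m.castSucc < i}

/-- `s_i + ⋯ + s_{r-1}`. -/
def tailSum (s : Fin r → ℕ) (i : Fin (r + 1)) : ℕ := ∑ m : Fin r with i ≤ m.castSucc, s m

/-- `[[Y]]`, the diagonal matrix with entries `Y ^ (s_i + ⋯ + s_{r-1})`. -/
def diagPow {R : Type*} [CommRing R] (s : Fin r → ℕ) (Y : R) :
    Matrix (Fin (r + 1)) (Fin (r + 1)) R :=
  Matrix.diagonal fun i => Y ^ tailSum s i

/-- The unipotent lower bidiagonal matrix `Q` with subdiagonal entries `Q_{m+1,m} = h m`. -/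
def matrixQ {R : Type*} [CommRing R] (h : Fin r → R) : Matrix (Fin (r + 1)) (Fin (r + 1)) R :=
  Matrix.of fun i j =>
    if i = j then 1
    else if hij : (j : ℕ) + 1 = i then h ⟨j, by omega⟩
    else 0

variable (Fq : Type*) [Field Fq] [Fintype Fq]
variable {L : Type*} [NormedField L] [PerfectField L] [Algebra Fq L]

/-- The product `∏_m (Ω ^ (s_m) Q_{m+1,m})^{(d_m)}` over the block from `k` to `i`. -/
def termL (s : Fin r → ℕ) (Ω : PowerSeries L) (h : Fin r → PowerSeries L) (k i : Fin (r + 1))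
    (d : Block k i → ℕ) : PowerSeries L :=
  ∏ m : Block k i, twist Fq (d m) (Ω ^ s m.1 * h m.1)

/-- The unipotent lower triangular matrix `L` with entries
`L_{ik} = ∑_{d_k > ⋯ > d_{i-1} ≥ 0} ∏_m (Ω ^ (s_m) Q_{m+1,m})^{(d_m)}` for `i ≥ k`
(so `L_{ii} = 1`), with coefficientwise convergence. -/
def matrixL (s : Fin r → ℕ) (Ω : PowerSeries L) (h : Fin r → PowerSeries L) :
    Matrix (Fin (r + 1)) (Fin (r + 1)) (PowerSeries L) :=
  Matrix.of fun i k =>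
    if k ≤ i then ∑' d : {d : Block k i → ℕ // StrictAnti d}, termL Fq s Ω h k i d.1 else 0

/-- The map `A[T] → L⟦T⟧` that specializes `t` to `θ`. -/
def toPowerSeries (θ : L) : Fq[X][X] →+* PowerSeries L :=
  (Polynomial.coeToPowerSeries.ringHom).comp
    (Polynomial.mapRingHom ((aeval θ : Fq[X] →ₐ[Fq] L) : Fq[X] →+* L))

/-- The subdiagonal entries `Q_{m+1,m} = H_{s_m - 1}(T)` of `Q`, as power series in `T`. -/
def subdiagonal (θ : L) (H : ℕ → Fq[X][X]) (s : Fin r → ℕ) : Fin r → PowerSeries L :=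
  fun m => toPowerSeries Fq θ (H (s m - 1))

/-- `Φ = Q^{(-1)} D`, with `D = [[T - t]]`. -/
def matrixPhi (θ : L) (H : ℕ → Fq[X][X]) (s : Fin r → ℕ) :
    Matrix (Fin (r + 1)) (Fin (r + 1)) (PowerSeries L) :=
  (matrixQ (subdiagonal Fq θ H s)).map (twist Fq (-1)) *
    diagPow s (PowerSeries.X - PowerSeries.C θ)

/-- `Ψ = Λ L`, with `Λ = [[Ω]]`. -/
def matrixPsi (θ τ : L) (H : ℕ → Fq[X][X]) (s : Fin r → ℕ) :
    Matrix (Fin (r + 1)) (Fin (r + 1)) (PowerSeries L) :=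
  diagPow s (carlitzOmega Fq θ τ) *
    matrixL Fq s (carlitzOmega Fq θ τ) (subdiagonal Fq θ H s)

/-- The value of `Ψ⁻¹` at `T = t`. -/
def matrixP (θ τ : L) (H : ℕ → Fq[X][X]) (s : Fin r → ℕ) :
    Matrix (Fin (r + 1)) (Fin (r + 1)) L :=
  (matrixPsi Fq θ τ H s)⁻¹.map (evalAt θ)

end Matrices

end CarlitzMZV

end

/-! Everything rests on one evaluation: for `d ≥ 0`, the series `(Ω^s H_{s-1})^{(d)}` takes the
value `Γ_s Ω(t)^s S_d(s)` at `T = t` (`evalAt_twist_omega_pow_mul`). Two facts combine. Shifting the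
product and using `t = -τ^(q-1)` gives `Ω = (T - t^q) Ω^{(1)}`, hence `ℓ_d Ω^{(d)}(t) = Ω(t)` with
`ℓ_d = ∏_{1≤j≤d} (t - t^(q^j))`. And `H_{s-1}^{(d)}(t) = Γ_s ℓ_d^s S_d(s)`
(`twistedEval_andersonThakurPoly`): the substitution `t ↦ t^(q^d)`, `T ↦ t` turns the series whose
reciprocal generates the `H_n` into `1 - E_d(ℓ_d x)`, where `E_d = e_d / D_d` is the `𝔽_q`-linear
polynomial equal to 1 at the monic polynomials of degree `d`. These are all the roots of `1 - E_d`,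
and its derivative is the constant `-1/ℓ_d`; so its reciprocal is, up to a constant, its logarithmic
derivative, which generates the power sums.

Convergence is a matter of Gauss norms. The polynomial `H_{s-1}^{(-1)}` has degree at most
`(s-1)/(q-1)` in `t`, while `Ω` is of size `|τ|^(-q)` and `|τ|^(q-1) = |t|`; so the twists of `Ω^s
H_{s-1}` tend to zero on every disk (`gaussNull_twist_omega_pow_mul`), and the series for `L` may be
summed and evaluated term by term.

Sorting the strictly decreasing sequences by whether the last entry is zero gives a recursion for
the rows of `L` (`matrixL_succ`). Untwisted once, and multiplied by powers of `Ω^{(-1)} = (T - t)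
Ω`, it becomes `Ψ^{(-1)} = Φ Ψ`. The determinant of `Ψ` is a power of `Ω`, whose zeros have absolute
value at least `|t|^q`, so `Ψ⁻¹` converges for `|T| ≤ |t|`. If `v` is `σ`-invariant, `v Ψ` is fixed
by the twist and therefore has entries in `𝔽_q[T]`; so the rows of `Ψ⁻¹` are a basis of the
invariants.

Integrality of `H_n` follows from `Π_a Π_b ∣ Π_{a+b}`, proved with a formula of Legendre type. `H_n`
comes from a polynomial by `t ↦ t^q`, so `H_n^{(-1)}`, and with it `Φ`, is integral as well. The
assertions on the motive hold for any `Q' [[T - t]]` with `Q'` unipotent bidiagonal: the filtration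
is by the leading coordinates, and on the new coordinate of each step `σ` acts as on a Carlitz
power. -/

namespace CarlitzMZV

/-! ### The absolute value of `ℂ_∞` and the transcendence of `t` -/

section CInftyNorm

variable (Fq : Type*) [Field Fq] [Fintype Fq]

instance : IsUltrametricDist (KInftyBar Fq) :=
  IsUltrametricDist.isUltrametricDist_of_forall_norm_add_le_max_norm
    fun x y => isNonarchimedean_spectralNorm (K := KInfty Fq) x y

instance : IsUltrametricDist (CInfty Fq) := by
  refine IsUltrametricDist.isUltrametricDist_of_forall_norm_add_le_max_norm fun x y => ?_
  refine UniformSpace.Completion.induction_on₂ (α := KInftyBar Fq) (β := KInftyBar Fq) x y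
    (p := fun (x y : UniformSpace.Completion (KInftyBar Fq)) => ‖x + y‖ ≤ max ‖x‖ ‖y‖) ?_ ?_
  · exact isClosed_le (by fun_prop) (by fun_prop)
  · intro a b
    rw [← UniformSpace.Completion.coe_add]
    simp only [UniformSpace.Completion.norm_coe]
    exact IsUltrametricDist.norm_add_le_max a b

lemma one_lt_norm_tInfty : 1 < ‖tInfty Fq‖ := by
  have h1 : ‖tInfty Fq‖ = ‖algebraMap (KInfty Fq) (KInftyBar Fq)
      (algebraMap (RatFunc Fq) (KInfty Fq) RatFunc.X)‖ :=
    UniformSpace.Completion.norm_coe _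
  have h2 : ‖algebraMap (KInfty Fq) (KInftyBar Fq)
      (algebraMap (RatFunc Fq) (KInfty Fq) RatFunc.X)‖ =
      ‖algebraMap (RatFunc Fq) (KInfty Fq) RatFunc.X‖ :=
    spectralNorm_extends (K := KInfty Fq) (L := KInftyBar Fq) _
  rw [h1, h2]
  refine Valued.toNormedField.one_lt_norm_iff.2 ?_
  rw [kInfty_v_X, ← WithZero.exp_zero]
  exact WithZero.exp_lt_exp.2 one_pos

lemma aeval_tInfty (p : Fq[X]) :
    aeval (tInfty Fq) p = ratFuncToCInfty Fq (algebraMap Fq[X] (RatFunc Fq) p) := by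
  induction p using Polynomial.induction_on' with
  | add p q hp hq => simp [hp, hq]
  | monomial n a =>
    rw [aeval_monomial, ← C_mul_X_pow_eq_monomial, map_mul, map_pow, RatFunc.algebraMap_X,
      map_mul, map_pow]
    rfl

/-- Guarantees that `D_n`, `Γ_s`, `ℓ_d` and the monic polynomials stay nonzero, and the latter
distinct, when specialized to `ℂ_∞`. -/
lemma transcendental_tInfty : Transcendental Fq (tInfty Fq) := by
  rw [transcendental_iff_injective]
  intro p q h
  rw [aeval_tInfty, aeval_tInfty] at h
  exact RatFunc.algebraMap_injective Fq ((ratFuncToCInfty Fq).injective h)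

end CInftyNorm

open Filter

/-! ### Twists -/

section TwistBasics

variable (Fq : Type*) [Field Fq] [Fintype Fq] {F : Type*} [Field F] [PerfectField F] [Algebra Fq F]

lemma qFrob_apply (x : F) : qFrob Fq F x = x ^ Fintype.card Fq := rfl

lemma qFrob_zpow_natCast_apply (n : ℕ) (x : F) :
    (qFrob Fq F ^ (n : ℤ)) x = x ^ Fintype.card Fq ^ n := by
  rw [zpow_natCast]
  induction n with
  | zero => simp
  | succ n ih => rw [pow_succ', AlgEquiv.mul_apply, ih, qFrob_apply, ← pow_mul, pow_succ]

lemma qFrob_neg_one_pow (x : F) : (qFrob Fq F ^ (-1 : ℤ)) x ^ Fintype.card Fq = x := by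
  rw [← qFrob_apply, ← AlgEquiv.mul_apply, ← zpow_one_add]
  simp

@[simp]
lemma coeff_twist (n : ℤ) (f : PowerSeries F) (m : ℕ) :
    PowerSeries.coeff m (twist Fq n f) = (qFrob Fq F ^ n) (PowerSeries.coeff m f) :=
  PowerSeries.coeff_map _ _ _

lemma coeff_twist_natCast (n : ℕ) (f : PowerSeries F) (m : ℕ) :
    PowerSeries.coeff m (twist Fq n f) = PowerSeries.coeff m f ^ Fintype.card Fq ^ n := by
  rw [coeff_twist, qFrob_zpow_natCast_apply]

lemma twist_add (m n : ℤ) (f : PowerSeries F) :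
    twist Fq (m + n) f = twist Fq m (twist Fq n f) := by
  ext i
  simp [zpow_add]

@[simp]
lemma twist_zero (f : PowerSeries F) : twist Fq 0 f = f := by
  ext i
  simp

lemma twist_neg_one_twist_one (f : PowerSeries F) : twist Fq (-1) (twist Fq 1 f) = f := by
  rw [← twist_add]; simp

@[simp]
lemma twist_C (n : ℤ) (a : F) :
    twist Fq n (PowerSeries.C a) = PowerSeries.C ((qFrob Fq F ^ n) a) :=
  PowerSeries.map_C _ _

@[simp]
lemma twist_X (n : ℤ) : twist Fq n (PowerSeries.X : PowerSeries F) = PowerSeries.X :=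
  PowerSeries.map_X _

lemma polyTwist_add (m n : ℤ) (f : F[X]) :
    polyTwist Fq (m + n) f = polyTwist Fq m (polyTwist Fq n f) := by
  ext i
  simp [polyTwist, zpow_add]

lemma polyTwist_zero (f : F[X]) : polyTwist Fq 0 f = f := by
  ext i
  simp [polyTwist]

lemma polyTwist_neg_one_polyTwist_one (f : F[X]) : polyTwist Fq (-1) (polyTwist Fq 1 f) = f := by
  rw [← polyTwist_add, neg_add_cancel, polyTwist_zero]

omit [PerfectField F] in
/-- The elements fixed by the `q`-Frobenius are those of `𝔽_q`. -/
lemma exists_algebraMap_of_pow_card_eq {x : F} (hx : x ^ Fintype.card Fq = x) :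
    ∃ a : Fq, algebraMap Fq F a = x := by
  have hm : (X ^ Fintype.card Fq - X : Fq[X]).Monic :=
    monic_X_pow_sub (by rw [degree_X]; exact_mod_cast Fintype.one_lt_card)
  have hr := prod_multiset_X_sub_C_of_monic_of_roots_card_eq hm (by
    rw [FiniteField.roots_X_pow_card_sub_X,
      FiniteField.X_pow_card_sub_X_natDegree_eq Fq Fintype.one_lt_card]
    rfl)
  rw [FiniteField.roots_X_pow_card_sub_X] at hr
  have h : aeval x (∏ a : Fq, (X - C a)) = aeval x (X ^ Fintype.card Fq - X : Fq[X]) :=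
    congrArg _ hr
  simp only [map_prod, map_sub, map_pow, aeval_X, aeval_C, hx, sub_self] at h
  obtain ⟨a, -, ha⟩ := Finset.prod_eq_zero_iff.1 h
  exact ⟨a, (sub_eq_zero.1 ha).symm⟩

end TwistBasics

/-! ### Gauss norms -/

section Gauss

variable {L : Type*} [NormedField L]

/-- The Gauss norm of `f` with respect to the radius `c` is at most `M`. -/
def GaussLE (c M : ℝ) (f : PowerSeries L) : Prop :=
  ∀ n, ‖PowerSeries.coeff n f‖ * c ^ n ≤ M

variable {c M N : ℝ} {f g : PowerSeries L}

lemma GaussLE.nonneg (h : GaussLE c M f) : 0 ≤ M := by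
  have := h 0
  rw [pow_zero, mul_one] at this
  exact (norm_nonneg _).trans this

lemma GaussLE.mono (h : GaussLE c M f) (hMN : M ≤ N) : GaussLE c N f := fun n => (h n).trans hMN

lemma GaussLE.anti {c' : ℝ} (h : GaussLE c M f) (hc' : 0 ≤ c') (hc : c' ≤ c) : GaussLE c' M f :=
  fun n => (mul_le_mul_of_nonneg_left (pow_le_pow_left₀ hc' hc n) (norm_nonneg _)).trans (h n)

lemma gaussLE_one : GaussLE c 1 (1 : PowerSeries L) := by
  intro n
  rw [PowerSeries.coeff_one]
  split_ifs with h
  · simp [h]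
  · simp

lemma GaussLE.mul [IsUltrametricDist L] (hc : 0 ≤ c) (hf : GaussLE c M f) (hg : GaussLE c N g) :
    GaussLE c (M * N) (f * g) := by
  intro n
  rw [PowerSeries.coeff_mul]
  have key : ∀ p ∈ Finset.HasAntidiagonal.antidiagonal n,
      ‖PowerSeries.coeff p.1 f * PowerSeries.coeff p.2 g‖ * c ^ n ≤ M * N := by
    intro p hp
    rw [← Finset.HasAntidiagonal.mem_antidiagonal.1 hp, pow_add, norm_mul, mul_mul_mul_comm]
    exact mul_le_mul (hf _) (hg _) (by positivity) hf.nonneg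
  obtain ⟨p, hp, hle⟩ := IsUltrametricDist.exists_norm_finsetSum_le_of_nonempty
    ⟨(0, n), Finset.HasAntidiagonal.mem_antidiagonal.2 (zero_add n)⟩
    (fun p : ℕ × ℕ => PowerSeries.coeff p.1 f * PowerSeries.coeff p.2 g)
  exact (mul_le_mul_of_nonneg_right hle (by positivity)).trans (key p hp)

lemma GaussLE.pow [IsUltrametricDist L] (hc : 0 ≤ c) (hf : GaussLE c M f) (k : ℕ) :
    GaussLE c (M ^ k) (f ^ k) := by
  induction k with
  | zero => simpa using gaussLE_one (c := c)
  | succ k ih => rw [pow_succ, pow_succ]; exact ih.mul hc hf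

lemma GaussLE.prod [IsUltrametricDist L] {ι : Type*} (hc : 0 ≤ c) (s : Finset ι)
    {M : ι → ℝ} {f : ι → PowerSeries L} (hf : ∀ i ∈ s, GaussLE c (M i) (f i)) :
    GaussLE c (∏ i ∈ s, M i) (∏ i ∈ s, f i) := by
  classical
  induction s using Finset.induction_on with
  | empty => simpa using gaussLE_one (c := c)
  | insert a s ha ih =>
    rw [Finset.prod_insert ha, Finset.prod_insert ha]
    exact (hf a (by simp)).mul hc (ih fun i hi => hf i (by simp [hi]))

/-- The coefficients are raised to the power `q^d` but `T` is not, so the radius grows along with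
the bound. -/
lemma GaussLE.twist {Fq : Type*} [Field Fq] [Fintype Fq] [PerfectField L] [Algebra Fq L]
    (h : GaussLE c M f) (hc : 0 ≤ c) (d : ℕ) :
    GaussLE (c ^ Fintype.card Fq ^ d) (M ^ Fintype.card Fq ^ d) (twist Fq d f) := by
  intro n
  rw [coeff_twist_natCast, norm_pow, ← pow_mul, mul_comm _ n, pow_mul c, ← mul_pow]
  exact pow_le_pow_left₀ (by positivity) (h n) _

lemma exists_gaussLE (h : PowerSeries.IsRestricted c f) : ∃ M, GaussLE c M f := by
  obtain ⟨M, hM⟩ := ((PowerSeries.isRestricted_iff' c f).1 h).bddAbove_range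
  exact ⟨M, fun n => hM ⟨n, rfl⟩⟩

lemma GaussLE.isRestricted {c' : ℝ} (h : GaussLE c M f) (hc' : 0 ≤ c') (hc : c' < c) :
    PowerSeries.IsRestricted c' f := by
  rw [PowerSeries.isRestricted_iff']
  have hc0 : 0 < c := hc'.trans_lt hc
  refine squeeze_zero (fun n => by positivity) (g := fun n => M * (c' / c) ^ n) (fun n => ?_) ?_
  · calc ‖PowerSeries.coeff n f‖ * c' ^ n = (‖PowerSeries.coeff n f‖ * c ^ n) * (c' / c) ^ n := by
          rw [div_pow]; field_simp
      _ ≤ M * (c' / c) ^ n := by gcongr; exact h n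
  · simpa using (tendsto_pow_atTop_nhds_zero_of_lt_one (by positivity)
      ((div_lt_one hc0).2 hc)).const_mul M

lemma isRestricted_twist {Fq : Type*} [Field Fq] [Fintype Fq] [PerfectField L] [Algebra Fq L]
    (h : PowerSeries.IsRestricted c f) (d : ℕ) :
    PowerSeries.IsRestricted (c ^ Fintype.card Fq ^ d) (twist Fq d f) := by
  rw [PowerSeries.isRestricted_iff'] at h ⊢
  have hq : Fintype.card Fq ^ d ≠ 0 := pow_ne_zero _ Fintype.card_ne_zero
  have := h.pow (Fintype.card Fq ^ d)
  rw [zero_pow hq] at this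
  refine this.congr fun n => ?_
  rw [coeff_twist_natCast, norm_pow, ← pow_mul, mul_comm _ n, pow_mul c, ← mul_pow]

lemma isRestricted_coe (c : ℝ) (p : L[X]) : PowerSeries.IsRestricted c (p : PowerSeries L) := by
  rw [PowerSeries.isRestricted_iff']
  refine tendsto_const_nhds.congr' ?_
  filter_upwards [eventually_gt_atTop p.natDegree] with n hn
  rw [Polynomial.coeff_coe, coeff_eq_zero_of_natDegree_lt hn]
  simp

end Gauss

/-! ### Entire power series -/

section Entire

variable {L : Type*} [NormedField L]

/-- The power series converges everywhere. -/
def IsEntire (f : PowerSeries L) : Prop := ∀ c : ℝ, PowerSeries.IsRestricted c f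

variable {f g : PowerSeries L}

lemma isEntire_of_nonneg (h : ∀ c : ℝ, 0 ≤ c → PowerSeries.IsRestricted c f) : IsEntire f :=
  fun c => (PowerSeries.isRestricted_abs_iff c f).1 (h |c| (abs_nonneg c))

lemma isEntire_coe (p : L[X]) : IsEntire (p : PowerSeries L) := fun c => isRestricted_coe c p

variable [IsUltrametricDist L]

variable (L) in
/-- The ring of everywhere convergent power series. -/
noncomputable def entireSubring : Subring (PowerSeries L) := ⨅ c : ℝ, PowerSeries.IsRestricted.subring c

lemma mem_entireSubring : f ∈ entireSubring L ↔ IsEntire f := by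
  simp only [entireSubring, Subring.mem_iInf]
  rfl

lemma mem_restrictedSubring {c : ℝ} :
    f ∈ PowerSeries.IsRestricted.subring c ↔ PowerSeries.IsRestricted c f := Iff.rfl

omit [IsUltrametricDist L] in
lemma IsEntire.twist {Fq : Type*} [Field Fq] [Fintype Fq] [PerfectField L] [Algebra Fq L]
    (h : IsEntire f) (d : ℕ) : IsEntire (twist Fq d f) := by
  refine isEntire_of_nonneg fun c hc => ?_
  -- The radius whose `q^d`-th power is `c`.
  have := isRestricted_twist (Fq := Fq) (h (c ^ ((Fintype.card Fq ^ d : ℕ) : ℝ)⁻¹)) d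
  rwa [Real.rpow_inv_natCast_pow hc (pow_ne_zero _ Fintype.card_ne_zero)] at this

end Entire

/-! ### Evaluation and termwise summation -/

section Eval

variable {L : Type*} [NormedField L] [IsUltrametricDist L] [CompleteSpace L]

lemma summable_of_norm_tendsto {ι : Type*} {u : ι → L}
    (h : Tendsto (fun i => ‖u i‖) cofinite (𝓝 0)) : Summable u :=
  NonarchimedeanAddGroup.summable_of_tendsto_cofinite_zero (tendsto_zero_iff_norm_tendsto_zero.2 h)

omit [IsUltrametricDist L] [CompleteSpace L] in
lemma tendsto_evalAt {a : L} {f : PowerSeries L} (hf : PowerSeries.IsRestricted ‖a‖ f) :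
    Tendsto (fun n => PowerSeries.coeff n f * a ^ n) cofinite (𝓝 0) := by
  rw [tendsto_zero_iff_norm_tendsto_zero]
  simpa only [norm_mul, norm_pow] using (PowerSeries.isRestricted_iff _ _).1 hf

lemma summable_evalAt {a : L} {f : PowerSeries L} (hf : PowerSeries.IsRestricted ‖a‖ f) :
    Summable fun n => PowerSeries.coeff n f * a ^ n := by
  exact NonarchimedeanAddGroup.summable_of_tendsto_cofinite_zero (tendsto_evalAt hf)

lemma evalAt_add {a : L} {f g : PowerSeries L} (hf : PowerSeries.IsRestricted ‖a‖ f)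
    (hg : PowerSeries.IsRestricted ‖a‖ g) : evalAt a (f + g) = evalAt a f + evalAt a g := by
  simp only [evalAt, map_add, add_mul]
  exact (summable_evalAt hf).tsum_add (summable_evalAt hg)

lemma tsum_mul_tsum_antidiagonal {u v : ℕ → L} (hu : Tendsto u cofinite (𝓝 0))
    (hv : Tendsto v cofinite (𝓝 0)) :
    (∑' n, u n) * ∑' n, v n =
      ∑' n, ∑ p ∈ Finset.HasAntidiagonal.antidiagonal n, u p.1 * v p.2 :=
  Summable.tsum_mul_tsum_eq_tsum_sum_antidiagonal
    (NonarchimedeanAddGroup.summable_of_tendsto_cofinite_zero hu)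
    (NonarchimedeanAddGroup.summable_of_tendsto_cofinite_zero hv)
    (NonarchimedeanAddGroup.summable_of_tendsto_cofinite_zero
      (tendsto_mul_cofinite_nhds_zero hu hv))

lemma evalAt_mul {a : L} {f g : PowerSeries L} (hf : PowerSeries.IsRestricted ‖a‖ f)
    (hg : PowerSeries.IsRestricted ‖a‖ g) : evalAt a (f * g) = evalAt a f * evalAt a g := by
  have h := tsum_mul_tsum_antidiagonal (tendsto_evalAt hf) (tendsto_evalAt hg)
  refine Eq.trans ?_ h.symm
  refine tsum_congr fun n => ?_
  rw [PowerSeries.coeff_mul, Finset.sum_mul]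
  refine Finset.sum_congr rfl fun p hp => ?_
  rw [← Finset.HasAntidiagonal.mem_antidiagonal.1 hp, pow_add]
  ring

omit [IsUltrametricDist L] [CompleteSpace L] in
lemma evalAt_coe (a : L) (p : L[X]) : evalAt a (p : PowerSeries L) = p.eval a := by
  rw [evalAt, eval_eq_sum_range, tsum_eq_sum (s := Finset.range (p.natDegree + 1))]
  · simp
  · intro n hn
    rw [Polynomial.coeff_coe, coeff_eq_zero_of_natDegree_lt (by simpa using hn), zero_mul]

/-- Evaluation at `a`, on the ring of power series which converge on the disk of radius `‖a‖`. -/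
noncomputable def evalHom (a : L) : PowerSeries.IsRestricted.subring (R := L) ‖a‖ →+* L where
  toFun f := evalAt a f
  map_one' := by simpa using evalAt_coe a 1
  map_mul' f g := evalAt_mul f.2 g.2
  map_zero' := by simpa using evalAt_coe a 0
  map_add' f g := evalAt_add f.2 g.2

lemma evalAt_pow {a : L} {f : PowerSeries L} (hf : PowerSeries.IsRestricted ‖a‖ f) (n : ℕ) :
    evalAt a (f ^ n) = evalAt a f ^ n :=
  map_pow (evalHom a) ⟨f, hf⟩ n

lemma evalAt_prod {ι : Type*} {a : L} (s : Finset ι) {f : ι → PowerSeries L}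
    (hf : ∀ i, PowerSeries.IsRestricted ‖a‖ (f i)) :
    evalAt a (∏ i ∈ s, f i) = ∏ i ∈ s, evalAt a (f i) := by
  have := map_prod (evalHom a) (fun i => ⟨f i, hf i⟩) s
  have h2 : ((∏ i ∈ s, (⟨f i, hf i⟩ : PowerSeries.IsRestricted.subring (R := L) ‖a‖) :
      PowerSeries.IsRestricted.subring (R := L) ‖a‖) : PowerSeries L) = ∏ i ∈ s, f i := by
    simp
  rw [← h2]
  exact this

/-- A family of power series whose Gauss norms tend to zero. -/
def GaussNull {ι : Type*} (c : ℝ) (f : ι → PowerSeries L) : Prop :=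
  ∃ M : ι → ℝ, Tendsto M cofinite (𝓝 0) ∧ ∀ i, GaussLE c (M i) (f i)

variable {ι : Type*} {f : ι → PowerSeries L}

omit [IsUltrametricDist L] [CompleteSpace L] in
lemma GaussNull.comp {κ : Type*} {c : ℝ} (h : GaussNull c f) {e : κ → ι}
    (he : Function.Injective e) : GaussNull c (fun k => f (e k)) := by
  obtain ⟨M, hM, hf⟩ := h
  exact ⟨M ∘ e, hM.comp he.tendsto_cofinite, fun k => hf _⟩

lemma GaussNull.summable {c : ℝ} (hc : 0 < c) (h : GaussNull c f) : Summable f := by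
  obtain ⟨M, hM, hf⟩ := h
  rw [PowerSeries.WithPiTopology.summable_iff_summable_coeff]
  intro n
  refine summable_of_norm_tendsto (squeeze_zero (fun i => norm_nonneg _)
    (g := fun i => M i / c ^ n) (fun i => ?_) (by simpa using hM.div_const (c ^ n)))
  rw [le_div_iff₀ (by positivity)]
  exact hf i n

omit [IsUltrametricDist L] [CompleteSpace L] in
-- Only finitely many `i` have a large Gauss norm, and for each of them only finitely many
-- coefficients are large. This joint decay is what permits exchanging the sums over `i` and over
-- the powers of `T`.
lemma GaussNull.tendsto_cofinite_prod {c : ℝ} (hc : 0 ≤ c) (h : GaussNull c f)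
    (hr : ∀ i, PowerSeries.IsRestricted c (f i)) :
    Tendsto (fun p : ι × ℕ => ‖PowerSeries.coeff p.2 (f p.1)‖ * c ^ p.2) cofinite (𝓝 0) := by
  obtain ⟨M, hM, hf⟩ := h
  rw [Metric.tendsto_nhds] at hM ⊢
  intro ε hε
  have h1 : {i | ¬ dist (M i) 0 < ε}.Finite := hM ε hε
  have h2 : ∀ i, {n | ¬ dist (‖PowerSeries.coeff n (f i)‖ * c ^ n) 0 < ε}.Finite := fun i =>
    Metric.tendsto_nhds.1 ((PowerSeries.isRestricted_iff _ _).1 (hr i)) ε hε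
  refine (h1.biUnion fun i _ => (Set.finite_singleton i).prod (h2 i)).subset ?_
  rintro ⟨i, n⟩ hp
  simp only [Set.mem_iUnion]
  refine ⟨i, fun hlt => hp ?_, by simp, hp⟩
  change dist (‖PowerSeries.coeff n (f i)‖ * c ^ n) 0 < ε
  rw [Real.dist_0_eq_abs] at hlt ⊢
  rw [abs_of_nonneg (by positivity)]
  exact (hf i n).trans_lt ((le_abs_self _).trans_lt hlt)

omit [CompleteSpace L] in
lemma GaussNull.isRestricted_tsum {c : ℝ} (hc : 0 ≤ c) (h : GaussNull c f) (hs : Summable f)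
    (hr : ∀ i, PowerSeries.IsRestricted c (f i)) : PowerSeries.IsRestricted c (∑' i, f i) := by
  have h1 := h.tendsto_cofinite_prod hc hr
  rw [PowerSeries.isRestricted_iff, Metric.tendsto_nhds]
  intro ε hε
  have h2 := Metric.tendsto_nhds.1 h1 (ε / 2) (half_pos hε)
  have h3 : {p : ι × ℕ | ¬ dist (‖PowerSeries.coeff p.2 (f p.1)‖ * c ^ p.2) 0 < ε / 2}.Finite := h2
  refine (h3.image Prod.snd).subset ?_
  intro n hn
  by_contra hcon
  refine hn ?_
  have h4 : ∀ i, ‖PowerSeries.coeff n (f i)‖ * c ^ n < ε / 2 := by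
    intro i
    by_contra hi
    refine hcon ⟨(i, n), fun hlt => hi ?_, rfl⟩
    rw [Real.dist_0_eq_abs] at hlt
    exact (le_abs_self _).trans_lt hlt
  change dist (‖PowerSeries.coeff n (∑' i, f i)‖ * c ^ n) 0 < ε
  have h5 : PowerSeries.coeff n (∑' i, f i) = ∑' i, PowerSeries.coeff n (f i) :=
    hs.map_tsum (PowerSeries.coeff n) (PowerSeries.WithPiTopology.continuous_coeff L n)
  rw [Real.dist_0_eq_abs, abs_of_nonneg (by positivity), h5]
  have h6 : ‖c ^ n‖ = c ^ n := by rw [Real.norm_of_nonneg (by positivity)]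
  rcases eq_or_lt_of_le (pow_nonneg hc n) with h0 | h0
  · rw [← h0, mul_zero]; exact hε
  · refine lt_of_le_of_lt ?_ (half_lt_self hε)
    rw [← le_div_iff₀ h0]
    exact IsUltrametricDist.norm_tsum_le_of_forall_le_of_nonneg (by positivity)
      fun i => (le_div_iff₀ h0).2 (h4 i).le

lemma GaussNull.evalAt_tsum {a : L} (h : GaussNull ‖a‖ f) (hs : Summable f)
    (hr : ∀ i, PowerSeries.IsRestricted ‖a‖ (f i)) :
    (Summable fun i => evalAt a (f i)) ∧ evalAt a (∑' i, f i) = ∑' i, evalAt a (f i) := by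
  have h1 := h.tendsto_cofinite_prod (norm_nonneg a) hr
  have h2 : Summable fun p : ι × ℕ => PowerSeries.coeff p.2 (f p.1) * a ^ p.2 := by
    refine summable_of_norm_tendsto ?_
    simpa only [norm_mul, norm_pow] using h1
  refine ⟨h2.prod, ?_⟩
  have h5 : ∀ n, PowerSeries.coeff n (∑' i, f i) = ∑' i, PowerSeries.coeff n (f i) := fun n =>
    hs.map_tsum (PowerSeries.coeff n) (PowerSeries.WithPiTopology.continuous_coeff L n)
  simp only [evalAt, h5, ← tsum_mul_right]
  have h6 := Summable.tsum_comm (f := fun i n => PowerSeries.coeff n (f i) * a ^ n) h2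
  exact h6

end Eval

open Filter

/-! ### Inverses and continuity of twists -/

section Inverse

variable {L : Type*} [NormedField L] [IsUltrametricDist L]

/-- Each coefficient of `f⁻¹` is, up to sign, a sum of products of a coefficient of `f` and an
earlier coefficient of `f⁻¹`, so the ultrametric inequality carries the bound 1 along. -/
lemma GaussLE.inv {c : ℝ} (hc : 0 ≤ c) {f : PowerSeries L} (h0 : PowerSeries.constantCoeff f = 1)
    (hf : GaussLE c 1 f) : GaussLE c 1 f⁻¹ := by
  intro n
  induction n using Nat.strong_induction_on with
  | _ n ih =>
    rw [PowerSeries.coeff_inv]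
    split_ifs with hn
    · simp [h0, hn]
    · rw [h0, inv_one, neg_mul, one_mul, norm_neg]
      obtain ⟨p, hp, hle⟩ := IsUltrametricDist.exists_norm_finsetSum_le_of_nonempty
        ⟨(0, n), Finset.HasAntidiagonal.mem_antidiagonal.2 (zero_add n)⟩
        (fun p : ℕ × ℕ => if p.2 < n then PowerSeries.coeff p.1 f * PowerSeries.coeff p.2 f⁻¹ else 0)
      refine (mul_le_mul_of_nonneg_right hle (by positivity)).trans ?_
      split_ifs with hlt
      · rw [← Finset.HasAntidiagonal.mem_antidiagonal.1 hp, pow_add, norm_mul, mul_mul_mul_comm]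
        exact mul_le_one₀ (hf _) (by positivity) (ih _ hlt)
      · simp

end Inverse

section TwistContinuity

variable {Fq : Type*} [Field Fq] [Fintype Fq]
variable {L : Type*} [NormedField L] [PerfectField L] [Algebra Fq L]

/-- Only nonnegative twists are passed through infinite sums and products; the twist by `-1` is
always obtained by undoing a twist by 1. -/
lemma continuous_twist_natCast (n : ℕ) : Continuous (twist Fq n : PowerSeries L →+* PowerSeries L) := by
  rw [continuous_iff_continuousAt]
  intro f
  refine (PowerSeries.WithPiTopology.tendsto_iff_coeff_tendsto L _ _ _).2 fun d => ?_
  simp only [coeff_twist_natCast]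
  exact ((PowerSeries.WithPiTopology.continuous_coeff L d).tendsto f).pow _

lemma continuous_twist_one : Continuous (twist Fq 1 : PowerSeries L →+* PowerSeries L) := by
  simpa using continuous_twist_natCast (Fq := Fq) (L := L) 1

end TwistContinuity

/-! ### The function `Ω` -/

section OmegaProduct

variable (Fq : Type*) [Field Fq] [Fintype Fq]
variable {L : Type*} [NormedField L] {θ : L}

omit [Field Fq] in
lemma omegaFactor_eq (θ : L) (i : ℕ) : omegaFactor Fq θ i =
    1 + PowerSeries.C (-(θ⁻¹ ^ Fintype.card Fq ^ (i + 1))) * PowerSeries.X := by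
  simp [omegaFactor, sub_eq_add_neg]

lemma gaussLE_C_mul_X (c : ℝ) (hc : 0 ≤ c) (a : L) :
    GaussLE c (‖a‖ * c) (PowerSeries.C a * PowerSeries.X) := by
  intro n
  rw [PowerSeries.coeff_C_mul, PowerSeries.coeff_X]
  split_ifs with h
  · simp [h]
  · simp; positivity

lemma card_pow_succ_le (i : ℕ) : i + 1 ≤ Fintype.card Fq ^ (i + 1) :=
  (Nat.lt_pow_self Fintype.one_lt_card).le

variable [IsUltrametricDist L]

lemma GaussLE.add {c M : ℝ} (hc : 0 ≤ c) {f g : PowerSeries L} (hf : GaussLE c M f)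
    (hg : GaussLE c M g) : GaussLE c M (f + g) := by
  intro n
  rw [map_add]
  refine (mul_le_mul_of_nonneg_right (IsUltrametricDist.norm_add_le_max _ _)
    (by positivity)).trans ?_
  rw [max_mul_of_nonneg _ _ (by positivity)]
  exact max_le (hf n) (hg n)

omit [Field Fq] in
-- The zero of the factor has absolute value `|t|^(q^(i+1)) ≥ |t|^q`. The radius is taken beyond
-- `|t|` so that `1/Ω` converges on the closed disk containing `t`.
lemma gaussLE_omegaFactor (hθ : 1 < ‖θ‖) (i : ℕ) :
    GaussLE (‖θ‖ ^ Fintype.card Fq) 1 (omegaFactor Fq θ i) := by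
  rw [omegaFactor_eq]
  refine GaussLE.add (by positivity) gaussLE_one
    ((gaussLE_C_mul_X _ (by positivity) _).mono ?_)
  rw [norm_neg, norm_pow, norm_inv, inv_pow, inv_mul_le_one₀ (by positivity)]
  refine pow_le_pow_right₀ hθ.le ?_
  exact Nat.le_self_pow (Nat.succ_ne_zero i) _

variable [CompleteSpace L]

lemma multipliable_omegaFactor (hθ : 1 < ‖θ‖) : Multipliable (omegaFactor Fq θ) := by
  have h0 : (fun i => omegaFactor Fq θ i) = fun i =>
      1 + PowerSeries.C (-(θ⁻¹ ^ Fintype.card Fq ^ (i + 1))) * PowerSeries.X :=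
    funext (omegaFactor_eq Fq θ)
  change Multipliable (fun i => omegaFactor Fq θ i)
  rw [h0]
  apply multipliable_one_add_of_summable_prod
  have hs : Summable fun i : ℕ => ‖θ‖⁻¹ ^ Fintype.card Fq ^ (i + 1) := by
    have hlt : ‖θ‖⁻¹ < 1 := inv_lt_one_of_one_lt₀ hθ
    refine Summable.of_nonneg_of_le (fun i => by positivity) (fun i => ?_)
      (summable_geometric_of_lt_one (by positivity) hlt)
    exact pow_le_pow_of_le_one (by positivity) hlt.le
      ((Nat.le_succ i).trans (card_pow_succ_le Fq i))
  -- The expanded product is a sum over finite sets of indices, whose terms have Gauss norm at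
  -- radius 1 at most the product of the `|t|^(-q^(i+1))`.
  have hs' := summable_finsetProd_of_summable_nonneg (fun i => by positivity) hs
  refine GaussNull.summable one_pos ⟨_, hs'.tendsto_cofinite_zero, fun S => ?_⟩
  refine GaussLE.prod zero_le_one S fun i _ => (gaussLE_C_mul_X 1 zero_le_one _).mono ?_
  simp

/-- The normalization of `Ω` with constant coefficient `1`. -/
noncomputable def omegaProd (θ : L) : PowerSeries L := ∏' i, omegaFactor Fq θ i

omit [Field Fq] [IsUltrametricDist L] [CompleteSpace L] in
lemma carlitzOmega_eq (θ τ : L) :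
    carlitzOmega Fq θ τ = PowerSeries.C (1 / τ ^ Fintype.card Fq) * omegaProd Fq θ := rfl

lemma constantCoeff_omegaProd (hθ : 1 < ‖θ‖) : PowerSeries.constantCoeff (omegaProd Fq θ) = 1 := by
  rw [omegaProd, (multipliable_omegaFactor Fq hθ).map_tprod (PowerSeries.constantCoeff (R := L))
    (PowerSeries.WithPiTopology.continuous_constantCoeff L)]
  simp [omegaFactor]

lemma gaussLE_omegaProd (hθ : 1 < ‖θ‖) :
    GaussLE (‖θ‖ ^ Fintype.card Fq) 1 (omegaProd Fq θ) := by
  intro n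
  have h := (PowerSeries.WithPiTopology.tendsto_iff_coeff_tendsto L _ _ _).1
    (multipliable_omegaFactor Fq hθ).hasProd n
  refine le_of_tendsto (h.norm.mul_const _) (Eventually.of_forall fun S => ?_)
  simpa using GaussLE.prod (M := fun _ => 1) (by positivity) S
    (fun i _ => gaussLE_omegaFactor Fq hθ i) n

omit [IsUltrametricDist L] [CompleteSpace L] in
lemma norm_lt_norm_pow_card (hθ : 1 < ‖θ‖) : ‖θ‖ < ‖θ‖ ^ Fintype.card Fq := by
  simpa using pow_lt_pow_right₀ hθ (Fintype.one_lt_card (α := Fq))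

lemma isRestricted_inv_omegaProd (hθ : 1 < ‖θ‖) {c : ℝ} (hc : 0 ≤ c) (hcθ : c ≤ ‖θ‖) :
    PowerSeries.IsRestricted c (omegaProd Fq θ)⁻¹ :=
  ((gaussLE_omegaProd Fq hθ).inv (by positivity) (constantCoeff_omegaProd Fq hθ)).isRestricted hc
    (hcθ.trans_lt (norm_lt_norm_pow_card Fq hθ))

variable [PerfectField L] [Algebra Fq L]

omit [IsUltrametricDist L] [CompleteSpace L] in
lemma twist_one_omegaFactor (i : ℕ) : twist Fq 1 (omegaFactor Fq θ i) = omegaFactor Fq θ (i + 1) := by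
  rw [omegaFactor, omegaFactor, map_sub, map_mul, twist_C, twist_X, map_one, zpow_one, map_div₀,
    map_one, qFrob_apply, ← pow_mul, ← pow_succ]

lemma omegaProd_eq (hθ : 1 < ‖θ‖) :
    omegaProd Fq θ = omegaFactor Fq θ 0 * twist Fq 1 (omegaProd Fq θ) := by
  have hm := multipliable_omegaFactor Fq hθ
  have h1 : twist Fq 1 (omegaProd Fq θ) = ∏' i, omegaFactor Fq θ (i + 1) := by
    rw [omegaProd, hm.map_tprod (twist Fq 1) continuous_twist_one]
    simp only [twist_one_omegaFactor]
  have h2 : Multipliable fun i => omegaFactor Fq θ (i + 1) := by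
    have := hm.map (twist Fq 1) continuous_twist_one
    simpa only [Function.comp_def, twist_one_omegaFactor] using this
  rw [h1, omegaProd, tprod_eq_zero_mul' h2]

variable {τ : L}

omit [IsUltrametricDist L] [CompleteSpace L] [PerfectField L] [Algebra Fq L] in
include Fq in
lemma tTilde_ne_zero (hθ : 1 < ‖θ‖) (hτ : θ = -τ ^ (Fintype.card Fq - 1)) : τ ≠ 0 := by
  rintro rfl
  have hq : Fintype.card Fq - 1 ≠ 0 := (Nat.sub_pos_of_lt Fintype.one_lt_card).ne'
  rw [zero_pow hq, neg_zero] at hτ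
  rw [hτ, norm_zero] at hθ
  linarith

/-- The functional equation `Ω = (T - t ^ q) Ω^{(1)}`. -/
lemma carlitzOmega_eq_mul_twist (hθ : 1 < ‖θ‖) (hτ : θ = -τ ^ (Fintype.card Fq - 1)) :
    carlitzOmega Fq θ τ = (PowerSeries.X - PowerSeries.C (θ ^ Fintype.card Fq)) *
      twist Fq 1 (carlitzOmega Fq θ τ) := by
  have hτ0 := tTilde_ne_zero Fq hθ hτ
  have hq : 0 < Fintype.card Fq := Fintype.card_pos
  have hθq : θ ^ Fintype.card Fq = -(τ ^ Fintype.card Fq ^ 2 / τ ^ Fintype.card Fq) := by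
    have h1 : θ ^ Fintype.card Fq = -(τ ^ (Fintype.card Fq - 1)) ^ Fintype.card Fq := by
      conv_lhs => rw [hτ]
      -- Frobenius is a ring homomorphism, so the sign comes out whatever the parity of `q`.
      rw [← qFrob_apply Fq, map_neg, qFrob_apply]
    rw [h1, neg_inj, eq_div_iff (pow_ne_zero _ hτ0), ← pow_mul, ← pow_add]
    congr 1
    obtain ⟨k, hk⟩ := Nat.exists_eq_succ_of_ne_zero hq.ne'
    rw [hk, Nat.succ_sub_one]
    rw [Nat.succ_eq_add_one]
    ring
  have hθ0 : θ ^ Fintype.card Fq ≠ 0 := by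
    rw [hθq]
    exact neg_ne_zero.2 (div_ne_zero (pow_ne_zero _ hτ0) (pow_ne_zero _ hτ0))
  rw [carlitzOmega_eq, map_mul, twist_C, zpow_one]
  conv_lhs => rw [omegaProd_eq Fq hθ]
  rw [← mul_assoc, ← mul_assoc]
  congr 1
  rw [omegaFactor, qFrob_apply, zero_add, pow_one, sub_mul, mul_sub, mul_one, ← mul_assoc,
    ← map_mul, ← map_mul, sub_eq_sub_iff_add_eq_add, mul_comm PowerSeries.X]
  -- The normalization `τ^(-q)` is used here: the twist makes it `τ^(-q^2)`, and the quotient of the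
  -- two is the factor `-t^q` between `1 - T/t^q` and `T - t^q`.
  have e1 : 1 / τ ^ Fintype.card Fq =
      -(θ ^ Fintype.card Fq * (1 / τ ^ Fintype.card Fq) ^ Fintype.card Fq) := by
    rw [hθq, div_pow, one_pow, ← pow_mul, ← sq]
    field_simp
  have e2 : 1 / τ ^ Fintype.card Fq * (1 / θ ^ Fintype.card Fq) =
      -(1 / τ ^ Fintype.card Fq) ^ Fintype.card Fq := by
    conv_lhs => rw [e1]
    field_simp
  have e3 := congrArg (PowerSeries.C (R := L)) e1
  simp only [map_neg, map_mul] at e3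
  rw [e2]
  simp only [map_neg, map_mul]
  linear_combination e3

lemma twist_neg_one_carlitzOmega (hθ : 1 < ‖θ‖) (hτ : θ = -τ ^ (Fintype.card Fq - 1)) :
    twist Fq (-1) (carlitzOmega Fq θ τ) =
      (PowerSeries.X - PowerSeries.C θ) * carlitzOmega Fq θ τ := by
  conv_lhs => rw [carlitzOmega_eq_mul_twist Fq hθ hτ]
  rw [map_mul, twist_neg_one_twist_one, map_sub, twist_X, twist_C, ← qFrob_apply Fq,
    ← AlgEquiv.mul_apply]
  simp

lemma twist_natCast_carlitzOmega (hθ : 1 < ‖θ‖) (hτ : θ = -τ ^ (Fintype.card Fq - 1)) (d : ℕ) :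
    twist Fq d (carlitzOmega Fq θ τ) =
      (PowerSeries.X - PowerSeries.C (θ ^ Fintype.card Fq ^ (d + 1))) *
        twist Fq (d + 1 : ℕ) (carlitzOmega Fq θ τ) := by
  conv_lhs => rw [carlitzOmega_eq_mul_twist Fq hθ hτ]
  rw [map_mul, ← twist_add, map_sub, twist_X, twist_C, qFrob_zpow_natCast_apply, ← pow_mul,
    ← pow_succ', Nat.cast_succ]

omit [PerfectField L] [Algebra Fq L] in
lemma gaussLE_carlitzOmega (hθ : 1 < ‖θ‖) :
    GaussLE (‖θ‖ ^ Fintype.card Fq) (‖τ‖ ^ Fintype.card Fq)⁻¹ (carlitzOmega Fq θ τ) := by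
  intro n
  rw [carlitzOmega_eq, PowerSeries.coeff_C_mul, norm_mul, mul_assoc, one_div, norm_inv, norm_pow]
  exact mul_le_of_le_one_right (by positivity) (gaussLE_omegaProd Fq hθ n)

/-- If `Ω` converges on radius `R`, its twist converges on radius `R^q`, and the functional equation
passes this back to `Ω`. Iterating from `R = |t|` exceeds every radius. -/
lemma isEntire_carlitzOmega (hθ : 1 < ‖θ‖) (hτ : θ = -τ ^ (Fintype.card Fq - 1)) :
    IsEntire (carlitzOmega Fq θ τ) := by
  have key : ∀ k : ℕ, PowerSeries.IsRestricted (‖θ‖ ^ Fintype.card Fq ^ k)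
      (carlitzOmega Fq θ τ) := by
    intro k
    induction k with
    | zero =>
      exact (gaussLE_carlitzOmega Fq hθ).isRestricted (by positivity)
        (by simpa using norm_lt_norm_pow_card Fq hθ)
    | succ k ih =>
      rw [carlitzOmega_eq_mul_twist Fq hθ hτ]
      refine PowerSeries.isRestricted.mul _ ?_ ?_
      · have := isRestricted_coe (‖θ‖ ^ Fintype.card Fq ^ (k + 1))
          (X - C (θ ^ Fintype.card Fq))
        simpa using this
      · have := isRestricted_twist (Fq := Fq) ih 1
        rwa [Nat.cast_one, pow_one, ← pow_mul, ← pow_succ] at this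
  refine isEntire_of_nonneg fun c hc => ?_
  obtain ⟨n, hn⟩ := pow_unbounded_of_one_lt c hθ
  obtain ⟨M, hM⟩ := exists_gaussLE (key n)
  refine hM.isRestricted hc (hn.trans_le ?_)
  exact pow_le_pow_right₀ hθ.le (Nat.lt_pow_self Fintype.one_lt_card).le

omit [PerfectField L] [Algebra Fq L] in
lemma isUnit_carlitzOmega (hθ : 1 < ‖θ‖) (hτ : θ = -τ ^ (Fintype.card Fq - 1)) :
    carlitzOmega Fq θ τ * (PowerSeries.C (τ ^ Fintype.card Fq) * (omegaProd Fq θ)⁻¹) = 1 := by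
  have hτ0 := tTilde_ne_zero Fq hθ hτ
  rw [carlitzOmega_eq, mul_mul_mul_comm, ← map_mul, one_div, inv_mul_cancel₀ (pow_ne_zero _ hτ0),
    map_one, one_mul, PowerSeries.mul_inv_cancel]
  rw [constantCoeff_omegaProd Fq hθ]
  exact one_ne_zero

omit [PerfectField L] [Algebra Fq L] in
lemma isRestricted_omegaInv (hθ : 1 < ‖θ‖) {c : ℝ} (hc : 0 ≤ c) (hcθ : c ≤ ‖θ‖) :
    PowerSeries.IsRestricted c
      (PowerSeries.C (τ ^ Fintype.card Fq) * (omegaProd Fq θ)⁻¹) :=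
  PowerSeries.isRestricted.mul _ (PowerSeries.isRestricted_C _ _)
    (isRestricted_inv_omegaProd Fq hθ hc hcθ)

/-- The inverse series also converges at `T = t`, and evaluation is multiplicative. -/
lemma evalAt_carlitzOmega_ne_zero (hθ : 1 < ‖θ‖) (hτ : θ = -τ ^ (Fintype.card Fq - 1)) :
    evalAt θ (carlitzOmega Fq θ τ) ≠ 0 := by
  have h := evalAt_mul (isEntire_carlitzOmega Fq hθ hτ ‖θ‖)
    (isRestricted_omegaInv Fq (τ := τ) hθ (norm_nonneg θ) le_rfl)
  have h1 : evalAt θ (1 : PowerSeries L) = 1 := by simpa using evalAt_coe θ 1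
  rw [isUnit_carlitzOmega Fq hθ hτ, h1] at h
  intro h0
  rw [h0, zero_mul] at h
  exact one_ne_zero h

/-- `ℓ_d = ∏_{j = 1}^d (t - t ^ (q ^ j))`. -/
def carlitzEll {R : Type*} [CommRing R] (θ : R) (d : ℕ) : R :=
  ∏ j ∈ Finset.range d, (θ - θ ^ Fintype.card Fq ^ (j + 1))

/-- At `T = t`, each use of the functional equation contributes one factor of `ℓ_d`. These factors
absorb those produced by the Anderson–Thakur polynomials. -/
lemma evalAt_twist_carlitzOmega (hθ : 1 < ‖θ‖) (hτ : θ = -τ ^ (Fintype.card Fq - 1)) (d : ℕ) :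
    carlitzEll Fq θ d * evalAt θ (twist Fq d (carlitzOmega Fq θ τ)) =
      evalAt θ (carlitzOmega Fq θ τ) := by
  induction d with
  | zero => simp [carlitzEll]
  | succ d ih =>
    rw [← ih, twist_natCast_carlitzOmega Fq hθ hτ d, evalAt_mul]
    · rw [carlitzEll, Finset.prod_range_succ, mul_assoc]
      congr 2
      have := evalAt_coe θ (X - C (θ ^ Fintype.card Fq ^ (d + 1)))
      simpa using this.symm
    · have := isRestricted_coe ‖θ‖ (X - C (θ ^ Fintype.card Fq ^ (d + 1)))
      simpa using this
    · exact (isEntire_carlitzOmega Fq hθ hτ).twist _ _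

end OmegaProduct

/-! ### Carlitz factorials and their divisibility -/

section Factorial

variable (Fq : Type*) [Field Fq] [Fintype Fq]

lemma sub_pow_card_pow {R : Type*} [CommRing R] [Algebra Fq R] (x y : R) (n : ℕ) :
    (x - y) ^ Fintype.card Fq ^ n = x ^ Fintype.card Fq ^ n - y ^ Fintype.card Fq ^ n := by
  induction n with
  | zero => simp
  | succ n ih =>
    have h : ∀ z : R, z ^ Fintype.card Fq = FiniteField.frobeniusAlgHom Fq R z := fun z => rfl
    rw [pow_succ, pow_mul, ih, h, map_sub, ← h, ← h, ← pow_mul, ← pow_mul]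

lemma add_pow_card_pow {R : Type*} [CommRing R] [Algebra Fq R] (x y : R) (n : ℕ) :
    (x + y) ^ Fintype.card Fq ^ n = x ^ Fintype.card Fq ^ n + y ^ Fintype.card Fq ^ n := by
  have h := sub_pow_card_pow Fq (x + y) y n
  rw [add_sub_cancel_right] at h
  rw [h, sub_add_cancel]

/-- `[k] = t ^ (q ^ k) - t`. -/
noncomputable def carlitzBracket (k : ℕ) : Fq[X] := X ^ Fintype.card Fq ^ k - X

/-- The factor `t^(q^n) - t^(q^i)` is the `q^i`-th power of `[n - i]`; here `k + 1 = n - i`. -/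
lemma carlitzD_eq_prod_bracket (n : ℕ) :
    carlitzD Fq n = ∏ k ∈ Finset.range n, carlitzBracket Fq (k + 1) ^ Fintype.card Fq ^ (n - 1 - k) := by
  rw [carlitzD, ← Finset.prod_range_reflect]
  refine Finset.prod_congr rfl fun k hk => ?_
  have hk' := Finset.mem_range.1 hk
  rw [carlitzBracket, sub_pow_card_pow Fq, ← pow_mul, ← pow_add]
  congr 3
  omega

/-- The left side is the exponent of `[k + 1]` in `Π_n`, counting the lowest `N` digits only:
dropping the `k + 1` lowest digits is division by `q^(k+1)`. -/
lemma sum_digits_mul_pow (q : ℕ) (hq : 0 < q) (n k N : ℕ) :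
    ∑ i ∈ Finset.range N, (if k < i then q ^ (i - 1 - k) else 0) * (n / q ^ i % q) =
      n % q ^ N / q ^ (k + 1) := by
  induction N with
  | zero => simp [Nat.mod_one]
  | succ N ih =>
    rw [Finset.sum_range_succ, ih, Nat.mod_pow_succ]
    split_ifs with h
    · have e : q ^ N = q ^ (k + 1) * q ^ (N - 1 - k) := by rw [← pow_add]; congr 1; omega
      rw [show q ^ N * (n / q ^ N % q) = q ^ (k + 1) * (q ^ (N - 1 - k) * (n / q ^ N % q)) by
        rw [← mul_assoc, ← e], Nat.add_mul_div_left _ _ (by positivity)]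
    · have hN : N + 1 ≤ k + 1 := by omega
      rw [zero_mul, add_zero, ← Nat.mod_pow_succ, Nat.div_eq_of_lt, Nat.div_eq_of_lt]
      · exact (Nat.mod_lt _ (by positivity)).trans_le (Nat.pow_le_pow_right hq hN)
      · exact (Nat.mod_lt _ (by positivity)).trans_le (Nat.pow_le_pow_right hq (by omega))

/-- The analogue of the formula of Legendre. -/
lemma carlitzFactorial_eq_prod_bracket {n N : ℕ} (hN : n < N) :
    carlitzFactorial Fq n =
      ∏ k ∈ Finset.range N, carlitzBracket Fq (k + 1) ^ (n / Fintype.card Fq ^ (k + 1)) := by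
  have hq : 1 < Fintype.card Fq := Fintype.one_lt_card
  have h1 : carlitzFactorial Fq n =
      ∏ i ∈ Finset.range N, carlitzD Fq i ^ (n / Fintype.card Fq ^ i % Fintype.card Fq) := by
    refine Finset.prod_subset (Finset.range_subset_range.2 hN) fun i _ hi => ?_
    have : n < Fintype.card Fq ^ i :=
      (Nat.lt_pow_self hq).trans_le (Nat.pow_le_pow_right hq.le (by simp at hi; omega))
    rw [Nat.div_eq_of_lt this, Nat.zero_mod, pow_zero]
  have h2 : ∀ i ∈ Finset.range N, carlitzD Fq i = ∏ k ∈ Finset.range N,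
      carlitzBracket Fq (k + 1) ^ (if k < i then Fintype.card Fq ^ (i - 1 - k) else 0) := by
    intro i hi
    rw [carlitzD_eq_prod_bracket]
    have hs : Finset.range i ⊆ Finset.range N :=
      Finset.range_subset_range.2 (Finset.mem_range.1 hi).le
    rw [← Finset.prod_subset hs fun k _ hk => by rw [if_neg (by simpa using hk), pow_zero]]
    exact Finset.prod_congr rfl fun k hk => by rw [if_pos (Finset.mem_range.1 hk)]
  rw [h1, Finset.prod_congr rfl fun i hi => by rw [h2 i hi, ← Finset.prod_pow],
    Finset.prod_comm]
  refine Finset.prod_congr rfl fun k _ => ?_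
  simp only [← pow_mul]
  rw [Finset.prod_pow_eq_pow_sum, sum_digits_mul_pow _ (by omega), Nat.mod_eq_of_lt]
  exact hN.trans (Nat.lt_pow_self hq)

/-- For each bracket the exponents satisfy `⌊a/m⌋ + ⌊b/m⌋ ≤ ⌊(a+b)/m⌋` with `m = q^(k+1)`. The
integrality of the `H_n` comes from here. -/
lemma carlitzFactorial_mul_dvd (a b : ℕ) :
    carlitzFactorial Fq a * carlitzFactorial Fq b ∣ carlitzFactorial Fq (a + b) := by
  rw [carlitzFactorial_eq_prod_bracket Fq (N := a + b + 1) (by omega : a < a + b + 1),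
    carlitzFactorial_eq_prod_bracket Fq (N := a + b + 1) (by omega : b < a + b + 1),
    carlitzFactorial_eq_prod_bracket Fq (Nat.lt_succ_self (a + b)), ← Finset.prod_mul_distrib]
  refine Finset.prod_dvd_prod_of_dvd _ _ fun k _ => ?_
  rw [← pow_add]
  exact pow_dvd_pow _ (Nat.div_add_div_le_add_div)

lemma carlitzFactorial_zero : carlitzFactorial Fq 0 = 1 := by
  simp [carlitzFactorial]

/-- Identifies the denominators `D_i` of the generating series with factorials, so that its
recursion involves only Carlitz binomial coefficients. -/
lemma carlitzFactorial_card_pow (i : ℕ) :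
    carlitzFactorial Fq (Fintype.card Fq ^ i) = carlitzD Fq i := by
  have hq : 1 < Fintype.card Fq := Fintype.one_lt_card
  rw [carlitzFactorial, Finset.prod_eq_single i]
  · rw [Nat.div_self (by positivity), Nat.mod_eq_of_lt hq, pow_one]
  · intro j _ hj
    rcases lt_or_gt_of_ne hj with h | h
    · rw [Nat.pow_div h.le (by positivity)]
      obtain ⟨m, hm⟩ := Nat.exists_eq_succ_of_ne_zero (Nat.sub_pos_of_lt h).ne'
      rw [hm, Nat.succ_eq_add_one, pow_succ, Nat.mul_mod_left, pow_zero]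
    · rw [Nat.div_eq_of_lt (Nat.pow_lt_pow_right hq h), Nat.zero_mod, pow_zero]
  · intro h
    exact absurd (Finset.mem_range.2 ((Nat.lt_pow_self hq).trans (Nat.lt_succ_self _))) h

/-- The Carlitz binomial coefficient `Π_{a + b} / (Π_a Π_b)`. -/
noncomputable def carlitzBinomial (a b : ℕ) : Fq[X] := (carlitzFactorial_mul_dvd Fq a b).choose

lemma carlitzFactorial_add (a b : ℕ) : carlitzFactorial Fq (a + b) =
    carlitzFactorial Fq a * carlitzFactorial Fq b * carlitzBinomial Fq a b :=
  (carlitzFactorial_mul_dvd Fq a b).choose_spec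

lemma carlitzD_ne_zero (n : ℕ) : carlitzD Fq n ≠ 0 := by
  refine Finset.prod_ne_zero_iff.2 fun i hi h => ?_
  have h1 := congrArg natDegree (sub_eq_zero.1 h)
  rw [natDegree_X_pow, natDegree_X_pow] at h1
  exact (Finset.mem_range.1 hi).ne' (Nat.pow_right_injective (Fintype.one_lt_card (α := Fq)) h1)

lemma carlitzFactorial_ne_zero (n : ℕ) : carlitzFactorial Fq n ≠ 0 :=
  Finset.prod_ne_zero_iff.2 fun i _ => pow_ne_zero _ (carlitzD_ne_zero Fq i)

end Factorial

/-! ### Reciprocals of series in the `x^(q^i)` -/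

section Recursion

variable {R : Type*} [CommRing R]

/-- The power series `∑ γ_i x ^ (q ^ i)`. -/
noncomputable def linearizedSeries (q : ℕ) (γ : ℕ → R) : PowerSeries R :=
  PowerSeries.mk fun n => ∑ i ∈ Finset.range (n + 1), if n = q ^ i then γ i else 0

lemma coeff_linearizedSeries_mul {q : ℕ} (hq : 1 < q) (γ u : ℕ → R) (n : ℕ) :
    PowerSeries.coeff n (linearizedSeries q γ * PowerSeries.mk u) =
      ∑ i ∈ Finset.range n, if q ^ i ≤ n then γ i * u (n - q ^ i) else 0 := by
  -- Hence `q^i ≤ n` forces `i < n`, and the finite ranges miss nothing.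
  have hlt : ∀ i, i < q ^ i := fun i => Nat.lt_pow_self hq
  rw [PowerSeries.coeff_mul, Finset.Nat.sum_antidiagonal_eq_sum_range_succ_mk]
  simp only [linearizedSeries, PowerSeries.coeff_mk]
  have h1 : ∀ a ∈ Finset.range n.succ,
      (∑ i ∈ Finset.range (a + 1), if a = q ^ i then γ i else 0) * u (n - a) =
      ∑ i ∈ Finset.range n, if a = q ^ i then γ i * u (n - q ^ i) else 0 := by
    intro a ha
    have ha' : a ≤ n := Nat.lt_succ_iff.1 (Finset.mem_range.1 ha)
    rw [Finset.sum_mul]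
    have e1 : ∀ N, a ≤ N → (∑ i ∈ Finset.range N, if a = q ^ i then γ i * u (n - q ^ i) else 0) =
        ∑ i ∈ Finset.range a, if a = q ^ i then γ i * u (n - q ^ i) else 0 := by
      intro N hN
      refine (Finset.sum_subset (Finset.range_subset_range.2 hN) fun i _ hi => ?_).symm
      rw [if_neg]
      rintro rfl
      exact hi (Finset.mem_range.2 (hlt i))
    rw [e1 n ha', ← e1 (a + 1) (Nat.le_succ a)]
    refine Finset.sum_congr rfl fun i _ => ?_
    split_ifs with h
    · rw [h]
    · rw [zero_mul]
  rw [Finset.sum_congr rfl h1, Finset.sum_comm]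
  refine Finset.sum_congr rfl fun i _ => ?_
  rw [Finset.sum_ite_eq' (Finset.range n.succ) (q ^ i)]
  simp only [Finset.mem_range, Nat.lt_succ_iff]

lemma one_sub_linearizedSeries_mul_eq_one_iff {q : ℕ} (hq : 1 < q) (γ u : ℕ → R) :
    (1 - linearizedSeries q γ) * PowerSeries.mk u = 1 ↔
      ∀ n, u n = (if n = 0 then 1 else 0) +
        ∑ i ∈ Finset.range n, if q ^ i ≤ n then γ i * u (n - q ^ i) else 0 := by
  rw [PowerSeries.ext_iff]
  refine forall_congr' fun n => ?_
  rw [sub_mul, one_mul, map_sub, coeff_linearizedSeries_mul hq, PowerSeries.coeff_mk,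
    PowerSeries.coeff_one, sub_eq_iff_eq_add]

end Recursion

/-! ### The Anderson–Thakur polynomials -/

section AndersonThakur

variable (Fq : Type*) [Field Fq] [Fintype Fq]

/-- `∏_{j < i} (T ^ (q ^ i) - t ^ (q ^ j))`. -/
noncomputable def andersonThakurNum (i : ℕ) : Fq[X][X] :=
  ∏ j ∈ Finset.range i, (X ^ Fintype.card Fq ^ i - C X ^ Fintype.card Fq ^ j)

/-- The twist `H_n^{(-1)}` of the Anderson–Thakur polynomial `H_n`, which is a polynomial in
`t ^ q`. -/
noncomputable def andersonThakurTwist (n : ℕ) : Fq[X][X] :=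
  (if n = 0 then 1 else 0) + ∑ i ∈ Finset.range n,
    if h : Fintype.card Fq ^ i ≤ n then
      have _hlt : n - Fintype.card Fq ^ i < n := by
        have : 0 < Fintype.card Fq ^ i := pow_pos Fintype.card_pos _
        omega
      andersonThakurNum Fq i *
        (carlitzBinomial Fq (Fintype.card Fq ^ i) (n - Fintype.card Fq ^ i)).map C *
        andersonThakurTwist (n - Fintype.card Fq ^ i)
    else 0
termination_by n
decreasing_by exact _hlt

/-- The substitution `t ↦ t ^ q` in the coefficients. -/
noncomputable def coeffExpand : Fq[X][X] →+* Fq[X][X] :=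
  Polynomial.mapRingHom (expand Fq (Fintype.card Fq) : Fq[X] →+* Fq[X])

/-- The Anderson–Thakur polynomial `H_n`. -/
noncomputable def andersonThakurPoly (n : ℕ) : Fq[X][X] :=
  coeffExpand Fq (andersonThakurTwist Fq n)

lemma coeffExpand_andersonThakurNum (i : ℕ) : coeffExpand Fq (andersonThakurNum Fq i) =
    ∏ j ∈ Finset.range i, (X ^ Fintype.card Fq ^ i - C X ^ Fintype.card Fq ^ (j + 1)) := by
  rw [andersonThakurNum, map_prod]
  refine Finset.prod_congr rfl fun j _ => ?_
  simp [coeffExpand, pow_succ', pow_mul]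

/-- `p.map C` is `p(T)`, which does not involve `t`. -/
lemma coeffExpand_map_C (p : Fq[X]) : coeffExpand Fq (p.map C) = p.map C := by
  rw [coeffExpand, Polynomial.coe_mapRingHom, Polynomial.map_map]
  congr 1
  ext a
  simp

lemma andersonThakurPoly_eq (n : ℕ) : andersonThakurPoly Fq n =
    (if n = 0 then 1 else 0) + ∑ i ∈ Finset.range n, if Fintype.card Fq ^ i ≤ n then
      coeffExpand Fq (andersonThakurNum Fq i) *
        (carlitzBinomial Fq (Fintype.card Fq ^ i) (n - Fintype.card Fq ^ i)).map C *
        andersonThakurPoly Fq (n - Fintype.card Fq ^ i)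
    else 0 := by
  rw [andersonThakurPoly, andersonThakurTwist, map_add, map_sum]
  congr 1
  · split_ifs <;> simp
  · refine Finset.sum_congr rfl fun i _ => ?_
    split_ifs with h
    · rw [map_mul, map_mul, coeffExpand_map_C]
      rfl
    · exact map_zero _

/-- The recursion for `H_n`, divided by `Π_n`, says exactly this. An arbitrary `φ` is allowed
because two are needed: the inclusion in the fraction field, and the specialization `t ↦ t^(q^d)`,
`T ↦ t` that yields power sums. -/
lemma andersonThakur_generating {K : Type*} [Field K] (φ : Fq[X][X] →+* K)
    (hφ : ∀ n, φ ((carlitzFactorial Fq n).map C) ≠ 0) :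
    (1 - linearizedSeries (Fintype.card Fq) fun i =>
        φ (coeffExpand Fq (andersonThakurNum Fq i)) / φ ((carlitzD Fq i).map C)) *
      PowerSeries.mk (fun n => φ (andersonThakurPoly Fq n) / φ ((carlitzFactorial Fq n).map C)) =
    1 := by
  rw [one_sub_linearizedSeries_mul_eq_one_iff Fintype.one_lt_card]
  intro n
  rw [andersonThakurPoly_eq, map_add, map_sum, add_div, Finset.sum_div]
  congr 1
  · split_ifs with h
    · simp [h, carlitzFactorial_zero]
    · simp
  · refine Finset.sum_congr rfl fun i _ => ?_
    split_ifs with h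
    · obtain ⟨m, rfl⟩ := Nat.exists_eq_add_of_le h
      have hne := hφ (Fintype.card Fq ^ i + m)
      have hne2 := hφ m
      rw [Nat.add_sub_cancel_left] at *
      rw [carlitzFactorial_add, carlitzFactorial_card_pow] at *
      simp only [Polynomial.map_mul, map_mul] at *
      have h1 := left_ne_zero_of_mul (left_ne_zero_of_mul hne)
      have h3 := right_ne_zero_of_mul hne
      field_simp
    · simp

theorem isAndersonThakur_andersonThakurPoly : IsAndersonThakur Fq (andersonThakurPoly Fq) := by
  have hinj : Function.Injective (toFrac Fq) := IsFractionRing.injective _ _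
  have h := andersonThakur_generating Fq (toFrac Fq) fun n => by
    rw [map_ne_zero_iff _ hinj, Polynomial.map_ne_zero_iff C_injective]
    exact carlitzFactorial_ne_zero Fq n
  have hs : andersonThakurSeries Fq = 1 - linearizedSeries (Fintype.card Fq) fun i =>
      toFrac Fq (coeffExpand Fq (andersonThakurNum Fq i)) / toFrac Fq ((carlitzD Fq i).map C) := by
    rw [andersonThakurSeries, linearizedSeries]
    congr 2
    funext n
    refine Finset.sum_congr rfl fun i _ => ?_
    congr 1
    rw [Finset.prod_div_distrib, ← map_prod, ← map_prod, coeffExpand_andersonThakurNum,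
      carlitzD, Polynomial.map_prod]
    have e : Finset.Icc 1 i = Finset.Ico (0 + 1) (i + 1) := rfl
    rw [e, ← Finset.prod_Ico_add', ← Finset.prod_Ico_add', ← Finset.range_eq_Ico]
    simp
  unfold IsAndersonThakur
  rw [hs, PowerSeries.eq_inv_iff_mul_eq_one, mul_comm]
  · exact h
  · intro h0
    have := congrArg PowerSeries.constantCoeff h
    rw [map_mul, h0, zero_mul, map_one] at this
    exact zero_ne_one this

end AndersonThakur

/-! ### Degrees in `t` -/

section Degree

variable {R : Type*} [CommRing R]

/-- The degree of `p` in the variable `t` of the coefficients is at most `m / k`. -/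
def CoeffDegreeLE (k m : ℕ) (p : R[X][X]) : Prop := ∀ j, k * (p.coeff j).natDegree ≤ m

variable {k m m' : ℕ} {p p' : R[X][X]}

lemma coeffDegreeLE_iff (hk : 0 < k) :
    CoeffDegreeLE k m p ↔ ∀ j, (p.coeff j).natDegree ≤ m / k := by
  refine forall_congr' fun j => ?_
  rw [Nat.le_div_iff_mul_le hk, mul_comm]

lemma CoeffDegreeLE.mono (h : CoeffDegreeLE k m p) (hm : m ≤ m') : CoeffDegreeLE k m' p :=
  fun j => (h j).trans hm

lemma CoeffDegreeLE.add (hk : 0 < k) (h : CoeffDegreeLE k m p) (h' : CoeffDegreeLE k m p') :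
    CoeffDegreeLE k m (p + p') := by
  rw [coeffDegreeLE_iff hk] at *
  intro j
  rw [coeff_add]
  exact (natDegree_add_le _ _).trans (max_le (h j) (h' j))

lemma CoeffDegreeLE.sum (hk : 0 < k) {ι : Type*} (s : Finset ι) {p : ι → R[X][X]}
    (h : ∀ i ∈ s, CoeffDegreeLE k m (p i)) : CoeffDegreeLE k m (∑ i ∈ s, p i) := by
  classical
  induction s using Finset.induction_on with
  | empty => intro j; simp
  | insert a s ha ih =>
    rw [Finset.sum_insert ha]
    exact (h a (by simp)).add hk (ih fun i hi => h i (by simp [hi]))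

lemma CoeffDegreeLE.mul (hk : 0 < k) (h : CoeffDegreeLE k m p) (h' : CoeffDegreeLE k m' p') :
    CoeffDegreeLE k (m + m') (p * p') := by
  rw [coeffDegreeLE_iff hk]
  intro j
  rw [coeff_mul]
  refine natDegree_sum_le_of_forall_le _ _ fun x _ => natDegree_mul_le.trans ?_
  rw [Nat.le_div_iff_mul_le hk, mul_comm, mul_add]
  exact add_le_add (h _) (h' _)

lemma coeffDegreeLE_map_C (p : R[X]) : CoeffDegreeLE k 0 (p.map C) := by
  intro j
  rw [coeff_map, natDegree_C, mul_zero]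

end Degree

section AndersonThakurDegree

variable (Fq : Type*) [Field Fq] [Fintype Fq]

/-- The degrees in `t` of the factors add up to `1 + q + ⋯ + q^(i-1) = (q^i - 1)/(q - 1)`. -/
lemma coeffDegreeLE_andersonThakurNum (i : ℕ) :
    CoeffDegreeLE (Fintype.card Fq - 1) (Fintype.card Fq ^ i) (andersonThakurNum Fq i) := by
  have hk : 0 < Fintype.card Fq - 1 := Nat.sub_pos_of_lt Fintype.one_lt_card
  -- The exponent of `T` is separated from the number of factors, so that induction on the latter is
  -- possible.
  have h : ∀ e n, CoeffDegreeLE (Fintype.card Fq - 1) (Fintype.card Fq ^ n)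
      (∏ j ∈ Finset.range n, (X ^ e - C X ^ Fintype.card Fq ^ j : Fq[X][X])) := by
    intro e n
    induction n with
    | zero =>
      intro j
      rw [Finset.prod_range_zero, coeff_one]
      split_ifs <;> simp
    | succ n ih =>
      rw [Finset.prod_range_succ]
      have h1 : CoeffDegreeLE (Fintype.card Fq - 1) ((Fintype.card Fq - 1) * Fintype.card Fq ^ n)
          (X ^ e - C X ^ Fintype.card Fq ^ n : Fq[X][X]) := by
        intro j
        refine Nat.mul_le_mul_left _ ?_
        rw [coeff_sub, coeff_X_pow, ← map_pow, coeff_C]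
        refine (natDegree_sub_le _ _).trans (max_le ?_ ?_)
        · split_ifs <;> simp
        · split_ifs <;> simp
      refine (ih.mul hk h1).mono (le_of_eq ?_)
      obtain ⟨k, hk'⟩ := Nat.exists_eq_add_of_le (Fintype.card_pos (α := Fq))
      rw [hk', Nat.add_sub_cancel_left]
      ring
  exact h _ i

/-- Each step of the recursion lowers `n` by `q^i` and adds at most `q^i/(q-1)` to the degree in
`t`. The bound `n/(q-1)` is just enough against the size of `Ω`. -/
lemma coeffDegreeLE_andersonThakurTwist (n : ℕ) :
    CoeffDegreeLE (Fintype.card Fq - 1) n (andersonThakurTwist Fq n) := by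
  have hk : 0 < Fintype.card Fq - 1 := Nat.sub_pos_of_lt Fintype.one_lt_card
  induction n using Nat.strong_induction_on with
  | _ n ih =>
    rw [andersonThakurTwist]
    refine CoeffDegreeLE.add hk ?_ (CoeffDegreeLE.sum hk _ fun i _ => ?_)
    · intro j
      split_ifs
      · rw [coeff_one]
        split_ifs <;> simp
      · simp
    · split_ifs with h
      · have hpos : 0 < Fintype.card Fq ^ i := pow_pos Fintype.card_pos _
        refine ((CoeffDegreeLE.mul hk (coeffDegreeLE_andersonThakurNum Fq i)
          (coeffDegreeLE_map_C _)).mul hk (ih _ (by omega))).mono ?_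
        omega
      · intro j
        simp

end AndersonThakurDegree

/-! ### The `𝔽_q`-linear polynomials `E_d = e_d / D_d` -/

section LinearizedPolynomial

variable (Fq : Type*) [Field Fq] [Fintype Fq] {K : Type*} [Field K] [Algebra Fq K] {θ : K}

omit [Field Fq] [Algebra Fq K] in
lemma carlitzEll_succ (θ : K) (d : ℕ) : carlitzEll Fq θ (d + 1) =
    carlitzEll Fq θ d * (θ - θ ^ Fintype.card Fq ^ (d + 1)) :=
  Finset.prod_range_succ _ _

lemma pow_card_pow_sub_ne_zero (hθ : Transcendental Fq θ) {i j : ℕ} (h : i ≠ j) :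
    θ ^ Fintype.card Fq ^ i - θ ^ Fintype.card Fq ^ j ≠ 0 := by
  have hinj := transcendental_iff_injective.1 hθ
  have : aeval θ (X ^ Fintype.card Fq ^ i - X ^ Fintype.card Fq ^ j : Fq[X]) ≠ 0 := by
    rw [map_ne_zero_iff _ hinj, sub_ne_zero]
    intro h0
    have h1 := congrArg natDegree h0
    rw [natDegree_X_pow, natDegree_X_pow] at h1
    exact h (Nat.pow_right_injective (Fintype.one_lt_card (α := Fq)) h1)
  simpa using this

lemma carlitzEll_ne_zero (hθ : Transcendental Fq θ) (d : ℕ) : carlitzEll Fq θ d ≠ 0 := by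
  refine Finset.prod_ne_zero_iff.2 fun j _ => ?_
  simpa using pow_card_pow_sub_ne_zero Fq hθ (Nat.succ_ne_zero j).symm

omit [Fintype Fq] in
lemma aeval_ne_zero (hθ : Transcendental Fq θ) {p : Fq[X]} (hp : p ≠ 0) : aeval θ p ≠ 0 :=
  (map_ne_zero_iff _ (transcendental_iff_injective.1 hθ)).2 hp

lemma aeval_carlitzD_succ (θ : K) (n : ℕ) : aeval θ (carlitzD Fq (n + 1)) =
    (θ ^ Fintype.card Fq ^ (n + 1) - θ) * aeval θ (carlitzD Fq n) ^ Fintype.card Fq := by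
  rw [carlitzD, Finset.prod_range_succ', map_mul, mul_comm, carlitzD, ← map_pow,
    ← Finset.prod_pow, map_prod, map_prod]
  congr 1
  · simp
  · refine Finset.prod_congr rfl fun i _ => ?_
    have h := sub_pow_card_pow Fq (X ^ Fintype.card Fq ^ n : Fq[X])
      (X ^ Fintype.card Fq ^ i) 1
    rw [pow_one, ← pow_mul, ← pow_mul, ← pow_succ, ← pow_succ] at h
    rw [h]

/-- The coefficients of `e_d / D_d`, where `e_d` is the `𝔽_q`-linear polynomial whose roots are the
polynomials in `t` of degree less than `d`. -/
noncomputable def carlitzCoeff (θ : K) (d i : ℕ) : K :=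
  if i ≤ d then
    1 / (aeval θ (carlitzD Fq i) * carlitzEll Fq θ (d - i) ^ Fintype.card Fq ^ i)
  else 0

lemma carlitzCoeff_pow_card (θ : K) {d i : ℕ} (hi : i ≤ d)
    (h : θ ^ Fintype.card Fq ^ (i + 1) - θ ≠ 0) :
    carlitzCoeff Fq θ d i ^ Fintype.card Fq =
      (θ ^ Fintype.card Fq ^ (i + 1) - θ) * carlitzCoeff Fq θ (d + 1) (i + 1) := by
  rw [carlitzCoeff, carlitzCoeff, if_pos hi, if_pos (by omega), Nat.add_sub_add_right,
    aeval_carlitzD_succ, div_pow, one_pow, mul_pow, ← pow_mul, ← pow_succ, mul_assoc,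
    one_div, one_div, mul_inv (θ ^ Fintype.card Fq ^ (i + 1) - θ), mul_inv_cancel_left₀ h]

lemma carlitzCoeff_eq_mul_succ (hθ : Transcendental Fq θ) {d i : ℕ} (hi : i ≤ d + 1) :
    carlitzCoeff Fq θ d i =
      (θ ^ Fintype.card Fq ^ i - θ ^ Fintype.card Fq ^ (d + 1)) * carlitzCoeff Fq θ (d + 1) i := by
  rcases Nat.lt_or_ge d i with h | h
  · obtain rfl : i = d + 1 := by omega
    rw [sub_self, zero_mul, carlitzCoeff, if_neg (by omega)]
  · obtain ⟨m, rfl⟩ := Nat.exists_eq_add_of_le h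
    have hne := carlitzEll_ne_zero Fq hθ m
    have hD := aeval_ne_zero Fq hθ (carlitzD_ne_zero Fq i)
    have h1 : θ ^ Fintype.card Fq ^ i - θ ^ Fintype.card Fq ^ (i + m + 1) =
        (θ - θ ^ Fintype.card Fq ^ (m + 1)) ^ Fintype.card Fq ^ i := by
      rw [sub_pow_card_pow Fq, ← pow_mul, ← pow_add]
      congr 3
      omega
    have h2 := pow_card_pow_sub_ne_zero Fq hθ (by omega : i ≠ i + m + 1)
    rw [carlitzCoeff, carlitzCoeff, if_pos h, if_pos hi, Nat.add_sub_cancel_left,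
      show i + m + 1 - i = m + 1 by omega, carlitzEll_succ, mul_pow, ← h1]
    field_simp

/-- The `𝔽_q`-linear polynomial `e_d / D_d`. -/
noncomputable def carlitzPoly (θ : K) (d : ℕ) : K[X] :=
  ∑ i ∈ Finset.range (d + 1), C (carlitzCoeff Fq θ d i) * X ^ Fintype.card Fq ^ i

lemma eval_carlitzPoly (θ x : K) (d : ℕ) : (carlitzPoly Fq θ d).eval x =
    ∑ i ∈ Finset.range (d + 1), carlitzCoeff Fq θ d i * x ^ Fintype.card Fq ^ i := by
  simp [carlitzPoly, eval_finsetSum]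

lemma eval_carlitzPoly_add (θ x y : K) (d : ℕ) : (carlitzPoly Fq θ d).eval (x + y) =
    (carlitzPoly Fq θ d).eval x + (carlitzPoly Fq θ d).eval y := by
  simp only [eval_carlitzPoly, add_pow_card_pow Fq, mul_add, Finset.sum_add_distrib]

lemma algebraMap_pow_card_pow (c : Fq) (i : ℕ) :
    algebraMap Fq K c ^ Fintype.card Fq ^ i = algebraMap Fq K c := by
  rw [← map_pow, FiniteField.pow_card_pow]

lemma eval_carlitzPoly_smul (θ x : K) (c : Fq) (d : ℕ) :
    (carlitzPoly Fq θ d).eval (algebraMap Fq K c * x) =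
      algebraMap Fq K c * (carlitzPoly Fq θ d).eval x := by
  simp only [eval_carlitzPoly, Finset.mul_sum, mul_pow, algebraMap_pow_card_pow]
  exact Finset.sum_congr rfl fun i _ => by ring

lemma sum_pow_card {ι : Type*} (s : Finset ι) (f : ι → K) :
    (∑ i ∈ s, f i) ^ Fintype.card Fq = ∑ i ∈ s, f i ^ Fintype.card Fq :=
  map_sum (FiniteField.frobeniusAlgHom Fq K) f s

lemma eval_carlitzPoly_pow_card (hθ : Transcendental Fq θ) (x : K) (d : ℕ) :
    (carlitzPoly Fq θ d).eval x ^ Fintype.card Fq =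
      ∑ i ∈ Finset.range (d + 2), (θ ^ Fintype.card Fq ^ i - θ) *
        (carlitzCoeff Fq θ (d + 1) i * x ^ Fintype.card Fq ^ i) := by
  rw [eval_carlitzPoly, sum_pow_card, Finset.sum_range_succ' _ (d + 1), pow_zero, pow_one, sub_self,
    zero_mul, add_zero]
  refine Finset.sum_congr rfl fun i hi => ?_
  rw [mul_pow, carlitzCoeff_pow_card Fq θ (Nat.lt_succ_iff.1 (Finset.mem_range.1 hi)), ← pow_mul,
    ← pow_succ, mul_assoc]
  simpa using pow_card_pow_sub_ne_zero Fq hθ (Nat.succ_ne_zero i)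

lemma eval_carlitzPoly_eq_sum_succ (hθ : Transcendental Fq θ) (x : K) (d : ℕ) :
    (carlitzPoly Fq θ d).eval x = ∑ i ∈ Finset.range (d + 2),
      (θ ^ Fintype.card Fq ^ i - θ ^ Fintype.card Fq ^ (d + 1)) *
        (carlitzCoeff Fq θ (d + 1) i * x ^ Fintype.card Fq ^ i) := by
  rw [Finset.sum_range_succ, sub_self, zero_mul, add_zero, eval_carlitzPoly]
  refine Finset.sum_congr rfl fun i hi => ?_
  rw [carlitzCoeff_eq_mul_succ Fq hθ (Finset.mem_range.1 hi).le, mul_assoc]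

/-- The coefficients of `E_d^q` and of `E_d` are those of `E_{d+1}` times `t^(q^i) - t` and `t^(q^i)
- t^(q^(d+1))`; in the difference the dependence on `i` cancels. Consequently `E_{d+1}` vanishes
wherever `E_d` takes a value in `𝔽_q`. -/
lemma eval_carlitzPoly_succ (hθ : Transcendental Fq θ) (x : K) (d : ℕ) :
    (θ ^ Fintype.card Fq ^ (d + 1) - θ) * (carlitzPoly Fq θ (d + 1)).eval x =
      (carlitzPoly Fq θ d).eval x ^ Fintype.card Fq - (carlitzPoly Fq θ d).eval x := by
  rw [eval_carlitzPoly_pow_card Fq hθ, eval_carlitzPoly_eq_sum_succ Fq hθ x d,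
    ← Finset.sum_sub_distrib, eval_carlitzPoly, Finset.mul_sum]
  exact Finset.sum_congr rfl fun i _ => by ring

lemma eval_carlitzPoly_mul (hθ : Transcendental Fq θ) (x : K) (d : ℕ) :
    (carlitzPoly Fq θ (d + 1)).eval (θ * x) =
      θ * (carlitzPoly Fq θ (d + 1)).eval x + (carlitzPoly Fq θ d).eval x ^ Fintype.card Fq := by
  rw [eval_carlitzPoly_pow_card Fq hθ, eval_carlitzPoly, eval_carlitzPoly, Finset.mul_sum,
    ← Finset.sum_add_distrib]
  refine Finset.sum_congr rfl fun i _ => ?_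
  rw [mul_pow]
  ring

/-- By induction `E_d` has values in `𝔽_q` on degree at most `d`, so `E_{d+1}` vanishes there. For
the leading monomial `t^(d+1) = t · t^d`, the rule for multiplication by `t` gives `E_{d+1}(t^(d+1))
= E_d(t^d)^q = 1`. -/
lemma eval_carlitzPoly_aeval (hθ : Transcendental Fq θ) (d : ℕ) :
    ∀ p : Fq[X], p.natDegree ≤ d →
      (carlitzPoly Fq θ d).eval (aeval θ p) = algebraMap Fq K (p.coeff d) := by
  induction d with
  | zero =>
    intro p hp
    rw [eq_C_of_natDegree_le_zero hp, aeval_C, eval_carlitzPoly]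
    simp [carlitzCoeff, carlitzD, carlitzEll]
  | succ d ih =>
    have low : ∀ p : Fq[X], p.natDegree ≤ d →
        (carlitzPoly Fq θ (d + 1)).eval (aeval θ p) = 0 := by
      intro p hp
      have h := eval_carlitzPoly_succ Fq hθ (aeval θ p) d
      have h2 := algebraMap_pow_card_pow Fq (K := K) (p.coeff d) 1
      rw [pow_one] at h2
      rw [ih p hp, h2, sub_self] at h
      refine (mul_eq_zero.1 h).resolve_left ?_
      simpa using pow_card_pow_sub_ne_zero Fq hθ (Nat.succ_ne_zero d)
    intro p hp
    have hp' : p = (p - C (p.coeff (d + 1)) * X ^ (d + 1)) + C (p.coeff (d + 1)) * X ^ (d + 1) := by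
      ring
    have hr : (p - C (p.coeff (d + 1)) * X ^ (d + 1)).natDegree ≤ d := by
      rw [natDegree_le_iff_coeff_eq_zero]
      intro N hN
      rw [coeff_sub, coeff_C_mul_X_pow]
      split_ifs with h
      · rw [h, sub_self]
      · rw [sub_zero, coeff_eq_zero_of_natDegree_lt (by omega)]
    conv_lhs => rw [hp']
    rw [map_add, eval_carlitzPoly_add, low _ hr, zero_add, map_mul, aeval_C, map_pow, aeval_X,
      eval_carlitzPoly_smul, pow_succ', eval_carlitzPoly_mul Fq hθ]
    have h1 := low (X ^ d) (natDegree_X_pow_le d)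
    have h2 := ih (X ^ d) (natDegree_X_pow_le d)
    rw [map_pow, aeval_X] at h1 h2
    rw [h1, h2]
    simp

end LinearizedPolynomial

/-! ### Power sums and special values of Anderson–Thakur polynomials -/

section PowerSums

variable (Fq : Type*) [Field Fq] [Fintype Fq]

lemma finite_monic_natDegree_eq (d : ℕ) : {a : Fq[X] | a.Monic ∧ a.natDegree = d}.Finite := by
  have e : {a : Fq[X] // a.Monic ∧ a.natDegree = d} ≃ (Fin d → Fq) :=
    (monicEquivDegreeLT d).trans (degreeLTEquiv Fq d).toEquiv
  have : Finite {a : Fq[X] | a.Monic ∧ a.natDegree = d} := Finite.of_equiv _ e.symm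
  exact Set.toFinite _

/-- The finite set of monic polynomials of degree `d`. -/
noncomputable def monicsOfDegree (d : ℕ) : Finset Fq[X] := (finite_monic_natDegree_eq Fq d).toFinset

lemma mem_monicsOfDegree {d : ℕ} {a : Fq[X]} :
    a ∈ monicsOfDegree Fq d ↔ a.Monic ∧ a.natDegree = d := by
  simp [monicsOfDegree]

lemma card_monicsOfDegree (d : ℕ) : (monicsOfDegree Fq d).card = Fintype.card Fq ^ d := by
  have e : {a : Fq[X] // a.Monic ∧ a.natDegree = d} ≃ (Fin d → Fq) :=
    (monicEquivDegreeLT d).trans (degreeLTEquiv Fq d).toEquiv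
  have h : Nat.card (monicsOfDegree Fq d) = Nat.card (Fin d → Fq) :=
    Nat.card_congr ((Equiv.subtypeEquivRight fun a => mem_monicsOfDegree Fq).trans e)
  rw [Nat.card_eq_fintype_card, Fintype.card_coe, Nat.card_eq_fintype_card] at h
  simpa using h

variable {K : Type*} [Field K] [Algebra Fq K] {θ : K}

/-- The geometric series of `1 / (a - x)`. -/
lemma X_sub_C_mul_geometric {a : K} (ha : a ≠ 0) :
    ((X - C a : K[X]) : PowerSeries K) * PowerSeries.mk (fun n => 1 / a ^ (n + 1)) = -1 := by
  ext n
  rw [Polynomial.coe_sub, Polynomial.coe_X, Polynomial.coe_C, sub_mul, map_sub,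
    PowerSeries.coeff_C_mul, PowerSeries.coeff_mk]
  cases n with
  | zero =>
    simp [ha]
  | succ n =>
    rw [PowerSeries.coeff_succ_X_mul, PowerSeries.coeff_mk]
    simp only [map_neg, PowerSeries.coeff_one, Nat.succ_ne_zero, if_false, neg_zero]
    rw [sub_eq_zero, pow_succ' a (n + 1)]
    field_simp

lemma natDegree_one_sub_carlitzPoly_le (θ : K) (d : ℕ) :
    (1 - carlitzPoly Fq θ d).natDegree ≤ Fintype.card Fq ^ d := by
  refine (natDegree_sub_le _ _).trans (max_le (by simp) ?_)
  refine natDegree_sum_le_of_forall_le _ _ fun i hi => ?_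
  refine (natDegree_C_mul_X_pow_le _ _).trans (Nat.pow_le_pow_right Fintype.card_pos ?_)
  exact Nat.lt_succ_iff.1 (Finset.mem_range.1 hi)

/-- The `q^d` monic polynomials of degree `d` are distinct roots of a nonzero polynomial of degree
at most `q^d`, so the cofactor is constant. -/
lemma exists_one_sub_carlitzPoly_eq (hθ : Transcendental Fq θ) (d : ℕ) :
    ∃ c : K, 1 - carlitzPoly Fq θ d = C c * ∏ a ∈ monicsOfDegree Fq d, (X - C (aeval θ a)) := by
  have hdvd : ∏ a ∈ monicsOfDegree Fq d, (X - C (aeval θ a)) ∣ 1 - carlitzPoly Fq θ d := by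
    refine Finset.prod_dvd_of_coprime
      ((pairwise_coprime_X_sub_C (transcendental_iff_injective.1 hθ)).set_pairwise _) ?_
    intro a ha
    obtain ⟨hm, hd⟩ := (mem_monicsOfDegree Fq).1 ha
    rw [dvd_iff_isRoot, IsRoot.def, eval_sub, eval_one, eval_carlitzPoly_aeval Fq hθ d a hd.le,
      ← hd, coeff_natDegree, hm.leadingCoeff, map_one, sub_self]
  obtain ⟨Q, hQ⟩ := hdvd
  have hne : 1 - carlitzPoly Fq θ d ≠ 0 := by
    intro h
    have h1 := congrArg (eval 0) h
    rw [eval_sub, eval_carlitzPoly] at h1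
    simp at h1
  have hmonic : (∏ a ∈ monicsOfDegree Fq d, (X - C (aeval θ a))).Monic :=
    monic_prod_of_monic _ _ fun a _ => monic_X_sub_C _
  have hdeg : (∏ a ∈ monicsOfDegree Fq d, (X - C (aeval θ a))).natDegree = Fintype.card Fq ^ d := by
    rw [natDegree_prod_of_monic _ _ fun a _ => monic_X_sub_C _]
    simp [card_monicsOfDegree]
  have hQ0 : Q ≠ 0 := by
    rintro rfl
    exact hne (by rw [hQ, mul_zero])
  have h2 := natDegree_one_sub_carlitzPoly_le Fq θ d
  rw [hQ, hmonic.natDegree_mul' hQ0, hdeg] at h2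
  refine ⟨Q.coeff 0, ?_⟩
  rw [hQ, mul_comm, ← eq_C_of_natDegree_le_zero (by omega)]

/-- In characteristic dividing `q`, only the linear term of `E_d` survives differentiation. -/
lemma derivative_one_sub_carlitzPoly (θ : K) (d : ℕ) :
    derivative (1 - carlitzPoly Fq θ d) = C (-(1 / carlitzEll Fq θ d)) := by
  have hq : (Fintype.card Fq : K) = 0 := by
    have := FiniteField.cast_card_eq_zero Fq
    rw [← map_natCast (algebraMap Fq K), this, map_zero]
  rw [carlitzPoly, Finset.sum_range_succ', derivative_sub, derivative_add, derivative_one,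
    derivative_sum]
  rw [Finset.sum_eq_zero]
  · simp [carlitzCoeff, carlitzD]
  · intro i _
    simp [pow_succ, hq, derivative_X_pow]

omit [Algebra Fq K] in
lemma powerSum_eq_sum {L : Type*} [NormedField L] [Algebra Fq L] (θ : L) (d s : ℕ) :
    powerSum Fq θ d s = ∑ a ∈ monicsOfDegree Fq d, 1 / aeval θ a ^ s :=
  finsum_mem_eq_finite_toFinset_sum _ (finite_monic_natDegree_eq Fq d)

/-- The logarithmic derivative of `1 - e_d / D_d`. -/
lemma one_sub_carlitzPoly_mul_mk (hθ : Transcendental Fq θ) (d : ℕ) :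
    ((1 - carlitzPoly Fq θ d : K[X]) : PowerSeries K) *
      PowerSeries.mk (fun n => ∑ a ∈ monicsOfDegree Fq d, 1 / aeval θ a ^ (n + 1)) =
    PowerSeries.C (1 / carlitzEll Fq θ d) := by
  classical
  obtain ⟨c, hc⟩ := exists_one_sub_carlitzPoly_eq Fq hθ d
  have hmk : PowerSeries.mk (fun n => ∑ a ∈ monicsOfDegree Fq d, 1 / aeval θ a ^ (n + 1)) =
      ∑ a ∈ monicsOfDegree Fq d, PowerSeries.mk (fun n => 1 / aeval θ a ^ (n + 1)) := by
    ext n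
    simp
  have hder := derivative_one_sub_carlitzPoly Fq θ d
  have h1 : ∀ a ∈ monicsOfDegree Fq d,
      ((1 - carlitzPoly Fq θ d : K[X]) : PowerSeries K) *
        PowerSeries.mk (fun n => 1 / aeval θ a ^ (n + 1)) =
      -((C c * ∏ b ∈ (monicsOfDegree Fq d).erase a, (X - C (aeval θ b)) : K[X]) :
        PowerSeries K) := by
    intro a ha
    have ha0 : aeval θ a ≠ 0 :=
      aeval_ne_zero Fq hθ ((mem_monicsOfDegree Fq).1 ha).1.ne_zero
    rw [hc, ← Finset.prod_erase_mul _ _ ha, ← mul_assoc, Polynomial.coe_mul, mul_assoc,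
      X_sub_C_mul_geometric ha0, mul_neg, mul_one]
  rw [hmk, Finset.mul_sum, Finset.sum_congr rfl h1, Finset.sum_neg_distrib]
  -- The sum over `a` of the products omitting `a` is the derivative of the full product.
  have h2 : ∑ a ∈ monicsOfDegree Fq d,
      (C c * ∏ b ∈ (monicsOfDegree Fq d).erase a, (X - C (aeval θ b))) =
      C (-(1 / carlitzEll Fq θ d)) := by
    rw [← hder, hc, derivative_C_mul, derivative_prod_finset, Finset.mul_sum]
    simp
  have h3 := congrArg (Polynomial.coeToPowerSeries.ringHom (R := K)) h2
  rw [map_sum] at h3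
  simp only [Polynomial.coeToPowerSeries.ringHom_apply] at h3
  rw [h3]
  simp

/-- The specialization `t ↦ t ^ (q ^ d)`, `T ↦ t`. -/
noncomputable def twistedEval (θ : K) (d : ℕ) : Fq[X][X] →+* K :=
  eval₂RingHom ((aeval (θ ^ Fintype.card Fq ^ d) : Fq[X] →ₐ[Fq] K) : Fq[X] →+* K) θ

lemma twistedEval_map_C (θ : K) (d : ℕ) (p : Fq[X]) :
    twistedEval Fq θ d (p.map C) = aeval θ p := by
  rw [twistedEval, coe_eval₂RingHom, eval₂_map, aeval_def]
  congr 1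
  ext a
  simp

lemma twistedEval_andersonThakurNum (θ : K) (d i : ℕ) :
    twistedEval Fq θ d (coeffExpand Fq (andersonThakurNum Fq i)) =
      ∏ j ∈ Finset.range i, (θ ^ Fintype.card Fq ^ i - θ ^ Fintype.card Fq ^ (d + (j + 1))) := by
  rw [coeffExpand_andersonThakurNum, map_prod]
  refine Finset.prod_congr rfl fun j _ => ?_
  simp only [twistedEval, coe_eval₂RingHom, eval₂_sub, eval₂_pow, eval₂_X, eval₂_C,
    RingHom.coe_coe, aeval_X, ← pow_mul, ← pow_add]

/-- The infinite generating series thus specializes to the polynomial `1 - E_d(ℓ_d x)`. -/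
lemma twistedEval_div_carlitzD (hθ : Transcendental Fq θ) (d i : ℕ) :
    twistedEval Fq θ d (coeffExpand Fq (andersonThakurNum Fq i)) / aeval θ (carlitzD Fq i) =
      carlitzCoeff Fq θ d i * carlitzEll Fq θ d ^ Fintype.card Fq ^ i := by
  rw [twistedEval_andersonThakurNum, carlitzCoeff]
  split_ifs with h
  · obtain ⟨m, rfl⟩ := Nat.exists_eq_add_of_le h
    have hD := aeval_ne_zero Fq hθ (carlitzD_ne_zero Fq i)
    have hm := carlitzEll_ne_zero Fq hθ m
    have hadd : carlitzEll Fq θ (m + i) = carlitzEll Fq θ m *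
        ∏ j ∈ Finset.range i, (θ - θ ^ Fintype.card Fq ^ (m + j + 1)) :=
      Finset.prod_range_add _ _ _
    rw [Nat.add_sub_cancel_left, add_comm i m, hadd, mul_pow, ← Finset.prod_pow]
    have : ∀ j ∈ Finset.range i,
        (θ - θ ^ Fintype.card Fq ^ (m + j + 1)) ^ Fintype.card Fq ^ i =
        θ ^ Fintype.card Fq ^ i - θ ^ Fintype.card Fq ^ (m + i + (j + 1)) := by
      intro j _
      rw [sub_pow_card_pow Fq, ← pow_mul, ← pow_add]
      congr 3
      omega
    rw [Finset.prod_congr rfl this]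
    field_simp
  -- For `i > d` the factor with `d + (j + 1) = i` vanishes.
  · rw [Finset.prod_eq_zero (i := i - d - 1), zero_div, zero_mul]
    · exact Finset.mem_range.2 (by omega)
    · rw [show d + (i - d - 1 + 1) = i by omega, sub_self]

/-- The evaluation of the Anderson–Thakur polynomials at `T = t` gives power sums. -/
theorem twistedEval_andersonThakurPoly (hθ : Transcendental Fq θ) (d n : ℕ) :
    twistedEval Fq θ d (andersonThakurPoly Fq n) =
      aeval θ (carlitzFactorial Fq n) * carlitzEll Fq θ d ^ (n + 1) *
        ∑ a ∈ monicsOfDegree Fq d, 1 / aeval θ a ^ (n + 1) := by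
  have hne : ∀ n, aeval θ (carlitzFactorial Fq n) ≠ 0 := fun n =>
    aeval_ne_zero Fq hθ (carlitzFactorial_ne_zero Fq n)
  have hℓ := carlitzEll_ne_zero Fq hθ d
  have h1 := andersonThakur_generating Fq (twistedEval Fq θ d) fun n => by
    rw [twistedEval_map_C]
    exact hne n
  simp only [twistedEval_map_C, twistedEval_div_carlitzD Fq hθ] at h1
  -- After `x ↦ ℓ_d x`, and multiplication by `ℓ_d`, the power sums give a second inverse of `1 -
  -- E_d(ℓ_d x)`; comparing the two inverses coefficientwise gives the theorem.
  have h2 := congrArg (PowerSeries.rescale (carlitzEll Fq θ d)) (one_sub_carlitzPoly_mul_mk Fq hθ d)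
  have h3 : PowerSeries.rescale (carlitzEll Fq θ d)
      ((1 - carlitzPoly Fq θ d : K[X]) : PowerSeries K) =
      1 - linearizedSeries (Fintype.card Fq) fun i =>
        carlitzCoeff Fq θ d i * carlitzEll Fq θ d ^ Fintype.card Fq ^ i := by
    rw [Polynomial.coe_sub, Polynomial.coe_one, map_sub, map_one]
    congr 1
    ext m
    rw [PowerSeries.coeff_rescale, Polynomial.coeff_coe, carlitzPoly, finsetSum_coeff,
      linearizedSeries, PowerSeries.coeff_mk, Finset.mul_sum]
    -- The two sums have different ranges, but the terms in which they differ have `i > d`, where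
    -- the coefficient is zero.
    have e' : ∀ N N', (∀ i, N ≤ i → m = Fintype.card Fq ^ i → d < i) →
        (∀ i, N' ≤ i → m = Fintype.card Fq ^ i → d < i) →
        (∑ i ∈ Finset.range N, if m = Fintype.card Fq ^ i then
          carlitzCoeff Fq θ d i * carlitzEll Fq θ d ^ Fintype.card Fq ^ i else 0) =
        ∑ i ∈ Finset.range N', if m = Fintype.card Fq ^ i then
          carlitzCoeff Fq θ d i * carlitzEll Fq θ d ^ Fintype.card Fq ^ i else 0 := by
      intro N N' h h'
      wlog hle : N ≤ N' generalizing N N'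
      · exact (this N' N h' h (by omega)).symm
      · refine Finset.sum_subset (Finset.range_subset_range.2 hle) fun i _ hi => ?_
        split_ifs with hm
        · rw [carlitzCoeff, if_neg, zero_mul]
          exact not_le.2 (h i (by simpa using hi) hm)
        · rfl
    rw [← e' (d + 1) (m + 1) (fun i hi _ => hi) fun i hi hm => by
      have := Nat.lt_pow_self (n := i) (Fintype.one_lt_card (α := Fq))
      omega]
    refine Finset.sum_congr rfl fun i _ => ?_
    rw [coeff_C_mul_X_pow]
    split_ifs with h
    · rw [h, mul_comm]
    · rw [mul_zero]
  rw [map_mul, h3] at h2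
  have h4 : PowerSeries.C (carlitzEll Fq θ d) *
      PowerSeries.rescale (carlitzEll Fq θ d)
        (PowerSeries.mk fun n => ∑ a ∈ monicsOfDegree Fq d, 1 / aeval θ a ^ (n + 1)) =
      PowerSeries.mk fun n => carlitzEll Fq θ d ^ (n + 1) *
        ∑ a ∈ monicsOfDegree Fq d, 1 / aeval θ a ^ (n + 1) := by
    ext n
    rw [PowerSeries.coeff_C_mul, PowerSeries.coeff_rescale, PowerSeries.coeff_mk,
      PowerSeries.coeff_mk, pow_succ', mul_assoc]
  have h5 : PowerSeries.rescale (carlitzEll Fq θ d) (PowerSeries.C (1 / carlitzEll Fq θ d)) =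
      PowerSeries.C (1 / carlitzEll Fq θ d) := by
    ext n
    rw [PowerSeries.coeff_rescale, PowerSeries.coeff_C]
    split_ifs with h
    · rw [h, pow_zero, one_mul]
    · rw [mul_zero]
  have h6 := congrArg (fun z => PowerSeries.C (carlitzEll Fq θ d) * z) h2
  rw [h5, mul_left_comm, h4, ← map_mul, mul_one_div, div_self hℓ, map_one] at h6
  have h7 := left_inv_eq_right_inv ((mul_comm _ _).trans h1) h6
  have h8 := congrArg (PowerSeries.coeff n) h7
  rw [PowerSeries.coeff_mk, PowerSeries.coeff_mk, div_eq_iff (hne n)] at h8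
  rw [h8]
  ring

end PowerSums

open Filter

/-! ### Products of null families -/

section Products

variable {Fq : Type*} [Field Fq] [Fintype Fq]
variable {L : Type*} [NormedField L] [IsUltrametricDist L] [PerfectField L] [Algebra Fq L]

/-- A product is small as soon as one factor is, the others being bounded; so a large product forces
every `d i` into a finite set, which leaves finitely many `d`. -/
lemma tendsto_cofinite_prod_apply {ι : Type*} [Fintype ι] {M : ι → ℕ → ℝ} (h0 : ∀ i n, 0 ≤ M i n)
    (hM : ∀ i, Tendsto (M i) cofinite (𝓝 0)) [Nonempty ι] :
    Tendsto (fun d : ι → ℕ => ∏ i, M i (d i)) cofinite (𝓝 0) := by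
  classical
  have hb : ∀ i, ∃ K : ℝ, ∀ n, M i n ≤ K := fun i => by
    have := hM i
    rw [Nat.cofinite_eq_atTop] at this
    obtain ⟨K, hK⟩ := this.bddAbove_range
    exact ⟨K, fun n => hK ⟨n, rfl⟩⟩
  choose K hK using hb
  -- The maximum with 1 makes `B` bound the product over any subset of the indices.
  set B : ℝ := ∏ i, max 1 (K i)
  have hB1 : 0 < B := Finset.prod_pos fun i _ => lt_max_of_lt_left one_pos
  have key : ∀ (d : ι → ℕ) (i : ι), ∏ j, M j (d j) ≤ M i (d i) * B := by
    intro d i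
    rw [← Finset.mul_prod_erase _ _ (Finset.mem_univ i)]
    refine mul_le_mul_of_nonneg_left ?_ (h0 _ _)
    calc ∏ j ∈ Finset.univ.erase i, M j (d j) ≤ ∏ j ∈ Finset.univ.erase i, max 1 (K j) :=
          Finset.prod_le_prod (fun j _ => h0 _ _) fun j _ => (hK j _).trans (le_max_right _ _)
      _ ≤ max 1 (K i) * ∏ j ∈ Finset.univ.erase i, max 1 (K j) :=
          le_mul_of_one_le_left (Finset.prod_nonneg fun j _ => zero_le_one.trans (le_max_left _ _))
            (le_max_left _ _)
      _ = B := Finset.mul_prod_erase _ (fun j => max 1 (K j)) (Finset.mem_univ i)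
  rw [Metric.tendsto_nhds]
  intro ε hε
  have hfin : ∀ i, {n | ¬ dist (M i n) 0 < ε / B}.Finite := fun i =>
    Metric.tendsto_nhds.1 (hM i) (ε / B) (div_pos hε hB1)
  refine (Set.Finite.pi fun i => hfin i).subset fun d hd => ?_
  intro i _ hlt
  refine hd ?_
  change dist (∏ j, M j (d j)) 0 < ε
  rw [Real.dist_0_eq_abs] at hlt ⊢
  rw [abs_of_nonneg (h0 _ _), lt_div_iff₀ hB1] at hlt
  rw [abs_of_nonneg (Finset.prod_nonneg fun j _ => h0 _ _)]
  exact (key d i).trans_lt hlt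

/-- If the twists of finitely many power series tend to zero in Gauss norm, so do the products
of their twists. -/
lemma GaussNull.prod_twist {ι : Type*} [Fintype ι] {c : ℝ} (hc : 0 ≤ c) {f : ι → PowerSeries L}
    (h : ∀ i, GaussNull c fun n : ℕ => twist Fq n (f i)) :
    GaussNull c fun d : ι → ℕ => ∏ i, twist Fq (d i) (f i) := by
  rcases isEmpty_or_nonempty ι with hι | hι
  -- For an empty index set there is a single `d`, and the cofinite filter is trivial.
  · refine ⟨fun _ => 1, ?_, fun d => ?_⟩
    · simp [Filter.cofinite_eq_bot]
    · simpa using gaussLE_one (c := c)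
  · choose M hM hf using h
    exact ⟨_, tendsto_cofinite_prod_apply (fun i n => (hf i n).nonneg) hM,
      fun d => GaussLE.prod hc _ fun i _ => hf i _⟩

end Products

/-! ### Size and values of the twists of `Ω^s H_{s-1}` -/

section AndersonThakurSeries

variable (Fq : Type*) [Field Fq] [Fintype Fq]
variable {L : Type*} [NormedField L] [PerfectField L] [Algebra Fq L] {θ τ : L}

lemma qFrob_zpow_aeval (n : ℤ) (x : L) (p : Fq[X]) :
    (qFrob Fq L ^ n) (aeval x p) = aeval ((qFrob Fq L ^ n) x) p :=
  (aeval_algHom_apply (qFrob Fq L ^ n : L ≃ₐ[Fq] L).toAlgHom x p).symm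

omit [Fintype Fq] [PerfectField L] in
lemma coeff_toPowerSeries (θ : L) (p : Fq[X][X]) (j : ℕ) :
    PowerSeries.coeff j (toPowerSeries Fq θ p) = aeval θ (p.coeff j) := by
  simp [toPowerSeries]

lemma toPowerSeries_coeffExpand (θ : L) (p : Fq[X][X]) :
    toPowerSeries Fq θ (coeffExpand Fq p) = twist Fq 1 (toPowerSeries Fq θ p) := by
  ext j
  rw [coeff_twist, coeff_toPowerSeries, coeff_toPowerSeries, zpow_one, coeffExpand, coe_mapRingHom,
    coeff_map, RingHom.coe_coe, expand_aeval]
  have := qFrob_zpow_aeval Fq 1 θ (p.coeff j)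
  rw [zpow_one] at this
  rw [this, qFrob_apply]

omit [Fintype Fq] [PerfectField L] in
lemma isEntire_toPowerSeries (θ : L) (p : Fq[X][X]) : IsEntire (toPowerSeries Fq θ p) :=
  isEntire_coe _

/-- On coefficients in `𝔽_q[t]` the `d`-fold twist is the substitution `t ↦ t^(q^d)`; the variable
`T` is set to `t` only afterwards. -/
lemma evalAt_twist_toPowerSeries (θ : L) (d : ℕ) (p : Fq[X][X]) :
    evalAt θ (twist Fq d (toPowerSeries Fq θ p)) = twistedEval Fq θ d p := by
  have h : twist Fq d (toPowerSeries Fq θ p) =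
      ((p.map ((aeval (θ ^ Fintype.card Fq ^ d) : Fq[X] →ₐ[Fq] L) : Fq[X] →+* L) : L[X]) :
        PowerSeries L) := by
    ext j
    rw [coeff_twist, coeff_toPowerSeries, qFrob_zpow_aeval, qFrob_zpow_natCast_apply]
    simp
  rw [h, evalAt_coe, eval_map, twistedEval, coe_eval₂RingHom]

omit [PerfectField L] in
lemma norm_algebraMap_le_one (a : Fq) : ‖algebraMap Fq L a‖ ≤ 1 := by
  by_contra h
  have h1 : ‖algebraMap Fq L a‖ ^ Fintype.card Fq = ‖algebraMap Fq L a‖ := by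
    rw [← norm_pow, ← map_pow, FiniteField.pow_card]
  have h2 := pow_lt_pow_right₀ (not_le.1 h) (Fintype.one_lt_card (α := Fq))
  rw [h1, pow_one] at h2
  exact lt_irrefl _ h2

variable [IsUltrametricDist L]

omit [PerfectField L] in
lemma norm_aeval_le (hθ : 1 < ‖θ‖) {p : Fq[X]} {n : ℕ} (hp : p.natDegree ≤ n) :
    ‖aeval θ p‖ ≤ ‖θ‖ ^ n := by
  rw [aeval_eq_sum_range]
  refine IsUltrametricDist.norm_sum_le_of_forall_le_of_nonneg (by positivity) fun i hi => ?_
  rw [Algebra.smul_def, norm_mul, norm_pow]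
  refine (mul_le_of_le_one_left (by positivity) (norm_algebraMap_le_one Fq _)).trans ?_
  exact pow_le_pow_right₀ hθ.le ((Nat.lt_succ_iff.1 (Finset.mem_range.1 hi)).trans hp)

/-- `B` accounts for the powers of `T`, which the twist does not change, and so is independent of
`d`. -/
lemma exists_gaussLE_twist_toPowerSeries (hθ : 1 < ‖θ‖) {p : Fq[X][X]} {δ : ℕ}
    (hp : ∀ j, (p.coeff j).natDegree ≤ δ) {c : ℝ} (hc : 0 ≤ c) :
    ∃ B : ℝ, ∀ d : ℕ, GaussLE c ((‖θ‖ ^ δ) ^ Fintype.card Fq ^ d * B)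
      (twist Fq d (toPowerSeries Fq θ p)) := by
  refine ⟨max 1 c ^ p.natDegree, fun d n => ?_⟩
  rw [coeff_twist_natCast, coeff_toPowerSeries, norm_pow]
  rcases le_or_gt n p.natDegree with h | h
  · refine mul_le_mul ?_ ?_ (by positivity) (by positivity)
    · exact pow_le_pow_left₀ (norm_nonneg _) (norm_aeval_le Fq hθ (hp n)) _
    · exact (pow_le_pow_left₀ hc (le_max_right _ _) n).trans
        (pow_le_pow_right₀ (le_max_left _ _) h)
  · rw [coeff_eq_zero_of_natDegree_lt h, map_zero, norm_zero,
      zero_pow (pow_ne_zero _ Fintype.card_ne_zero), zero_mul]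
    positivity

omit [Field Fq] [PerfectField L] [Algebra Fq L] [IsUltrametricDist L] in
lemma norm_tTilde_pow (hτ : θ = -τ ^ (Fintype.card Fq - 1)) :
    ‖τ‖ ^ (Fintype.card Fq - 1) = ‖θ‖ := by
  rw [hτ, norm_neg, norm_pow]

variable [CompleteSpace L]

/-- The twists of `Ω ^ s H_{s - 1}` tend to zero in every Gauss norm. -/
lemma gaussNull_twist_omega_pow_mul (hθ : 1 < ‖θ‖) (hτ : θ = -τ ^ (Fintype.card Fq - 1))
    {s : ℕ} (hs : 0 < s) {c : ℝ} (hc : 0 ≤ c) :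
    GaussNull c fun d : ℕ => twist Fq d (carlitzOmega Fq θ τ ^ s *
      toPowerSeries Fq θ (andersonThakurPoly Fq (s - 1))) := by
  have hq : 0 < Fintype.card Fq - 1 := Nat.sub_pos_of_lt Fintype.one_lt_card
  set δ := (s - 1) / (Fintype.card Fq - 1) with hδ
  obtain ⟨B, hB⟩ := exists_gaussLE_twist_toPowerSeries Fq hθ
    ((coeffDegreeLE_iff hq).1 (coeffDegreeLE_andersonThakurTwist Fq (s - 1))) hc
  have hτ0 : 0 < ‖τ‖ := norm_pos_iff.2 (tTilde_ne_zero Fq hθ hτ)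
  set ρ : ℝ := (‖τ‖ ^ s)⁻¹ * ‖θ‖ ^ δ with hρ
  have hρ0 : 0 ≤ ρ := by positivity
  -- Raised to the power `q - 1` this reads `(q - 1) δ < s`, because `|τ|^(q-1) = |t|`; it holds
  -- since `(q - 1) δ ≤ s - 1`.
  have hρ1 : ρ < 1 := by
    rw [hρ, inv_mul_lt_one₀ (by positivity)]
    refine lt_of_pow_lt_pow_left₀ (Fintype.card Fq - 1) (by positivity) ?_
    rw [← pow_mul, ← pow_mul, mul_comm s, pow_mul ‖τ‖, norm_tTilde_pow Fq hτ]
    refine pow_lt_pow_right₀ hθ ?_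
    have := Nat.div_mul_le_self (s - 1) (Fintype.card Fq - 1)
    rw [← hδ] at this
    omega
  have hent : ∀ d : ℕ, IsEntire (twist Fq d (carlitzOmega Fq θ τ ^ s *
      toPowerSeries Fq θ (andersonThakurPoly Fq (s - 1)))) := by
    intro d
    refine IsEntire.twist ?_ d
    exact mem_entireSubring.1 (mul_mem (pow_mem (mem_entireSubring.2
      (isEntire_carlitzOmega Fq hθ hτ)) s) (mem_entireSubring.2 (isEntire_toPowerSeries Fq θ _)))
  choose N hN using fun d : ℕ => exists_gaussLE (hent d c)
  obtain ⟨d₀, hd₀⟩ := pow_unbounded_of_one_lt c hθ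
  -- The bound for the twisted `Ω` is valid on radius `|t|^(q^(d+1))`, which exceeds `c` from `d₀`
  -- on. For the finitely many earlier `d` any bound will do.
  refine ⟨fun d => if d₀ ≤ d then ρ ^ Fintype.card Fq ^ (d + 1) * B else N d, ?_, fun d => ?_⟩
  · have h1 : Tendsto (fun d : ℕ => Fintype.card Fq ^ (d + 1)) atTop atTop :=
      (tendsto_pow_atTop_atTop_of_one_lt Fintype.one_lt_card).comp (tendsto_add_atTop_nat 1)
    have h2 := ((tendsto_pow_atTop_nhds_zero_of_lt_one hρ0 hρ1).comp h1).mul_const B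
    rw [zero_mul] at h2
    rw [Nat.cofinite_eq_atTop]
    refine h2.congr' ?_
    filter_upwards [eventually_ge_atTop d₀] with d hd
    simp only [hd, if_true, Function.comp_apply]
  · dsimp only
    split_ifs with hd
    · have hΩ : GaussLE c ((‖τ‖ ^ Fintype.card Fq)⁻¹ ^ Fintype.card Fq ^ d)
          (twist Fq d (carlitzOmega Fq θ τ)) := by
        refine ((gaussLE_carlitzOmega Fq hθ).twist (by positivity) d).anti hc ?_
        rw [← pow_mul, ← pow_succ']
        refine hd₀.le.trans (pow_le_pow_right₀ hθ.le ?_)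
        exact hd.trans ((Nat.lt_pow_self Fintype.one_lt_card).le.trans
          (Nat.pow_le_pow_right Fintype.card_pos (Nat.le_succ d)))
      have h2 := (hΩ.pow hc s).mul hc (hB (d + 1))
      -- `H_{s-1}` is itself a twist of the polynomial whose degree was bounded, hence the exponent
      -- `d + 1`.
      rw [map_mul, map_pow, andersonThakurPoly, toPowerSeries_coeffExpand, ← twist_add,
        ← Nat.cast_succ]
      refine h2.mono (le_of_eq ?_)
      rw [hρ, mul_pow, ← mul_assoc]
      congr 2
      rw [inv_pow, inv_pow, inv_pow, ← pow_mul, ← pow_mul, ← pow_mul, pow_succ]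
      congr 2
      ring
    · exact hN d

/-- The factor `ℓ_d^s` from `H_{s-1}` turns `Ω^{(d)}(t)^s` into `Ω(t)^s`, so `d` enters only through
the power sum. -/
lemma evalAt_twist_omega_pow_mul (hθ : 1 < ‖θ‖) (hθ' : Transcendental Fq θ)
    (hτ : θ = -τ ^ (Fintype.card Fq - 1)) {s : ℕ} (hs : 0 < s) (d : ℕ) :
    evalAt θ (twist Fq d (carlitzOmega Fq θ τ ^ s *
      toPowerSeries Fq θ (andersonThakurPoly Fq (s - 1)))) =
    aeval θ (carlitzGamma Fq s) * evalAt θ (carlitzOmega Fq θ τ) ^ s * powerSum Fq θ d s := by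
  have hΩ : PowerSeries.IsRestricted ‖θ‖ (twist Fq d (carlitzOmega Fq θ τ)) :=
    (isEntire_carlitzOmega Fq hθ hτ).twist d ‖θ‖
  have hΩs : PowerSeries.IsRestricted ‖θ‖ (twist Fq d (carlitzOmega Fq θ τ) ^ s) :=
    pow_mem (mem_restrictedSubring.2 hΩ) s
  rw [map_mul, map_pow, evalAt_mul hΩs ((isEntire_toPowerSeries Fq θ _).twist d ‖θ‖),
    evalAt_pow hΩ, evalAt_twist_toPowerSeries, twistedEval_andersonThakurPoly Fq hθ',
    powerSum_eq_sum, ← evalAt_twist_carlitzOmega Fq hθ hτ d, mul_pow, Nat.sub_add_cancel hs,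
    carlitzGamma]
  ring

end AndersonThakurSeries

/-! ### Strictly decreasing sequences on consecutive indices -/

section Blocks

variable {r : ℕ}

/-- The last element of a block. -/
def blockLast {k : Fin (r + 1)} {j : Fin r} (hk : k ≤ j.castSucc) : Block k j.succ :=
  ⟨j, hk, Fin.castSucc_lt_succ⟩

/-- The inclusion of a block in the next one. -/
def blockIncl {k : Fin (r + 1)} {j : Fin r} (m : Block k j.castSucc) : Block k j.succ :=
  ⟨m.1, m.2.1, m.2.2.trans Fin.castSucc_lt_succ⟩

lemma block_lt_or_eq {k : Fin (r + 1)} {j : Fin r} (m : Block k j.succ) : m.1 < j ∨ m.1 = j := by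
  have h := m.2.2
  rw [Fin.lt_def, Fin.val_castSucc, Fin.val_succ] at h
  rw [Fin.lt_def, Fin.ext_iff]
  omega

lemma block_castSucc_lt {k : Fin (r + 1)} {j : Fin r} (m : Block k j.castSucc) : m.1 < j :=
  Fin.castSucc_lt_castSucc_iff.1 m.2.2

lemma bijective_optionBlock {k : Fin (r + 1)} {j : Fin r} (hk : k ≤ j.castSucc) :
    Function.Bijective fun o : Option (Block k j.castSucc) => o.elim (blockLast hk) blockIncl := by
  constructor
  · rintro (_ | a) (_ | b) h
    · rfl
    · exact absurd (congrArg Subtype.val h).symm (block_castSucc_lt b).ne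
    · exact absurd (congrArg Subtype.val h) (block_castSucc_lt a).ne
    · have h' : blockIncl a = blockIncl b := h
      exact congrArg some (Subtype.ext (congrArg (fun m : Block k j.succ => m.1) h'))
  · intro m
    rcases block_lt_or_eq m with h | h
    · exact ⟨some ⟨m.1, m.2.1, Fin.castSucc_lt_castSucc_iff.2 h⟩, rfl⟩
    · exact ⟨none, Subtype.ext h.symm⟩

lemma prod_block_succ {M : Type*} [CommMonoid M] {k : Fin (r + 1)} {j : Fin r}
    (hk : k ≤ j.castSucc) (g : Block k j.succ → M) :
    ∏ m, g m = g (blockLast hk) * ∏ m : Block k j.castSucc, g (blockIncl m) := by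
  rw [← (Equiv.ofBijective _ (bijective_optionBlock hk)).prod_comp, Fintype.prod_option]
  rfl

/-- Extension of a sequence on a block to the next one by a final zero, after raising it by one. -/
def extendZero {k : Fin (r + 1)} {j : Fin r} (e : Block k j.castSucc → ℕ) (m : Block k j.succ) : ℕ :=
  if h : m.1 < j then e ⟨m.1, m.2.1, Fin.castSucc_lt_castSucc_iff.2 h⟩ + 1 else 0

lemma extendZero_blockIncl {k : Fin (r + 1)} {j : Fin r} (e : Block k j.castSucc → ℕ)
    (m : Block k j.castSucc) : extendZero e (blockIncl m) = e m + 1 :=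
  dif_pos (block_castSucc_lt m)

lemma extendZero_blockLast {k : Fin (r + 1)} {j : Fin r} (hk : k ≤ j.castSucc)
    (e : Block k j.castSucc → ℕ) : extendZero e (blockLast hk) = 0 :=
  dif_neg (lt_irrefl j)

lemma strictAnti_extendZero {k : Fin (r + 1)} {j : Fin r} {e : Block k j.castSucc → ℕ}
    (he : StrictAnti e) : StrictAnti (extendZero e) := by
  intro m m' h
  have hm : m.1 < j := by
    rcases block_lt_or_eq m' with h' | h'
    · exact lt_trans h h'
    · exact lt_of_lt_of_eq h h'
  rw [extendZero, extendZero, dif_pos hm]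
  split_ifs with h'
  · exact Nat.succ_lt_succ (he h)
  · exact Nat.succ_pos _

/-- A strictly decreasing sequence either has only positive terms, or ends with a single zero. -/
def splitStrictAnti {k : Fin (r + 1)} {j : Fin r} :
    {d : Block k j.succ → ℕ // StrictAnti d} ⊕ {d : Block k j.castSucc → ℕ // StrictAnti d} →
      {d : Block k j.succ → ℕ // StrictAnti d} :=
  Sum.elim (fun d => ⟨fun m => d.1 m + 1, fun _ _ h => Nat.succ_lt_succ (d.2 h)⟩)
    fun e => ⟨extendZero e.1, strictAnti_extendZero e.2⟩

/-- The last entry is the smallest. If it is positive, all entries can be lowered by one; if it is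
zero, it is removed and the others, necessarily positive, are lowered. -/
lemma bijective_splitStrictAnti {k : Fin (r + 1)} {j : Fin r} (hk : k ≤ j.castSucc) :
    Function.Bijective (splitStrictAnti (k := k) (j := j)) := by
  constructor
  · rintro (a | a) (b | b) h <;> have h' := fun m => congrFun (congrArg Subtype.val h) m
    · exact congrArg Sum.inl (Subtype.ext (funext fun m => Nat.succ_injective (h' m)))
    · have := h' (blockLast hk)
      simp only [splitStrictAnti, Sum.elim_inl, Sum.elim_inr, extendZero_blockLast] at this
      omega
    · have := h' (blockLast hk)
      simp only [splitStrictAnti, Sum.elim_inl, Sum.elim_inr, extendZero_blockLast] at this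
      omega
    · refine congrArg Sum.inr (Subtype.ext (funext fun m => ?_))
      have := h' (blockIncl m)
      simp only [splitStrictAnti, Sum.elim_inr, extendZero_blockIncl] at this
      omega
  · intro d
    have hlast : ∀ m : Block k j.succ, m.1 < j → d.1 (blockLast hk) < d.1 m := fun m h => d.2 h
    by_cases h0 : d.1 (blockLast hk) = 0
    · have hpos : ∀ m : Block k j.castSucc, 0 < d.1 (blockIncl m) := fun m =>
        (Nat.zero_le _).trans_lt (hlast (blockIncl m) (block_castSucc_lt m))
      refine ⟨Sum.inr ⟨fun m => d.1 (blockIncl m) - 1, fun a b hab => ?_⟩, Subtype.ext ?_⟩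
      · have h1 : d.1 (blockIncl b) < d.1 (blockIncl a) := d.2 hab
        have h2 := hpos b
        change d.1 (blockIncl b) - 1 < d.1 (blockIncl a) - 1
        omega
      · funext m
        rcases (bijective_optionBlock hk).2 m with ⟨_ | m, rfl⟩
        · exact (extendZero_blockLast hk _).trans h0.symm
        · refine (extendZero_blockIncl _ m).trans ?_
          have := hpos m
          change d.1 (blockIncl m) - 1 + 1 = d.1 (blockIncl m)
          omega
    · have hpos : ∀ m, 0 < d.1 m := by
        intro m
        rcases block_lt_or_eq m with h | h
        · exact (Nat.zero_le _).trans_lt (hlast m h)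
        · have : m = blockLast hk := Subtype.ext h
          rw [this]
          omega
      refine ⟨Sum.inl ⟨fun m => d.1 m - 1, fun a b hab => ?_⟩, Subtype.ext (funext fun m => ?_)⟩
      · have h1 := d.2 hab
        have h2 := hpos b
        change d.1 b - 1 < d.1 a - 1
        omega
      · have := hpos m
        change d.1 m - 1 + 1 = d.1 m
        omega

end Blocks

lemma hasSum_of_sum_bijective {α β γ M : Type*} [AddCommMonoid M] [TopologicalSpace M]
    [ContinuousAdd M] {φ : α ⊕ β → γ} (hφ : Function.Bijective φ) {f : γ → M} {a b : M}
    (h₁ : HasSum (fun x => f (φ (Sum.inl x))) a) (h₂ : HasSum (fun x => f (φ (Sum.inr x))) b) :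
    HasSum f (a + b) :=
  (Equiv.ofBijective φ hφ).hasSum_iff.1 (HasSum.sum h₁ h₂)

/-! ### The recursion for `L` -/

section MatrixL

variable {Fq : Type*} [Field Fq] [Fintype Fq]
variable {L : Type*} [NormedField L] [PerfectField L] [Algebra Fq L]
variable {r : ℕ} {s : Fin r → ℕ} {Ω : PowerSeries L} {h : Fin r → PowerSeries L}

lemma twist_one_add (n : ℕ) (f : PowerSeries L) :
    twist Fq (n + 1 : ℕ) f = twist Fq 1 (twist Fq n f) := by
  rw [← twist_add, Nat.cast_succ, add_comm]

lemma termL_inl {k : Fin (r + 1)} {j : Fin r} (d : {d : Block k j.succ → ℕ // StrictAnti d}) :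
    termL Fq s Ω h k j.succ (splitStrictAnti (Sum.inl d)).1 =
      twist Fq 1 (termL Fq s Ω h k j.succ d.1) := by
  simp only [termL, splitStrictAnti, Sum.elim_inl, map_prod, twist_one_add]

lemma termL_inr {k : Fin (r + 1)} {j : Fin r} (hk : k ≤ j.castSucc)
    (e : {d : Block k j.castSucc → ℕ // StrictAnti d}) :
    termL Fq s Ω h k j.succ (splitStrictAnti (Sum.inr e)).1 =
      (Ω ^ s j * h j) * twist Fq 1 (termL Fq s Ω h k j.castSucc e.1) := by
  rw [termL, termL, prod_block_succ hk]
  simp only [splitStrictAnti, Sum.elim_inr, extendZero_blockLast, extendZero_blockIncl,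
    Nat.cast_zero, twist_zero, map_prod (twist Fq 1), twist_one_add]
  rfl

lemma isEmpty_block {k i : Fin (r + 1)} (hik : i ≤ k) : IsEmpty (Block k i) :=
  ⟨fun m => not_lt.2 hik (m.2.1.trans_lt m.2.2)⟩

lemma matrixL_self (i : Fin (r + 1)) : matrixL Fq s Ω h i i = 1 := by
  have := isEmpty_block (le_refl i)
  have : Unique {d : Block i i → ℕ // StrictAnti d} :=
    { default := ⟨isEmptyElim, fun a => isEmptyElim a⟩
      uniq := fun d => Subtype.ext (funext fun a => isEmptyElim a) }
  rw [matrixL, Matrix.of_apply, if_pos le_rfl, tsum_fintype, Fintype.sum_unique, termL,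
    Finset.univ_eq_empty, Finset.prod_empty]

lemma matrixL_of_lt {i k : Fin (r + 1)} (hik : i < k) : matrixL Fq s Ω h i k = 0 := by
  rw [matrixL, Matrix.of_apply, if_neg (not_le.2 hik)]

/-- The recursion for the entries of `L`. -/
lemma matrixL_succ (hs : ∀ k i : Fin (r + 1), Summable fun d : {d : Block k i → ℕ // StrictAnti d} =>
      termL Fq s Ω h k i d.1) (j : Fin r) (k : Fin (r + 1)) :
    matrixL Fq s Ω h j.succ k = twist Fq 1 (matrixL Fq s Ω h j.succ k) +
      Ω ^ s j * h j * twist Fq 1 (matrixL Fq s Ω h j.castSucc k) := by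
  rcases le_or_gt k j.castSucc with hk | hk
  · have hk' : k ≤ j.succ := hk.trans Fin.castSucc_lt_succ.le
    have e1 : matrixL Fq s Ω h j.succ k = ∑' d : {d : Block k j.succ → ℕ // StrictAnti d},
        termL Fq s Ω h k j.succ d.1 := by
      rw [matrixL, Matrix.of_apply, if_pos hk']
    have e2 : matrixL Fq s Ω h j.castSucc k =
        ∑' d : {d : Block k j.castSucc → ℕ // StrictAnti d}, termL Fq s Ω h k j.castSucc d.1 := by
      rw [matrixL, Matrix.of_apply, if_pos hk]
    have h1 := ((hs k j.succ).hasSum.map (twist Fq 1) continuous_twist_one)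
    have h2 := (((hs k j.castSucc).hasSum.map (twist Fq 1) continuous_twist_one).mul_left
      (Ω ^ s j * h j))
    rw [← e1] at h1
    rw [← e2] at h2
    have h3 := hasSum_of_sum_bijective (bijective_splitStrictAnti hk)
      (f := fun d : {d : Block k j.succ → ℕ // StrictAnti d} => termL Fq s Ω h k j.succ d.1)
      (h1.congr_fun fun d => termL_inl d) (h2.congr_fun fun e => termL_inr hk e)
    exact e1.trans h3.tsum_eq
  -- Here the entry in row `j.castSucc` is 0 and the one in row `j.succ` is 0 or 1, which the twist
  -- fixes.
  · rw [matrixL_of_lt hk, map_zero, mul_zero, add_zero]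
    rcases (Fin.castSucc_lt_iff_succ_le.1 hk).lt_or_eq with hk' | rfl
    · rw [matrixL_of_lt hk', map_zero]
    · rw [matrixL_self, map_one]

lemma twist_one_matrixL_zero (k : Fin (r + 1)) :
    twist Fq 1 (matrixL Fq s Ω h 0 k) = matrixL Fq s Ω h 0 k := by
  rcases (Fin.zero_le k).lt_or_eq with hk | rfl
  · rw [matrixL_of_lt hk, map_zero]
  · rw [matrixL_self, map_one]

end MatrixL

/-! ### Multiplication by the bidiagonal matrix `Q` -/

section MatrixQ

variable {R : Type*} [CommRing R] {r : ℕ}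

lemma matrixQ_mul_zero (h : Fin r → R) (N : Matrix (Fin (r + 1)) (Fin (r + 1)) R)
    (k : Fin (r + 1)) : (matrixQ h * N) 0 k = N 0 k := by
  rw [Matrix.mul_apply, Finset.sum_eq_single 0]
  · simp [matrixQ]
  · intro j _ hj
    simp [matrixQ, hj.symm]
  · simp

lemma matrixQ_mul_succ (h : Fin r → R) (N : Matrix (Fin (r + 1)) (Fin (r + 1)) R)
    (j : Fin r) (k : Fin (r + 1)) :
    (matrixQ h * N) j.succ k = N j.succ k + h j * N j.castSucc k := by
  have hne : j.succ ≠ j.castSucc := Fin.castSucc_lt_succ.ne'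
  rw [Matrix.mul_apply, ← Finset.sum_subset (Finset.subset_univ {j.succ, j.castSucc}),
    Finset.sum_pair hne]
  · simp [matrixQ, hne]
  · intro m _ hm
    simp only [Finset.mem_insert, Finset.mem_singleton, not_or] at hm
    have h2 : ¬ (m : ℕ) + 1 = j.succ := by
      intro h
      refine hm.2 (Fin.ext ?_)
      rw [Fin.val_succ] at h
      rw [Fin.val_castSucc]
      omega
    rw [matrixQ, Matrix.of_apply, if_neg (Ne.symm hm.1), dif_neg h2, zero_mul]

lemma tailSum_castSucc (s : Fin r → ℕ) (j : Fin r) :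
    tailSum s j.castSucc = s j + tailSum s j.succ := by
  rw [tailSum, tailSum, ← Finset.sum_insert (s := {m : Fin r | j.succ ≤ m.castSucc})
    (a := j) (f := s) (by simp)]
  refine Finset.sum_congr ?_ fun _ _ => rfl
  ext m
  simp only [Finset.mem_filter, Finset.mem_univ, true_and, Finset.mem_insert, Fin.ext_iff,
    Fin.le_def, Fin.val_castSucc, Fin.val_succ]
  omega

end MatrixQ

open Filter

/-! ### Twist-invariant elements of the Tate algebra -/

section Constants

variable (Fq : Type*) [Field Fq] [Fintype Fq]
variable {L : Type*} [NormedField L] [Algebra Fq L]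

omit [Fintype Fq] in
lemma coeff_constPoly (p : Fq[X]) (n : ℕ) :
    PowerSeries.coeff n (constPoly Fq p : PowerSeries L) = algebraMap Fq L (p.coeff n) := by
  simp [constPoly]

omit [Fintype Fq] in
lemma constPoly_injective : Function.Injective (constPoly Fq : Fq[X] →+* PowerSeries L) := by
  intro p q h
  ext n
  refine (algebraMap Fq L).injective ?_
  rw [← coeff_constPoly, ← coeff_constPoly, h]

lemma one_le_norm_algebraMap {a : Fq} (ha : algebraMap Fq L a ≠ 0) : 1 ≤ ‖algebraMap Fq L a‖ := by
  have h := norm_algebraMap_le_one Fq (L := L) a⁻¹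
  rw [map_inv₀, norm_inv] at h
  exact (inv_le_one₀ (norm_pos_iff.2 ha)).1 h

variable [PerfectField L]

/-- The elements of the Tate algebra fixed by the twist are the polynomials over `𝔽_q`. -/
lemma exists_constPoly_eq {f : PowerSeries L} (hr : PowerSeries.IsRestricted 1 f)
    (hf : twist Fq (-1) f = f) : ∃ p : Fq[X], constPoly Fq p = f := by
  have h1 : ∀ n, ∃ a : Fq, algebraMap Fq L a = PowerSeries.coeff n f := by
    intro n
    refine exists_algebraMap_of_pow_card_eq Fq ?_
    have h := qFrob_neg_one_pow Fq (PowerSeries.coeff n f)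
    rwa [← coeff_twist, hf] at h
  choose a ha using h1
  rw [PowerSeries.isRestricted_iff'] at hr
  -- Nonzero constants have absolute value at least 1, so coefficients that are constants and tend
  -- to zero eventually vanish.
  obtain ⟨N, hN⟩ := eventually_atTop.1 (hr.eventually (gt_mem_nhds one_pos))
  refine ⟨∑ n ∈ Finset.range N, monomial n (a n), ?_⟩
  ext m
  rw [coeff_constPoly, finsetSum_coeff]
  simp only [coeff_monomial, Finset.sum_ite_eq', Finset.mem_range]
  split_ifs with h
  · exact ha m
  · rw [map_zero]
    have h2 := hN m (not_lt.1 h)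
    rw [one_pow, mul_one, ← ha m] at h2
    rw [← ha m]
    by_contra h3
    exact not_le.2 h2 (one_le_norm_algebraMap Fq (Ne.symm h3))

end Constants

/-! ### From a rigid analytic trivialization to a period matrix -/

section Uniformization

variable {Fq : Type*} [Field Fq] [Fintype Fq]
variable {L : Type*} [NormedField L] [PerfectField L] [Algebra Fq L]
variable {ι : Type*} [Fintype ι] [DecidableEq ι] {Φ Ψ : Matrix ι ι (PowerSeries L)}

lemma inv_map_twist_mul (hu : IsUnit Ψ.det) (h : Ψ.map (twist Fq (-1)) = Φ * Ψ) :
    Ψ⁻¹.map (twist Fq (-1)) * Φ = Ψ⁻¹ := by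
  refine (Matrix.inv_eq_left_inv ?_).symm
  rw [mul_assoc, ← h, ← Matrix.map_mul, Matrix.nonsing_inv_mul _ hu]
  simp

/-- The rows of the inverse of a rigid analytic trivialization form a basis of the module of
`σ`-invariants. -/
lemma IsRigidAnalyticTrivialization.isPeriodMatrix [IsUltrametricDist L]
    (hΨ : IsRigidAnalyticTrivialization Fq Φ Ψ) {θ : L}
    (hθ : ∀ i j, PowerSeries.IsRestricted ‖θ‖ (Ψ⁻¹ i j)) :
    IsPeriodMatrix Fq θ Φ (Ψ⁻¹.map (evalAt θ)) := by
  have hu := hΨ.isUnit_det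
  have hinv := inv_map_twist_mul hu hΨ.uniformizability
  have hcomb : ∀ c : ι → PowerSeries L, ∑ i, c i • Ψ⁻¹ i = Matrix.vecMul c Ψ⁻¹ := by
    intro c
    rw [Matrix.vecMul_eq_sum]
  refine ⟨Ψ⁻¹, fun i => ⟨hΨ.restricted_inv i, ?_⟩, fun v hv => ?_, hθ, rfl⟩
  · have h1 := congrFun hinv i
    rwa [Matrix.mul_apply_eq_vecMul] at h1
  · obtain ⟨hvr, hvσ⟩ := hv
    -- `v Ψ` is fixed by the twist: `v^{(-1)} Ψ^{(-1)} = v^{(-1)} Φ Ψ = v Ψ`. Its entries are the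
    -- coordinates of `v` in the rows of `Ψ⁻¹`.
    have hw : ∀ j, ∃ p : Fq[X], constPoly Fq p = Matrix.vecMul v Ψ j := by
      intro j
      refine exists_constPoly_eq Fq ?_ ?_
      · have : Matrix.vecMul v Ψ j = ∑ i, v i * Ψ i j := rfl
        rw [this]
        exact Subring.sum_mem (PowerSeries.IsRestricted.subring 1)
          fun i _ => mul_mem (mem_restrictedSubring.2 (hvr i))
            (mem_restrictedSubring.2 (hΨ.restricted i j))
      · have h2 : Matrix.vecMul (fun i => twist Fq (-1) (v i)) (Ψ.map (twist Fq (-1))) =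
            Matrix.vecMul v Ψ := by
          rw [hΨ.uniformizability, ← Matrix.vecMul_vecMul, hvσ]
        have h3 := congrFun h2 j
        rw [← h3]
        have h4 : Matrix.vecMul v Ψ j = ∑ i, v i * Ψ i j := rfl
        rw [← h3] at h4
        rw [h4, map_sum, ← h4]
        simp only [map_mul]
        rfl
    choose p hp using hw
    refine ⟨p, ?_, fun c hc => ?_⟩
    · change v = ∑ i, (constPoly Fq (p i) : PowerSeries L) • Ψ⁻¹ i
      rw [hcomb fun i => constPoly Fq (p i), funext hp, Matrix.vecMul_vecMul,
        Matrix.mul_nonsing_inv _ hu, Matrix.vecMul_one]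
    · have hc' : v = ∑ i, (constPoly Fq (c i) : PowerSeries L) • Ψ⁻¹ i := hc
      rw [hcomb fun i => constPoly Fq (c i)] at hc'
      have h5 : Matrix.vecMul v Ψ = fun i => constPoly Fq (c i) := by
        rw [hc', Matrix.vecMul_vecMul, Matrix.nonsing_inv_mul _ hu, Matrix.vecMul_one]
      funext i
      refine constPoly_injective Fq (L := L) ?_
      rw [hp i, h5]

end Uniformization

/-! ### The trivialization `Ψ` and its value at `T = t` -/

section Trivialization

variable {Fq : Type*} [Field Fq] [Fintype Fq]
variable {L : Type*} [NormedField L] [IsUltrametricDist L] [CompleteSpace L] [PerfectField L]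
  [Algebra Fq L] {θ τ : L} {r : ℕ} {s : Fin r → ℕ}

local notation "Ωs" => carlitzOmega Fq θ τ
local notation "hs" => subdiagonal Fq θ (andersonThakurPoly Fq) s

lemma gaussNull_termL (hθ : 1 < ‖θ‖) (hτ : θ = -τ ^ (Fintype.card Fq - 1)) (hs0 : ∀ m, 0 < s m)
    {c : ℝ} (hc : 0 ≤ c) (k i : Fin (r + 1)) :
    GaussNull c fun d : {d : Block k i → ℕ // StrictAnti d} => termL Fq s Ωs hs k i d.1 :=
  (GaussNull.prod_twist hc fun m : Block k i =>
    gaussNull_twist_omega_pow_mul Fq hθ hτ (hs0 m.1) hc).comp Subtype.val_injective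

lemma isEntire_twist_omega_pow_mul (hθ : 1 < ‖θ‖) (hτ : θ = -τ ^ (Fintype.card Fq - 1))
    (m : Fin r) (d : ℕ) : IsEntire (twist Fq d (Ωs ^ s m * hs m)) :=
  IsEntire.twist (mem_entireSubring.1 (mul_mem (pow_mem (mem_entireSubring.2
    (isEntire_carlitzOmega Fq hθ hτ)) _) (mem_entireSubring.2 (isEntire_toPowerSeries Fq θ _)))) d

lemma isEntire_termL (hθ : 1 < ‖θ‖) (hτ : θ = -τ ^ (Fintype.card Fq - 1)) (k i : Fin (r + 1))
    (d : Block k i → ℕ) : IsEntire (termL Fq s Ωs hs k i d) :=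
  mem_entireSubring.1 (prod_mem fun m _ => mem_entireSubring.2
    (isEntire_twist_omega_pow_mul hθ hτ m.1 (d m)))

lemma summable_termL (hθ : 1 < ‖θ‖) (hτ : θ = -τ ^ (Fintype.card Fq - 1)) (hs0 : ∀ m, 0 < s m)
    (k i : Fin (r + 1)) :
    Summable fun d : {d : Block k i → ℕ // StrictAnti d} => termL Fq s Ωs hs k i d.1 :=
  (gaussNull_termL hθ hτ hs0 zero_le_one k i).summable one_pos

lemma isEntire_matrixL (hθ : 1 < ‖θ‖) (hτ : θ = -τ ^ (Fintype.card Fq - 1)) (hs0 : ∀ m, 0 < s m)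
    (i k : Fin (r + 1)) : IsEntire (matrixL Fq s Ωs hs i k) := by
  rw [matrixL, Matrix.of_apply]
  split_ifs
  · exact isEntire_of_nonneg fun c hc => (gaussNull_termL hθ hτ hs0 hc k i).isRestricted_tsum hc
      (summable_termL hθ hτ hs0 k i) fun d => isEntire_termL hθ hτ k i d.1 c
  · exact fun c => PowerSeries.isRestricted_zero c

omit [IsUltrametricDist L] [CompleteSpace L] in
lemma matrixPsi_apply (i k : Fin (r + 1)) :
    matrixPsi Fq θ τ (andersonThakurPoly Fq) s i k =
      Ωs ^ tailSum s i * matrixL Fq s Ωs hs i k := by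
  rw [matrixPsi, diagPow, Matrix.diagonal_mul]

lemma isEntire_matrixPsi (hθ : 1 < ‖θ‖) (hτ : θ = -τ ^ (Fintype.card Fq - 1))
    (hs0 : ∀ m, 0 < s m) (i k : Fin (r + 1)) :
    IsEntire (matrixPsi Fq θ τ (andersonThakurPoly Fq) s i k) := by
  rw [matrixPsi_apply]
  exact mem_entireSubring.1 (mul_mem (pow_mem (mem_entireSubring.2
    (isEntire_carlitzOmega Fq hθ hτ)) _) (mem_entireSubring.2 (isEntire_matrixL hθ hτ hs0 i k)))

omit [IsUltrametricDist L] [CompleteSpace L] in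
lemma det_matrixPsi : (matrixPsi Fq θ τ (andersonThakurPoly Fq) s).det =
    Ωs ^ ∑ i, tailSum s i := by
  rw [matrixPsi, Matrix.det_mul, diagPow, Matrix.det_diagonal, Finset.prod_pow_eq_pow_sum,
    Matrix.det_of_isLowerTriangular _ fun i k hik => matrixL_of_lt hik]
  simp [matrixL_self]

lemma matrixPhi_mul_matrixPsi (hθ : 1 < ‖θ‖) (hτ : θ = -τ ^ (Fintype.card Fq - 1)) :
    matrixPhi Fq θ (andersonThakurPoly Fq) s * matrixPsi Fq θ τ (andersonThakurPoly Fq) s =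
      matrixQ (fun m => twist Fq (-1) (hs m)) *
        Matrix.of fun i k => twist Fq (-1) Ωs ^ tailSum s i * matrixL Fq s Ωs hs i k := by
  have h1 : (matrixQ hs).map (twist Fq (-1)) = matrixQ fun m => twist Fq (-1) (hs m) := by
    ext1 i j
    simp only [matrixQ, Matrix.map_apply, Matrix.of_apply]
    split_ifs <;> simp
  rw [matrixPhi, h1, matrixPsi, mul_assoc, ← mul_assoc (diagPow s _)]
  congr 1
  ext1 i k
  rw [diagPow, diagPow, Matrix.diagonal_mul_diagonal, Matrix.diagonal_mul, Matrix.of_apply,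
    ← mul_pow, twist_neg_one_carlitzOmega Fq hθ hτ]

/-- The equation `Ψ^{(-1)} = Φ Ψ`. -/
lemma matrixPsi_map_twist (hθ : 1 < ‖θ‖) (hτ : θ = -τ ^ (Fintype.card Fq - 1))
    (hs0 : ∀ m, 0 < s m) :
    (matrixPsi Fq θ τ (andersonThakurPoly Fq) s).map (twist Fq (-1)) =
      matrixPhi Fq θ (andersonThakurPoly Fq) s * matrixPsi Fq θ τ (andersonThakurPoly Fq) s := by
  rw [matrixPhi_mul_matrixPsi hθ hτ]
  ext1 i k
  rw [Matrix.map_apply, matrixPsi_apply, map_mul, map_pow]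
  refine Fin.cases ?_ (fun j => ?_) i
  · rw [matrixQ_mul_zero, Matrix.of_apply]
    congr 1
    conv_lhs => rw [← twist_one_matrixL_zero]
    exact twist_neg_one_twist_one Fq _
  -- The untwisted recursion contains the factor `(Ω^{(-1)})^(s_j)`, which is the discrepancy
  -- between the powers of `Ω^{(-1)}` in rows `j.succ` and `j.castSucc`.
  · have h := congrArg (twist Fq (-1)) (matrixL_succ (summable_termL hθ hτ hs0) j k)
    rw [map_add, map_mul, map_mul, map_pow, twist_neg_one_twist_one, twist_neg_one_twist_one] at h
    rw [matrixQ_mul_succ, Matrix.of_apply, Matrix.of_apply, tailSum_castSucc, h]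
    ring

/-- `Ψ` is invertible over the ring of power series which converge on the disk of radius `‖t‖`. -/
lemma exists_inverse_matrixPsi (hθ : 1 < ‖θ‖) (hτ : θ = -τ ^ (Fintype.card Fq - 1))
    (hs0 : ∀ m, 0 < s m) {c : ℝ} (hc : 0 ≤ c) (hcθ : c ≤ ‖θ‖) :
    ∃ M N : Matrix (Fin (r + 1)) (Fin (r + 1)) (PowerSeries.IsRestricted.subring (R := L) c),
      M.map (Subring.subtype _) = matrixPsi Fq θ τ (andersonThakurPoly Fq) s ∧
      N.map (Subring.subtype _) = (matrixPsi Fq θ τ (andersonThakurPoly Fq) s)⁻¹ ∧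
      N * M = 1 := by
  let R := PowerSeries.IsRestricted.subring (R := L) c
  let M : Matrix (Fin (r + 1)) (Fin (r + 1)) R := Matrix.of fun i k =>
    ⟨matrixPsi Fq θ τ (andersonThakurPoly Fq) s i k, isEntire_matrixPsi hθ hτ hs0 i k c⟩
  have hM : M.map (Subring.subtype R) = matrixPsi Fq θ τ (andersonThakurPoly Fq) s := rfl
  let ω : R := ⟨Ωs, isEntire_carlitzOmega Fq hθ hτ c⟩
  let ω' : R := ⟨_, isRestricted_omegaInv Fq (τ := τ) hθ hc hcθ⟩
  have hω : ω * ω' = 1 := Subtype.ext (isUnit_carlitzOmega Fq hθ hτ)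
  have hdet : M.det = ω ^ ∑ i, tailSum s i := by
    refine Subtype.ext ?_
    change Subring.subtype R M.det = Subring.subtype R (ω ^ _)
    rw [RingHom.map_det, map_pow]
    exact det_matrixPsi
  -- The inverse is taken over the subring of convergent series, where the determinant, a power of
  -- `Ω`, is a unit; so the entries of `Ψ⁻¹` converge too.
  have hu : IsUnit M.det := by
    rw [hdet]
    exact (IsUnit.of_mul_eq_one _ hω).pow _
  refine ⟨M, M⁻¹, hM, ?_, Matrix.nonsing_inv_mul _ hu⟩
  refine (Matrix.inv_eq_left_inv ?_).symm
  rw [← hM, ← Matrix.map_mul, Matrix.nonsing_inv_mul _ hu]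
  simp

lemma isUnit_det_matrixPsi (hθ : 1 < ‖θ‖) (hτ : θ = -τ ^ (Fintype.card Fq - 1)) :
    IsUnit (matrixPsi Fq θ τ (andersonThakurPoly Fq) s).det := by
  rw [det_matrixPsi]
  exact (IsUnit.of_mul_eq_one _ (isUnit_carlitzOmega Fq hθ hτ)).pow _

lemma isRestricted_inv_matrixPsi (hθ : 1 < ‖θ‖) (hτ : θ = -τ ^ (Fintype.card Fq - 1))
    (hs0 : ∀ m, 0 < s m) {c : ℝ} (hc : 0 ≤ c) (hcθ : c ≤ ‖θ‖) (i j : Fin (r + 1)) :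
    PowerSeries.IsRestricted c ((matrixPsi Fq θ τ (andersonThakurPoly Fq) s)⁻¹ i j) := by
  obtain ⟨-, N, -, hN, -⟩ := exists_inverse_matrixPsi hθ hτ hs0 hc hcθ
  rw [← hN]
  exact (N i j).2

theorem isRigidAnalyticTrivialization_matrixPsi (hθ : 1 < ‖θ‖)
    (hτ : θ = -τ ^ (Fintype.card Fq - 1)) (hs0 : ∀ m, 0 < s m) :
    IsRigidAnalyticTrivialization Fq (matrixPhi Fq θ (andersonThakurPoly Fq) s)
      (matrixPsi Fq θ τ (andersonThakurPoly Fq) s) where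
  restricted i j := isEntire_matrixPsi hθ hτ hs0 i j 1
  isUnit_det := isUnit_det_matrixPsi hθ hτ
  restricted_inv := isRestricted_inv_matrixPsi hθ hτ hs0 zero_le_one hθ.le
  uniformizability := matrixPsi_map_twist hθ hτ hs0

lemma matrixP_mul_evalAt (hθ : 1 < ‖θ‖) (hτ : θ = -τ ^ (Fintype.card Fq - 1))
    (hs0 : ∀ m, 0 < s m) :
    matrixP Fq θ τ (andersonThakurPoly Fq) s *
      (matrixPsi Fq θ τ (andersonThakurPoly Fq) s).map (evalAt θ) = 1 := by
  obtain ⟨M, N, hM, hN, hNM⟩ := exists_inverse_matrixPsi (Fq := Fq) hθ hτ hs0 (norm_nonneg θ) le_rfl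
  have h := congrArg (fun Z => Z.map (evalHom θ)) hNM
  simp only [Matrix.map_mul] at h
  have h1 : N.map (evalHom θ) = matrixP Fq θ τ (andersonThakurPoly Fq) s := by
    rw [matrixP, ← hN]
    rfl
  have h2 : M.map (evalHom θ) =
      (matrixPsi Fq θ τ (andersonThakurPoly Fq) s).map (evalAt θ) := by
    rw [← hM]
    rfl
  rw [← h1, ← h2, h]
  simp

lemma evalAt_termL (hθ : 1 < ‖θ‖) (hθ' : Transcendental Fq θ)
    (hτ : θ = -τ ^ (Fintype.card Fq - 1)) (hs0 : ∀ m, 0 < s m) (k i : Fin (r + 1))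
    (d : Block k i → ℕ) :
    evalAt θ (termL Fq s Ωs hs k i d) =
      (∏ m : Block k i, aeval θ (carlitzGamma Fq (s m.1))) *
        evalAt θ Ωs ^ (∑ m : Block k i, s m.1) * multiPowerSum Fq θ (fun m : Block k i => s m.1) d := by
  have hr : ∀ m : Block k i, PowerSeries.IsRestricted ‖θ‖ (twist Fq (d m) (Ωs ^ s m.1 * hs m.1)) :=
    fun m => isEntire_twist_omega_pow_mul hθ hτ m.1 (d m) ‖θ‖
  rw [termL, evalAt_prod _ hr, multiPowerSum, ← Finset.prod_pow_eq_pow_sum, ← Finset.prod_mul_distrib,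
    ← Finset.prod_mul_distrib]
  refine Finset.prod_congr rfl fun m _ => ?_
  rw [subdiagonal, evalAt_twist_omega_pow_mul Fq hθ hθ' hτ (hs0 m.1) (d m)]

lemma carlitzGamma_factor_ne_zero (hθ : 1 < ‖θ‖) (hθ' : Transcendental Fq θ)
    (hτ : θ = -τ ^ (Fintype.card Fq - 1)) (k i : Fin (r + 1)) :
    (∏ m : Block k i, aeval θ (carlitzGamma Fq (s m.1))) *
        evalAt θ Ωs ^ (∑ m : Block k i, s m.1) ≠ 0 :=
  mul_ne_zero (Finset.prod_ne_zero_iff.2 fun _ _ =>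
      aeval_ne_zero Fq hθ' (carlitzFactorial_ne_zero Fq _))
    (pow_ne_zero _ (evalAt_carlitzOmega_ne_zero Fq hθ hτ))

/-- The values at `T = t` of the terms of `L` are summable, and they are the products of power sums
times a fixed nonzero constant. -/
lemma summable_multiPowerSum (hθ : 1 < ‖θ‖) (hθ' : Transcendental Fq θ)
    (hτ : θ = -τ ^ (Fintype.card Fq - 1)) (hs0 : ∀ m, 0 < s m) (k i : Fin (r + 1)) :
    Summable fun d : {d : Block k i → ℕ // StrictAnti d} =>
      multiPowerSum Fq θ (fun m : Block k i => s m.1) d.1 := by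
  have h := ((gaussNull_termL hθ hτ hs0 (norm_nonneg θ) k i).evalAt_tsum
    (summable_termL hθ hτ hs0 k i) fun d => isEntire_termL hθ hτ k i d.1 _).1
  simp only [evalAt_termL hθ hθ' hτ hs0] at h
  exact (summable_mul_left_iff (carlitzGamma_factor_ne_zero hθ hθ' hτ k i)).1 h

lemma evalAt_matrixL (hθ : 1 < ‖θ‖) (hθ' : Transcendental Fq θ)
    (hτ : θ = -τ ^ (Fintype.card Fq - 1)) (hs0 : ∀ m, 0 < s m) {k i : Fin (r + 1)} (hki : k ≤ i) :
    evalAt θ (matrixL Fq s Ωs hs i k) =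
      (∏ m : Block k i, aeval θ (carlitzGamma Fq (s m.1))) *
        evalAt θ Ωs ^ (∑ m : Block k i, s m.1) * multizeta Fq θ (fun m : Block k i => s m.1) := by
  rw [matrixL, Matrix.of_apply, if_pos hki, ((gaussNull_termL hθ hτ hs0 (norm_nonneg θ) k i).evalAt_tsum
    (summable_termL hθ hτ hs0 k i) fun d => isEntire_termL hθ hτ k i d.1 _).2]
  simp only [evalAt_termL hθ hθ' hτ hs0]
  rw [tsum_mul_left, multizeta]

lemma tailSum_add_sum_block (s : Fin r → ℕ) {k i : Fin (r + 1)} (hki : k ≤ i) :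
    tailSum s i + ∑ m : Block k i, s m.1 = tailSum s k := by
  have h1 : ∑ m : Block k i, s m.1 = ∑ m : Fin r with k ≤ m.castSucc ∧ m.castSucc < i, s m :=
    (Finset.sum_subtype _ (fun m => by simp) s).symm
  rw [h1, tailSum, tailSum, ← Finset.sum_union]
  · refine Finset.sum_congr ?_ fun _ _ => rfl
    ext m
    simp only [Finset.mem_union, Finset.mem_filter, Finset.mem_univ, true_and]
    constructor
    · rintro (h | h)
      · exact hki.trans h
      · exact h.1
    · intro h
      rcases le_or_gt i m.castSucc with h' | h'
      · exact Or.inl h'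
      · exact Or.inr ⟨h, h'⟩
  · rw [Finset.disjoint_filter]
    intro m _ h h'
    exact not_le.2 h'.2 h

/-- `Λ` contributes the powers of `Ω(t) = 1/π̃` belonging to the indices from `i` on, and `L` those
of the block from `k` to `i`. -/
lemma evalAt_matrixPsi (hθ : 1 < ‖θ‖) (hθ' : Transcendental Fq θ)
    (hτ : θ = -τ ^ (Fintype.card Fq - 1)) (hs0 : ∀ m, 0 < s m) {k i : Fin (r + 1)} (hki : k ≤ i) :
    evalAt θ (matrixPsi Fq θ τ (andersonThakurPoly Fq) s i k) =
      (∏ m : Block k i, aeval θ (carlitzGamma Fq (s m.1))) *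
        multizeta Fq θ (fun m : Block k i => s m.1) / carlitzPi Fq θ τ ^ tailSum s k := by
  have hΩ : PowerSeries.IsRestricted ‖θ‖ Ωs := isEntire_carlitzOmega Fq hθ hτ _
  have hΩs : PowerSeries.IsRestricted ‖θ‖ (Ωs ^ tailSum s i) :=
    pow_mem (mem_restrictedSubring.2 hΩ) _
  rw [matrixPsi_apply, evalAt_mul hΩs (isEntire_matrixL hθ hτ hs0 i k _), evalAt_pow hΩ,
    evalAt_matrixL hθ hθ' hτ hs0 hki, carlitzPi, one_div, inv_pow, div_inv_eq_mul,
    ← tailSum_add_sum_block s hki, pow_add]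
  ring

end Trivialization

/-! ### Multizeta values of the full tuple -/

section Reindexing

variable {Fq : Type*} [Field Fq] {L : Type*} [NormedField L] [Algebra Fq L]

lemma multizeta_comp_orderIso {ι κ : Type*} [Fintype ι] [LinearOrder ι] [Fintype κ] [LinearOrder κ]
    (θ : L) (e : ι ≃o κ) (s : κ → ℕ) : multizeta Fq θ (fun m => s (e m)) = multizeta Fq θ s := by
  let E : {d : κ → ℕ // StrictAnti d} ≃ {d : ι → ℕ // StrictAnti d} :=
    { toFun := fun d => ⟨fun m => d.1 (e m), fun _ _ h => d.2 (e.strictMono h)⟩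
      invFun := fun d => ⟨fun m => d.1 (e.symm m), fun _ _ h => d.2 (e.symm.strictMono h)⟩
      left_inv := fun d => by ext; simp
      right_inv := fun d => by ext; simp }
  rw [multizeta, multizeta, ← E.tsum_eq]
  refine tsum_congr fun d => ?_
  exact e.toEquiv.prod_comp fun m => powerSum Fq θ (d.1 m) (s m)

/-- The block of all indices. -/
def blockUniv (r : ℕ) : Block (0 : Fin (r + 1)) (Fin.last r) ≃o Fin r where
  toFun m := m.1
  invFun m := ⟨m, Fin.zero_le _, Fin.castSucc_lt_last m⟩
  left_inv _ := rfl
  right_inv _ := rfl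
  map_rel_iff' := Iff.rfl

end Reindexing

/-! ### Bidiagonal matrices acting on row vectors -/

section MotiveMatrix

variable {R S : Type*} [CommRing R] [CommRing S] {r : ℕ}

lemma matrixQ_map (φ : R →+* S) (h : Fin r → R) :
    (matrixQ h).map φ = matrixQ fun m => φ (h m) := by
  ext1 i j
  simp only [matrixQ, Matrix.map_apply, Matrix.of_apply]
  split_ifs <;> simp

lemma diagPow_map (φ : R →+* S) (s : Fin r → ℕ) (y : R) :
    (diagPow s y).map φ = diagPow s (φ y) := by
  rw [diagPow, diagPow, Matrix.diagonal_map (map_zero φ)]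
  simp

lemma isUnit_det_matrixQ (h : Fin r → R) : IsUnit (matrixQ h).det := by
  have h1 : (matrixQ h).det = ∏ i, matrixQ h i i :=
    Matrix.det_of_isLowerTriangular _ fun i j (hij : i < j) => by
      rw [matrixQ, Matrix.of_apply, if_neg hij.ne, dif_neg]
      rw [Fin.lt_def] at hij
      omega
  rw [h1]
  simp [matrixQ]

lemma vecMul_matrixQ_last (f : Fin (r + 1) → R) (h : Fin r → R) :
    Matrix.vecMul f (matrixQ h) (Fin.last r) = f (Fin.last r) := by
  have : Matrix.vecMul f (matrixQ h) (Fin.last r) = ∑ i, f i * matrixQ h i (Fin.last r) := rfl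
  rw [this, Finset.sum_eq_single (Fin.last r)]
  · simp [matrixQ]
  · intro i _ hi
    have h2 : ¬ ((Fin.last r : Fin (r + 1)) : ℕ) + 1 = i := by
      rw [Fin.val_last]
      omega
    rw [matrixQ, Matrix.of_apply, if_neg hi, dif_neg h2, mul_zero]
  · simp

lemma vecMul_matrixQ_castSucc (f : Fin (r + 1) → R) (h : Fin r → R) (j : Fin r) :
    Matrix.vecMul f (matrixQ h) j.castSucc = f j.castSucc + f j.succ * h j := by
  have h0 : Matrix.vecMul f (matrixQ h) j.castSucc = ∑ i, f i * matrixQ h i j.castSucc := rfl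
  have hne : j.castSucc ≠ j.succ := Fin.castSucc_lt_succ.ne
  rw [h0, ← Finset.sum_subset (Finset.subset_univ {j.castSucc, j.succ}), Finset.sum_pair hne]
  · simp [matrixQ, hne.symm]
  · intro m _ hm
    simp only [Finset.mem_insert, Finset.mem_singleton, not_or] at hm
    have h2 : ¬ (j.castSucc : ℕ) + 1 = m := by
      intro h
      exact hm.2 (Fin.ext (by rw [Fin.val_succ, ← h, Fin.val_castSucc]))
    rw [matrixQ, Matrix.of_apply, if_neg hm.1, dif_neg h2, mul_zero]

lemma tailSum_le_zero (s : Fin r → ℕ) (i : Fin (r + 1)) : tailSum s i ≤ tailSum s 0 := by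
  rw [← tailSum_add_sum_block s (Fin.zero_le i)]
  exact Nat.le_add_right _ _

end MotiveMatrix

/-! ### The dual `t`-motive and its filtration -/

section Motive

variable (Fq : Type*) [Field Fq] [Fintype Fq] {F : Type*} [Field F] [PerfectField F] [Algebra Fq F]
variable {r : ℕ} (s : Fin r → ℕ) (g : Fin r → F[X]) (θ : F)

/-- The matrix `Q' [[T - t]]`, with `Q'` unipotent bidiagonal. -/
noncomputable def bidiagonalPhi : Matrix (Fin (r + 1)) (Fin (r + 1)) F[X] :=
  matrixQ g * diagPow s (X - C θ)

local notation "σs" => motiveSigma Fq (bidiagonalPhi s g θ)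

lemma motiveSigma_apply (f : Fin (r + 1) → F[X]) (i : Fin (r + 1)) :
    σs f i = Matrix.vecMul (fun j => polyTwist Fq (-1) (f j)) (matrixQ g) i *
      (X - C θ) ^ tailSum s i := by
  have h : σs f = Matrix.vecMul (fun j => polyTwist Fq (-1) (f j)) (bidiagonalPhi s g θ) := rfl
  rw [h, bidiagonalPhi, ← Matrix.vecMul_vecMul, diagPow, Matrix.vecMul_diagonal]

lemma isDualTMotive_bidiagonalPhi : IsDualTMotive Fq θ σs (r + 1) where
  free := inferInstance
  finite := inferInstance
  finrank_eq := by simp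
  semilinear p f := by
    have h : (fun j => polyTwist Fq (-1) ((p • f) j)) =
        polyTwist Fq (-1) p • fun j => polyTwist Fq (-1) (f j) := by
      funext j
      simp
    funext i
    rw [motiveSigma_apply, h, Matrix.smul_vecMul, Pi.smul_apply, Pi.smul_apply, motiveSigma_apply,
      smul_mul_assoc]
  cokernel := by
    refine ⟨tailSum s 0, fun f => ?_⟩
    -- The preimage: the power of `T - t` left over after division by the diagonal entry, then
    -- multiplication by the inverse of `Q'`, then a twist by 1 to undo that of `σ`.
    refine ⟨fun j => polyTwist Fq 1 (Matrix.vecMul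
      (fun i => f i * (X - C θ) ^ (tailSum s 0 - tailSum s i)) (matrixQ g)⁻¹ j), ?_⟩
    funext i
    rw [motiveSigma_apply]
    simp only [polyTwist_neg_one_polyTwist_one]
    rw [Matrix.vecMul_vecMul, Matrix.nonsing_inv_mul _ (isUnit_det_matrixQ g), Matrix.vecMul_one,
      mul_assoc, ← pow_add, Nat.sub_add_cancel (tailSum_le_zero s i), Pi.smul_apply, smul_eq_mul,
      mul_comm]

variable (F r) in
/-- The vectors supported on the first `n` coordinates. -/
def firstCoords (n : ℕ) : Submodule F[X] (Fin (r + 1) → F[X]) where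
  carrier := {f | ∀ j : Fin (r + 1), n ≤ j → f j = 0}
  add_mem' ha hb j hj := by rw [Pi.add_apply, ha j hj, hb j hj, add_zero]
  zero_mem' _ _ := rfl
  smul_mem' c f hf j hj := by rw [Pi.smul_apply, hf j hj, smul_zero]

omit [PerfectField F] in
lemma firstCoords_mono {m n : ℕ} (h : m ≤ n) : firstCoords F r m ≤ firstCoords F r n :=
  fun _ hf j hj => hf j (h.trans hj)

/-- The subdiagonal entry of column `i` meets the coordinate `i + 1 ≥ n`, which is zero. So on the
last nonzero coordinate `σ` is that of a Carlitz power. -/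
lemma motiveSigma_apply_of_mem {n : ℕ} {f : Fin (r + 1) → F[X]} {i : Fin (r + 1)} (hi : n ≤ i + 1)
    (hf : f ∈ firstCoords F r n) :
    σs f i = (X - C θ) ^ tailSum s i * polyTwist Fq (-1) (f i) := by
  rw [motiveSigma_apply, mul_comm]
  congr 1
  refine Fin.lastCases ?_ (fun j hi => ?_) i hi
  · intro _
    rw [vecMul_matrixQ_last]
  · rw [vecMul_matrixQ_castSucc, hf j.succ (by simpa using hi), map_zero, zero_mul, add_zero]

lemma motiveSigma_mem_firstCoords {n : ℕ} {f : Fin (r + 1) → F[X]} (hf : f ∈ firstCoords F r n) :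
    σs f ∈ firstCoords F r n := fun j hj => by
  rw [motiveSigma_apply_of_mem Fq s g θ (hj.trans (Nat.le_succ _)) hf, hf j hj, map_zero, mul_zero]

lemma isCarlitzFiltration_firstCoords :
    IsCarlitzFiltration Fq θ σs (tailSum s) fun i : Fin (r + 2) => firstCoords F r i where
  bot := by
    rw [eq_bot_iff]
    exact fun f hf => (Submodule.mem_bot _).2 (funext fun j => hf j (Nat.zero_le _))
  top := by
    rw [eq_top_iff]
    exact fun f _ j hj => absurd j.2 (not_lt.2 (by simpa using hj))
  le i := firstCoords_mono (by simp)
  stable i f hf := motiveSigma_mem_firstCoords Fq s g θ hf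
  quotient i := by
    refine ⟨(LinearMap.proj i).comp (Submodule.subtype _), fun p => ?_, fun f => ?_,
      fun f f' h => ?_⟩
    · refine ⟨⟨Pi.single i p, fun j hj => ?_⟩, ?_⟩
      · refine Pi.single_eq_of_ne ?_ _
        rintro rfl
        simp at hj
      · simp
    · refine ⟨fun h j hj => ?_, fun h => h i (by simp)⟩
      rcases (by simpa using hj : i ≤ j).eq_or_lt with rfl | hlt
      · exact h
      · exact f.2 j (by simpa [Nat.succ_le_iff] using hlt)
    · change (f' : Fin (r + 1) → F[X]) i = _
      rw [h, motiveSigma_apply_of_mem Fq s g θ (by simp) f.2]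
      rfl

omit [PerfectField F] in
/-- A triangular family, with one vector for each coordinate and degree, is a basis. -/
lemma linearIndependent_of_triangular {w : Fin r × ℕ → Fin (r + 1) → F[X]}
    (h1 : ∀ p, w p ∈ firstCoords F r (p.1 + 1))
    (h2 : ∀ p, (w p p.1.castSucc).Monic ∧ (w p p.1.castSucc).natDegree = p.2) :
    LinearIndependent F w := by
  classical
  rw [linearIndependent_iff']
  intro S c hc
  by_contra hcon
  push Not at hcon
  obtain ⟨p₀, hp₀, hcp₀⟩ := hcon
  -- For the lexicographically largest index `p` in the relation, no other term contributes to the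
  -- coefficient of `T^(p.2)` in coordinate `p.1`.
  obtain ⟨p, hp, hmax⟩ := Finset.exists_max_image (S.filter fun p => c p ≠ 0) toLex
    ⟨p₀, Finset.mem_filter.2 ⟨hp₀, hcp₀⟩⟩
  rw [Finset.mem_filter] at hp
  have h3 := congrArg (fun f : Fin (r + 1) → F[X] => (f p.1.castSucc).coeff p.2) hc
  simp only [Finset.sum_apply, Pi.smul_apply, finsetSum_coeff, coeff_smul, smul_eq_mul,
    Pi.zero_apply, coeff_zero] at h3
  rw [Finset.sum_eq_single_of_mem p hp.1] at h3
  · have h4 := (h2 p).1.coeff_natDegree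
    rw [(h2 p).2] at h4
    rw [h4, mul_one] at h3
    exact hp.2 h3
  · intro p' hp' hne
    by_cases hcp : c p' = 0
    · rw [hcp, zero_mul]
    have hle := hmax p' (Finset.mem_filter.2 ⟨hp', hcp⟩)
    rcases (Prod.Lex.le_iff.1 hle) with hlt | ⟨heq, hle'⟩
    · have hlt' : p'.1 < p.1 := hlt
      rw [h1 p' p.1.castSucc (by rw [Fin.val_castSucc]; exact hlt'), coeff_zero, mul_zero]
    · have heq' : p'.1 = p.1 := heq
      have hlt : p'.2 < p.2 :=
        lt_of_le_of_ne hle' fun h => hne (Prod.ext heq' h)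
      rw [← heq', coeff_eq_zero_of_natDegree_lt (by rw [(h2 p').2]; exact hlt), mul_zero]

omit [PerfectField F] in
-- Subtracting multiples of the `w (i, N)` lowers the degree of the last nonzero coordinate until it
-- vanishes; then the number of coordinates drops.
lemma span_of_triangular {w : Fin r × ℕ → Fin (r + 1) → F[X]}
    (h1 : ∀ p, w p ∈ firstCoords F r (p.1 + 1))
    (h2 : ∀ p, (w p p.1.castSucc).Monic ∧ (w p p.1.castSucc).natDegree = p.2) :
    Submodule.span F (Set.range w) = (firstCoords F r r).restrictScalars F := by
  refine le_antisymm (Submodule.span_le.2 ?_) ?_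
  · rintro _ ⟨p, rfl⟩
    exact firstCoords_mono p.1.2 (h1 p)
  · have key : ∀ n, n ≤ r → ∀ f ∈ firstCoords F r n, f ∈ Submodule.span F (Set.range w) := by
      intro n
      induction n with
      | zero =>
        intro _ f hf
        have : f = 0 := funext fun j => hf j (Nat.zero_le _)
        rw [this]
        exact zero_mem _
      | succ n ih =>
        intro hn
        let i : Fin r := ⟨n, hn⟩
        have aux : ∀ N : ℕ, ∀ f ∈ firstCoords F r (n + 1), (f i.castSucc).degree < N →
            f ∈ Submodule.span F (Set.range w) := by
          intro N
          induction N with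
          | zero =>
            intro f hf hdeg
            have h0 : f i.castSucc = 0 := by
              rw [← degree_eq_bot]
              exact Nat.WithBot.lt_zero_iff.1 hdeg
            refine ih (by omega) f fun j hj => ?_
            rcases Nat.eq_or_lt_of_le hj with h | h
            · have : j = i.castSucc := Fin.ext h.symm
              rw [this, h0]
            · exact hf j h
          | succ N ihN =>
            intro f hf hdeg
            have hw := h2 (i, N)
            have hw1 : w (i, N) ∈ firstCoords F r (n + 1) := h1 (i, N)
            have h3 : f - (f i.castSucc).coeff N • w (i, N) ∈
                Submodule.span F (Set.range w) := by
              refine ihN _ ?_ ?_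
              · exact sub_mem (S := Submodule F _) (H := (firstCoords F r (n + 1)).restrictScalars F)
                  hf (Submodule.smul_mem _ _ hw1)
              · rw [degree_lt_iff_coeff_zero] at hdeg ⊢
                intro m hm
                rw [Pi.sub_apply, Pi.smul_apply, coeff_sub, coeff_smul, smul_eq_mul]
                rcases Nat.eq_or_lt_of_le hm with rfl | hlt
                · have h4 := hw.1.coeff_natDegree
                  rw [hw.2] at h4
                  rw [h4, mul_one, sub_self]
                · have h5 : (w (i, N) i.castSucc).coeff m = 0 :=
                    coeff_eq_zero_of_natDegree_lt (lt_of_eq_of_lt hw.2 hlt)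
                  rw [hdeg m hlt, h5, mul_zero, sub_zero]
            have h4 := add_mem h3 (Submodule.smul_mem (Submodule.span F (Set.range w))
              ((f i.castSucc).coeff N) (Submodule.subset_span ⟨(i, N), rfl⟩))
            rwa [sub_add_cancel] at h4
        intro f hf
        exact aux ((f i.castSucc).natDegree + 1) f hf
          (degree_le_natDegree.trans_lt (by exact_mod_cast Nat.lt_succ_self _))
    exact fun f hf => key r le_rfl f hf

/-- The twist keeps the top coordinate monic of the same degree, and `σ` then multiplies it by `(T -
t)^w`, with `w` the tail sum at `i`. By division with remainder, the `j < w` and all `n` give each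
degree exactly once. -/
lemma motiveSigma_iterate_single (i : Fin r) (j n : ℕ) :
    let f := σs^[n] (Pi.single i.castSucc ((X - C θ) ^ j))
    f ∈ firstCoords F r (i + 1) ∧ (f i.castSucc).Monic ∧
      (f i.castSucc).natDegree = n * tailSum s i.castSucc + j := by
  induction n with
  | zero =>
    simp only [Function.iterate_zero, id_eq, Pi.single_eq_same]
    refine ⟨fun m hm => Pi.single_eq_of_ne ?_ _, (monic_X_sub_C θ).pow j, ?_⟩
    · rintro rfl
      simp at hm
    · rw [natDegree_pow, natDegree_X_sub_C]
      ring
  | succ n ih =>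
    obtain ⟨ih1, ih2, ih3⟩ := ih
    simp only [Function.iterate_succ_apply']
    have hm : (polyTwist Fq (-1) ((σs^[n] (Pi.single i.castSucc ((X - C θ) ^ j))) i.castSucc)).Monic :=
      ih2.map _
    rw [motiveSigma_apply_of_mem Fq s g θ (by simp) ih1]
    refine ⟨motiveSigma_mem_firstCoords Fq s g θ ih1, ((monic_X_sub_C θ).pow _).mul hm, ?_⟩
    rw [((monic_X_sub_C θ).pow _).natDegree_mul hm, natDegree_pow, natDegree_X_sub_C]
    have h4 : (polyTwist Fq (-1)
        ((σs^[n] (Pi.single i.castSucc ((X - C θ) ^ j))) i.castSucc)).natDegree =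
        n * tailSum s i.castSucc + j := by
      rw [← ih3]
      exact natDegree_map _
    rw [h4]
    ring

/-- Division with remainder by positive numbers `t i`. -/
def divModEquiv {t : Fin r → ℕ} (ht : ∀ i, 0 < t i) : Fin r × ℕ ≃ (Σ i : Fin r, Fin (t i)) × ℕ where
  toFun p := (⟨p.1, p.2 % t p.1, Nat.mod_lt _ (ht _)⟩, p.2 / t p.1)
  invFun q := (q.1.1, q.2 * t q.1.1 + q.1.2)
  left_inv p := Prod.ext rfl (Nat.div_add_mod' _ _)
  right_inv q := by
    obtain ⟨⟨i, j⟩, n⟩ := q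
    refine Prod.ext (Sigma.ext rfl (heq_of_eq (Fin.ext ?_))) ?_
    · change (n * t i + j) % t i = j
      rw [mul_comm, Nat.mul_add_mod, Nat.mod_eq_of_lt j.2]
    · change (n * t i + j) / t i = n
      rw [mul_comm, Nat.mul_add_div (ht i), Nat.div_eq_of_lt j.2, add_zero]

/-- The basis consists of the `(T - t)^j e_i` with `j` less than the tail sum at `i`, which is
positive for these `i`. The last coordinate is excluded: its tail sum is 0, so `σ` does not raise
degrees there. -/
lemma isSigmaFree_firstCoords (hs : ∀ m, 0 < s m) :
    IsSigmaFree σs ((firstCoords F r r).restrictScalars F) := by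
  have ht : ∀ i : Fin r, 0 < tailSum s i.castSucc := fun i => by
    rw [tailSum_castSucc]
    exact Nat.add_pos_left (hs i) _
  let e' := Fintype.equivFin (Σ i : Fin r, Fin (tailSum s i.castSucc))
  let e := (divModEquiv ht).trans (e'.prodCongr (Equiv.refl ℕ))
  let b (x : Σ i : Fin r, Fin (tailSum s i.castSucc)) : Fin (r + 1) → F[X] :=
    Pi.single x.1.castSucc ((X - C θ) ^ (x.2 : ℕ))
  let w (q : _ × ℕ) : Fin (r + 1) → F[X] := σs^[q.2] (b (e'.symm q.1))
  have hw : ∀ p, w (e p) = σs^[p.2 / tailSum s p.1.castSucc]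
      (Pi.single p.1.castSucc ((X - C θ) ^ (p.2 % tailSum s p.1.castSucc))) := by
    intro p
    change σs^[_] (b (e'.symm (e' (divModEquiv ht p).1))) = _
    rw [Equiv.symm_apply_apply]
    rfl
  have key := fun p : Fin r × ℕ => motiveSigma_iterate_single Fq s g θ p.1
    (p.2 % tailSum s p.1.castSucc) (p.2 / tailSum s p.1.castSucc)
  simp only [← hw, Nat.div_add_mod'] at key
  have h1 : ∀ p, (w ∘ e) p ∈ firstCoords F r (p.1 + 1) := fun p => (key p).1
  have h2 : ∀ p, ((w ∘ e) p p.1.castSucc).Monic ∧ ((w ∘ e) p p.1.castSucc).natDegree = p.2 :=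
    fun p => (key p).2
  refine ⟨_, fun a => b (e'.symm a), ?_, ?_⟩
  · exact (linearIndependent_equiv e).1 (linearIndependent_of_triangular h1 h2)
  · rw [← span_of_triangular h1 h2, e.surjective.range_comp]

end Motive

/-! ### Integrality of `Φ` -/

section CarlitzPhi

variable (Fq : Type*) [Field Fq] [Fintype Fq] {r : ℕ} (s : Fin r → ℕ)

/-- The matrix `Φ = Q^{(-1)} [[T - t]]`, with entries in `A[T]`. -/
noncomputable def integralPhi : Matrix (Fin (r + 1)) (Fin (r + 1)) Fq[X][X] :=
  matrixQ (fun m => andersonThakurTwist Fq (s m - 1)) * diagPow s (X - C X)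

/-- `H_n` arises from an element of `A[T]` by `t ↦ t^q`, so the twist by `-1` introduces no roots of
`t`. -/
lemma integralPhi_map_toPowerSeries {L : Type*} [NormedField L] [PerfectField L] [Algebra Fq L]
    (θ : L) : (integralPhi Fq s).map (toPowerSeries Fq θ) =
      matrixPhi Fq θ (andersonThakurPoly Fq) s := by
  have h : ∀ m, twist Fq (-1) (subdiagonal Fq θ (andersonThakurPoly Fq) s m) =
      toPowerSeries Fq θ (andersonThakurTwist Fq (s m - 1)) := fun m => by
    rw [subdiagonal, andersonThakurPoly, toPowerSeries_coeffExpand, twist_neg_one_twist_one]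
  rw [integralPhi, matrixPhi, Matrix.map_mul, matrixQ_map, matrixQ_map, diagPow_map]
  simp only [h]
  congr 2
  simp [toPowerSeries]

lemma integralPhi_map {F : Type*} [Field F] [Algebra Fq F] (θ : F) :
    (integralPhi Fq s).map (Polynomial.map ((aeval θ : Fq[X] →ₐ[Fq] F) : Fq[X] →+* F)) =
      bidiagonalPhi s (fun m => (andersonThakurTwist Fq (s m - 1)).map
        ((aeval θ : Fq[X] →ₐ[Fq] F) : Fq[X] →+* F)) θ := by
  rw [← coe_mapRingHom, integralPhi, bidiagonalPhi, Matrix.map_mul, matrixQ_map, diagPow_map]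
  simp

end CarlitzPhi

end CarlitzMZV

/-! ### The main theorem -/

open CarlitzMZV in
theorem mainTheorem1 (Fq : Type*) [Field Fq] [Fintype Fq] :
    ∃ H : ℕ → Fq[X][X], IsAndersonThakur Fq H ∧
    ∀ (t τ : CInfty Fq), t = tInfty Fq → t = -τ ^ (Fintype.card Fq - 1) →
    ∀ (r : ℕ) (s : Fin r → ℕ), (∀ m, 0 < s m) →
    -- convergence of the product `Ω`, of the series defining `L`, and of the multizeta values
    Multipliable (omegaFactor Fq t) ∧
    (∀ c : ℝ, PowerSeries.IsRestricted c (carlitzOmega Fq t τ)) ∧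
    evalAt t (carlitzOmega Fq t τ) ≠ 0 ∧
    (∀ k i : Fin (r + 1), Summable fun d : {d : Block k i → ℕ // StrictAnti d} =>
      termL Fq s (carlitzOmega Fq t τ) (subdiagonal Fq t H s) k i d.1) ∧
    (∀ k i : Fin (r + 1), Summable fun d : {d : Block k i → ℕ // StrictAnti d} =>
      multiPowerSum Fq t (fun m : Block k i => s m.1) d.1) ∧
    -- `Φ` has entries in `A[T]`, and defines over every perfect `A`-field a dual `t`-motive of
    -- rank `r + 1`, which is an iterated extension of tensor powers of the Carlitz motive
    (∃ ΦA : Matrix (Fin (r + 1)) (Fin (r + 1)) Fq[X][X],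
      ΦA.map (toPowerSeries Fq t) = matrixPhi Fq t H s ∧
      ∀ (F : Type*) [Field F] [PerfectField F] [Algebra Fq F] (θ : F)
        (ΦF : Matrix (Fin (r + 1)) (Fin (r + 1)) F[X]),
        ΦF = ΦA.map (Polynomial.map ((aeval θ : Fq[X] →ₐ[Fq] F) : Fq[X] →+* F)) →
        IsDualTMotive Fq θ (motiveSigma Fq ΦF) (r + 1) ∧
        ∃ W : Fin (r + 2) → Submodule F[X] (Fin (r + 1) → F[X]),
          IsCarlitzFiltration Fq θ (motiveSigma Fq ΦF) (tailSum s) W ∧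
          IsSigmaFree (motiveSigma Fq ΦF) ((W (Fin.last r).castSucc).restrictScalars F)) ∧
    -- `Ψ` is a rigid analytic trivialization, with entries converging everywhere
    IsRigidAnalyticTrivialization Fq (matrixPhi Fq t H s) (matrixPsi Fq t τ H s) ∧
    (∀ i k, ∀ c : ℝ, PowerSeries.IsRestricted c (matrixPsi Fq t τ H s i k)) ∧
    -- the value of `Ψ⁻¹` at `T = t` is a period matrix, with inverse the value of `Ψ` at `T = t`
    IsPeriodMatrix Fq t (matrixPhi Fq t H s) (matrixP Fq t τ H s) ∧
    IsUnit (matrixP Fq t τ H s).det ∧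
    (matrixP Fq t τ H s)⁻¹ = (matrixPsi Fq t τ H s).map (evalAt t) ∧
    -- the entries of the inverse of the period matrix
    (∀ i k : Fin (r + 1), k ≤ i →
      (matrixP Fq t τ H s)⁻¹ i k =
        (∏ m : Block k i, aeval t (carlitzGamma Fq (s m.1))) *
          multizeta Fq t (fun m : Block k i => s m.1) / carlitzPi Fq t τ ^ tailSum s k) ∧
    (∀ i k : Fin (r + 1), i < k → (matrixP Fq t τ H s)⁻¹ i k = 0) ∧
    (matrixP Fq t τ H s)⁻¹ (Fin.last r) 0 =
      (∏ m, aeval t (carlitzGamma Fq (s m))) * multizeta Fq t s /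
        carlitzPi Fq t τ ^ ∑ m, s m := by
  refine ⟨andersonThakurPoly Fq, isAndersonThakur_andersonThakurPoly Fq, ?_⟩
  rintro t τ rfl hτ r s hs
  have hθ := one_lt_norm_tInfty Fq
  have hθ' := transcendental_tInfty Fq
  have hΨ := isRigidAnalyticTrivialization_matrixPsi hθ hτ hs
  have hP := matrixP_mul_evalAt hθ hτ hs
  -- The inverse of the period matrix is `Ψ(t)`, so its entries are read from `Ψ` and never from
  -- `Ψ⁻¹`.
  have hinv := Matrix.inv_eq_right_inv hP
  refine ⟨multipliable_omegaFactor Fq hθ, isEntire_carlitzOmega Fq hθ hτ,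
    evalAt_carlitzOmega_ne_zero Fq hθ hτ, summable_termL hθ hτ hs,
    summable_multiPowerSum hθ hθ' hτ hs, ⟨integralPhi Fq s, integralPhi_map_toPowerSeries Fq s _,
      ?_⟩, hΨ, isEntire_matrixPsi hθ hτ hs,
    hΨ.isPeriodMatrix (isRestricted_inv_matrixPsi hθ hτ hs (norm_nonneg _) le_rfl),
    Matrix.isUnit_det_of_right_inverse hP, hinv, ?_, ?_, ?_⟩
  · rintro F _ _ _ θ _ rfl
    rw [integralPhi_map]
    exact ⟨isDualTMotive_bidiagonalPhi Fq s _ θ, fun i => firstCoords F r i,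
      isCarlitzFiltration_firstCoords Fq s _ θ, isSigmaFree_firstCoords Fq s _ θ hs⟩
  · intro i k hki
    rw [hinv, Matrix.map_apply, evalAt_matrixPsi hθ hθ' hτ hs hki]
  · intro i k hik
    rw [hinv, Matrix.map_apply, matrixPsi_apply, matrixL_of_lt hik]
    simp [evalAt]
  · rw [hinv, Matrix.map_apply, evalAt_matrixPsi hθ hθ' hτ hs (Fin.zero_le _),
      ← multizeta_comp_orderIso (tInfty Fq) (blockUniv r) s,
      ← (blockUniv r).toEquiv.prod_comp]
    simp [tailSum]
    rfl
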